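/- Conventions. For $V$ a complex vector space with a vertex operator $Y(a,z)=\sum_{n\in\mathbf Z}a(n)z^{-n-1}$, a *quasi-vertex operator algebra* (QVOA) $(V,Y,\mathbf 1,\rho)$ is a vertex algebra with a grading $V=\bigoplus_{k\in\mathbf Z}V_k$, $\dim V_k<\infty$, $V_k=0$ for $k\ll 0$, $V_k(n)V_\ell\subseteq V_{k+\ell-n-1}$, together with a representation $\rho$ of $\mathfrak{sl}_2$ by operators $L(0)=\rho\begin{pmatrix}1/2&0\\0&-1/2\end{pmatrix}$, $L(-1)=\rho\begin{pmatrix}0&1\\0&0\end{pmatrix}$, $L(1)=\rho\begin{pmatrix}0&0\\-1&0\end{pmatrix}$, such that $L(0)$ acts on $V_k$ as $k$, $L(-1)a=a(-2)\mathbf 1$, $(L(-1)a)(n)=-na(n-1)=[L(-1),a(n)]$, and $[L(1),a(n)]=(L(1)a)(n)+(2k-n-2)a(n+1)$ for $a\in V_k$. A *doubled* QVOA is a QVOA in which the states of conformal degree $n$ are given weight $2n$ (and there are no nonzero states of odd weight); $V^{(2)}$ denotes $V$ with the doubled grading. For $\gamma=\begin{pmatrix}a&b\\c&d\end{pmatrix}\in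 SL_2(\mathbf Z)$ and $\tau$ in the upper half-plane $\mathcal H$ put $j=c\tau+d$, $X=c/(c\tau+d)$. A *holomorphic quasi-modular form of weight $k$* is a function $f:\mathcal H\to\mathbf C$ such that, for some $s$ and some functions $Q_0(f),\dots,Q_s(f)$ that are holomorphic on $\mathcal H$ and at the cusp, $j^{-k}f(\gamma\tau)=\sum_{n=0}^sX^nQ_n(f)(\tau)$ for all $\gamma\in SL_2(\mathbf Z)$ and $\tau\in\mathcal H$ (so $f=Q_0(f)$). Let $Q_k$ be the space of these, $Q=\bigoplus_{k\ge 0}Q_{2k}$, and let $Q^{(1/2)}$ be the algebra $Q$ with the grading $Q^{(1/2)}_k=Q_{2k}$. For a QVOA $V$, a *holomorphic $V$-valued quasi-modular form of weight $k$* is a function $f:\mathcal H\to V$ such that, for some $N$ and $s$ and some maps $Q_0(f),\dots,Q_s(f):\mathcal H\to\bigoplus_{n\le N}V_n$ that are holomorphic on $\mathcal H$ and at the cusp, $j^{-k}K(\gamma,\tau)^{-1}f(\gamma\tau)=\sum_{n=0}^sX^nQ_n(f)(\tau)$ for all $\gamma,\tau$, where $K(\gamma,\tau)=\exp(-cj\,L(1))\,j^{-2L(0)}$.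 Let $Q_k(V)$ be the space of these and $Q(V)=\bigoplus_{k\in\mathbf Z}Q_{2k}(V)$. **Theorem.** (1) $E_2,E_4,E_6$ are algebraically independent and $Q=\mathbf C[E_2,E_4,E_6]$. Let $\theta=q\,\frac{d}{dq}=\frac1{2\pi i}\frac{d}{d\tau}$. The graded algebra $Q^{(1/2)}$, with vacuum $1$, vertex operator $Y(f,z)g=(e^{z\theta}f)g$ (that is, $f(n)g=0$ and $f(-n-1)g=\frac1{n!}(\theta^nf)g$ for $n\ge 0$) and the $\mathfrak{sl}_2$-action $L(-1)=\theta$, $L(0)=$ the Euler operator ($k$ on $Q^{(1/2)}_k$), $L(1)=12\,\partial/\partial E_2$, is a quasi-vertex operator algebra. (2) Let $V$ be a QVOA. The tensor product $Q^{(1/2)}\otimes V$ (with vacuum $1\otimes\mathbf 1$, modes $(a\otimes b)(n)=\sum_{i+j+1=n}a(i)\otimes b(j)$, the tensor product grading and the tensor product representation of $\mathfrak{sl}_2$) is a QVOA. The map $f\otimes v\mapsto f(\tau)v$ is a linear isomorphism from $Q^{(1/2)}\otimes V$ onto $Q(V)$; transporting the structure along it makes $Q(V)$ a doubled QVOA whose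 space of weight $m$ is the space of $V$-valued quasi-modular forms of weight $m$ in $Q(V)$, for every $m\in\mathbf Z$. In particular $Q(V)\cong Q\otimes V^{(2)}$ as graded spaces. -/

import Mathlib

open UpperHalfPlane ModularForm EisensteinSeries
open scoped MatrixGroups Manifold TensorProduct

noncomputable section

attribute [local instance 100] LieRing.ofAssociativeRing

/-! ### The Lie algebra of traceless complex two-by-two matrices -/

/-- The Lie algebra of traceless complex `2 × 2` matrices. -/
abbrev SL2C : Type := LieAlgebra.SpecialLinear.sl (Fin 2) ℂ

/-- The matrix `(1/2, 0; 0, -1/2)`, which acts as `L(0)`. -/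
def sl2Euler : SL2C := ⟨!![1 / 2, 0; 0, -1 / 2], by
  change Matrix.trace (!![1 / 2, 0; 0, -1 / 2] : Matrix (Fin 2) (Fin 2) ℂ) = 0
  norm_num [Matrix.trace_fin_two]⟩

/-- The matrix `(0, 1; 0, 0)`, which acts as `L(-1)`. -/
def sl2Raise : SL2C := ⟨!![0, 1; 0, 0], by
  change Matrix.trace (!![0, 1; 0, 0] : Matrix (Fin 2) (Fin 2) ℂ) = 0
  simp [Matrix.trace_fin_two]⟩

/-- The matrix `(0, 0; -1, 0)`, which acts as `L(1)`. -/
def sl2Lower : SL2C := ⟨!![0, 0; -1, 0], by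
  change Matrix.trace (!![0, 0; -1, 0] : Matrix (Fin 2) (Fin 2) ℂ) = 0
  simp [Matrix.trace_fin_two]⟩

/-! ### Vertex algebras and quasi-vertex operator algebras -/

/-- A vertex algebra over `ℂ` with Fock space `V`. A Mathlib `VertexOperator ℂ V` is exactly a
field `a(z) = ∑ a(n) z ^ (-n-1)`, i.e. `a(n) b = 0` for every `b` and all large `n`. All sums in the
Jacobi identity have only finitely many nonzero terms. -/
structure VertexAlg (V : Type*) [AddCommGroup V] [Module ℂ V] where
  /-- the state-field correspondence -/
  Y : V →ₗ[ℂ] VertexOperator ℂ V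
  /-- the vacuum state -/
  vac : V
  vac_ne_zero : vac ≠ 0
  /-- every field is creative -/
  creative : ∀ (a : V) (n : ℤ), 0 ≤ n → (Y a).ncoeff n vac = 0
  /-- the field of `a` creates `a` -/
  creates : ∀ a : V, (Y a).ncoeff (-1) vac = a
  /-- the Jacobi identity -/
  jacobi : ∀ (a b c : V) (r s t : ℤ),
    ∑ᶠ i : ℕ, Ring.choose r i •
        (Y ((Y a).ncoeff (t + i) b)).ncoeff (r + s - i) c =
      ∑ᶠ i : ℕ, ((-1 : ℤ) ^ i * Ring.choose t i) •
        ((Y a).ncoeff (r + t - i) ((Y b).ncoeff (s + i) c) -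
          (Int.negOnePow t : ℤ) • (Y b).ncoeff (s + t - i) ((Y a).ncoeff (r + i) c))

/-- The mode `a(n)`. -/
def VertexAlg.mode {V : Type*} [AddCommGroup V] [Module ℂ V] (S : VertexAlg V) (a : V) (n : ℤ) :
    Module.End ℂ V :=
  (S.Y a).ncoeff n

/-- A `ℤ`-graded vertex algebra: finite-dimensional homogeneous spaces, bounded below. -/
structure GradedVertexAlg (V : Type*) [AddCommGroup V] [Module ℂ V] extends VertexAlg V where
  /-- the space of states of conformal degree `k` -/
  grading : ℤ → Submodule ℂ V
  internal : DirectSum.IsInternal grading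
  mode_mem : ∀ (k l n : ℤ) (a b : V), a ∈ grading k → b ∈ grading l →
    toVertexAlg.mode a n b ∈ grading (k + l - n - 1)
  finiteDimensional : ∀ k, FiniteDimensional ℂ (grading k)
  bounded_below : ∃ N : ℤ, ∀ k < N, grading k = ⊥

/-- A quasi-vertex operator algebra. -/
structure QVOA (V : Type*) [AddCommGroup V] [Module ℂ V] extends GradedVertexAlg V where
  /-- the representation of `sl₂` -/
  rho : SL2C →ₗ⁅ℂ⁆ Module.End ℂ V
  /-- `L(0)` is the Euler operator -/
  rho_euler : ∀ (k : ℤ) (a : V), a ∈ grading k → rho sl2Euler a = (k : ℂ) • a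
  /-- `L(-1)` is the canonical derivation -/
  rho_raise : ∀ a : V, rho sl2Raise a = toVertexAlg.mode a (-2) vac
  /-- translation covariance, first equality -/
  translation : ∀ (a : V) (n : ℤ),
    toVertexAlg.mode (rho sl2Raise a) n = (-n : ℂ) • toVertexAlg.mode a (n - 1)
  /-- translation covariance, second equality -/
  translation_bracket : ∀ (a : V) (n : ℤ),
    ⁅rho sl2Raise, toVertexAlg.mode a n⁆ = (-n : ℂ) • toVertexAlg.mode a (n - 1)
  /-- the commutator of `L(1)` with the modes -/
  lower_bracket : ∀ (k : ℤ) (a : V), a ∈ grading k → ∀ n : ℤ,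
    ⁅rho sl2Lower, toVertexAlg.mode a n⁆ =
      toVertexAlg.mode (rho sl2Lower a) n + (2 * k - n - 2 : ℂ) • toVertexAlg.mode a (n + 1)

/-- A doubled quasi-vertex operator algebra: a quasi-vertex operator algebra whose states of
conformal degree `n` are assigned the weight `2 n`. -/
structure DoubledQVOA (V : Type*) [AddCommGroup V] [Module ℂ V] extends QVOA V where
  /-- the space of states of weight `m` -/
  weight : ℤ → Submodule ℂ V
  weight_even : ∀ n : ℤ, weight (2 * n) = grading n
  weight_odd : ∀ m : ℤ, Odd m → weight m = ⊥

/-- A linear equivalence is an isomorphism of quasi-vertex operator algebras if it preserves the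
vacuum and all products and intertwines the `sl₂`-actions. -/
structure IsQVOAIso {U V : Type*} [AddCommGroup U] [Module ℂ U] [AddCommGroup V] [Module ℂ V]
    (A : QVOA U) (B : QVOA V) (f : U ≃ₗ[ℂ] V) : Prop where
  map_vac : f A.vac = B.vac
  map_mode : ∀ (a b : U) (n : ℤ), f (A.mode a n b) = B.mode (f a) n (f b)
  map_rho : ∀ (x : SL2C) (a : U), f (A.rho x a) = B.rho x (f a)

/-- `T` is the tensor product of the quasi-vertex operator algebras `A` and `B`. Only finitely many
terms of the sum in `mode` are nonzero. -/
structure IsTensorQVOA {U V : Type*} [AddCommGroup U] [Module ℂ U] [AddCommGroup V] [Module ℂ V]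
    (A : QVOA U) (B : QVOA V) (T : QVOA (U ⊗[ℂ] V)) : Prop where
  vac : T.vac = A.vac ⊗ₜ[ℂ] B.vac
  mode : ∀ (a c : U) (b d : V) (n : ℤ),
    T.mode (a ⊗ₜ[ℂ] b) n (c ⊗ₜ[ℂ] d) =
      ∑ᶠ i : ℤ, A.mode a i c ⊗ₜ[ℂ] B.mode b (n - 1 - i) d
  grading : ∀ n : ℤ, T.grading n =
    ⨆ k : ℤ, Submodule.map₂ (TensorProduct.mk ℂ U V) (A.grading k) (B.grading (n - k))
  rho : ∀ x : SL2C, T.rho x =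
    TensorProduct.map (A.rho x) LinearMap.id + TensorProduct.map LinearMap.id (B.rho x)

/-! ### The operators `z ^ L(0)` and `exp (x L(1))` -/

namespace QVOA

variable {V : Type*} [AddCommGroup V] [Module ℂ V] (S : QVOA V)

/-- The operator `z ^ L(0)`, acting on states of conformal degree `m` as `z ^ m`. -/
def powL0 (z : ℂ) : Module.End ℂ V :=
  (DirectSum.toModule ℂ ℤ V fun m => z ^ m • (S.grading m).subtype) ∘ₗ
    (LinearEquiv.ofBijective (DirectSum.coeLinearMap S.grading) S.internal).symm.toLinearMap

theorem powL0_apply (z : ℂ) {m : ℤ} {v : V} (hv : v ∈ S.grading m) :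
    S.powL0 z v = z ^ m • v := by
  have h : (LinearEquiv.ofBijective (DirectSum.coeLinearMap S.grading) S.internal).symm v =
      DirectSum.lof ℂ ℤ (fun i => S.grading i) m ⟨v, hv⟩ := by
    rw [LinearEquiv.symm_apply_eq]
    exact (DirectSum.coeLinearMap_lof S.grading m ⟨v, hv⟩).symm
  simp [powL0, h, DirectSum.toModule_lof]

theorem grading_induction {p : V → Prop} (h0 : p 0) (hadd : ∀ x y, p x → p y → p (x + y))
    (hmem : ∀ (m : ℤ) (x : V), x ∈ S.grading m → p x) (v : V) : p v := by
  have hv : v ∈ ⨆ m, S.grading m := by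
    rw [S.internal.submodule_iSup_eq_top]
    trivial
  exact Submodule.iSup_induction S.grading (motive := p) hv hmem h0 hadd

theorem lower_mem {m : ℤ} {v : V} (hv : v ∈ S.grading m) :
    S.rho sl2Lower v ∈ S.grading (m - 1) := by
  have hbr : ⁅sl2Euler, sl2Lower⁆ = -sl2Lower := by
    apply Subtype.ext
    rw [LieAlgebra.SpecialLinear.sl_bracket]
    ext i j
    fin_cases i <;> fin_cases j <;> norm_num [sl2Euler, sl2Lower]
  have hE : S.rho sl2Euler (S.rho sl2Lower v) = ((m - 1 : ℤ) : ℂ) • S.rho sl2Lower v := by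
    have h := congrArg (fun f : Module.End ℂ V => f v) (S.rho.map_lie sl2Euler sl2Lower)
    simp only [hbr, map_neg, LieRing.of_associative_ring_bracket, LinearMap.neg_apply,
      LinearMap.sub_apply, Module.End.mul_apply, S.rho_euler m v hv, map_smul] at h
    rw [eq_sub_iff_add_eq] at h
    rw [← h]
    push_cast
    module
  set w := S.rho sl2Lower v
  have hw : w ∈ ⨆ i, S.grading i := by
    rw [S.internal.submodule_iSup_eq_top]
    trivial
  have hind := (Module.End.eigenspaces_iSupIndep (S.rho sl2Euler)).comp
    (Int.cast_injective (α := ℂ))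
  have hle : ∀ i, S.grading i ≤ Module.End.eigenspace (S.rho sl2Euler) (i : ℂ) := fun i x hx =>
    Module.End.mem_eigenspace_iff.2 (S.rho_euler i x hx)
  have hsup : ⨆ i, S.grading i ≤ S.grading (m - 1) ⊔ ⨆ i, ⨆ _ : i ≠ m - 1, S.grading i := by
    refine iSup_le fun i => ?_
    by_cases h : i = m - 1
    · subst h
      exact le_sup_left
    · exact le_trans (le_iSup₂ (f := fun i (_ : i ≠ m - 1) => S.grading i) i h) le_sup_right
  have hw := Submodule.mem_sup.1 (hsup hw)
  obtain ⟨a, ha, b, hb, hab⟩ := hw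
  have hb0 : b = 0 := by
    refine Submodule.disjoint_def.1 (hind (m - 1)) b ?_ ?_
    · have : b = w - a := by rw [← hab]; abel
      rw [this]
      exact Submodule.sub_mem _ (Module.End.mem_eigenspace_iff.2 hE) (hle _ ha)
    · exact (iSup₂_mono fun i _ => hle i) hb
  rw [← hab, hb0, add_zero]
  exact ha

/-- `L(1)` is locally nilpotent. -/
theorem lower_locally_nilpotent (v : V) :
    ∃ N : ℕ, ∀ n ≥ N, (S.rho sl2Lower ^ n) v = 0 := by
  induction v using S.grading_induction with
  | h0 => exact ⟨0, fun n _ => map_zero _⟩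
  | hadd x y hx hy =>
    obtain ⟨N, hN⟩ := hx
    obtain ⟨M, hM⟩ := hy
    exact ⟨max N M, fun n hn => by
      rw [map_add, hN n (le_trans (le_max_left _ _) hn), hM n (le_trans (le_max_right _ _) hn),
        add_zero]⟩
  | hmem m x hx =>
    obtain ⟨B, hB⟩ := S.bounded_below
    have hpow : ∀ n : ℕ, (S.rho sl2Lower ^ n) x ∈ S.grading (m - n) := by
      intro n
      induction n with
      | zero => simpa using hx
      | succ n ih =>
        rw [pow_succ', Module.End.mul_apply]
        have := S.lower_mem ih
        rwa [show m - ((n + 1 : ℕ) : ℤ) = m - n - 1 by push_cast; ring]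
    refine ⟨(m - B + 1).toNat, fun n hn => ?_⟩
    have h := hpow n
    rw [hB (m - n) (by omega)] at h
    exact (Submodule.mem_bot ℂ).1 h

theorem finsum_eq_sum_range {x : ℂ} {v : V} {N : ℕ}
    (hN : ∀ n ≥ N, (S.rho sl2Lower ^ n) v = 0) :
    ∑ᶠ n : ℕ, (x ^ n / n.factorial) • (S.rho sl2Lower ^ n) v =
      ∑ n ∈ Finset.range N, (x ^ n / n.factorial) • (S.rho sl2Lower ^ n) v := by
  refine finsum_eq_sum_of_support_subset _ fun n hn => ?_
  by_contra h
  simp only [Finset.coe_range, Set.mem_Iio, not_lt] at h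
  exact hn (by simp [hN n h])

/-- The operator `exp (x L(1)) = ∑ x ^ n / n! L(1) ^ n`; on each state only finitely many terms are
nonzero. -/
def expL1 (x : ℂ) : Module.End ℂ V where
  toFun v := ∑ᶠ n : ℕ, (x ^ n / n.factorial) • (S.rho sl2Lower ^ n) v
  map_add' u v := by
    obtain ⟨N, hN⟩ := S.lower_locally_nilpotent u
    obtain ⟨M, hM⟩ := S.lower_locally_nilpotent v
    have hN' : ∀ n ≥ max N M, (S.rho sl2Lower ^ n) u = 0 := fun n hn =>
      hN n (le_trans (le_max_left _ _) hn)
    have hM' : ∀ n ≥ max N M, (S.rho sl2Lower ^ n) v = 0 := fun n hn =>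
      hM n (le_trans (le_max_right _ _) hn)
    rw [S.finsum_eq_sum_range hN', S.finsum_eq_sum_range hM',
      S.finsum_eq_sum_range (N := max N M) fun n hn => by rw [map_add, hN' n hn, hM' n hn, add_zero],
      ← Finset.sum_add_distrib]
    simp only [map_add, smul_add]
  map_smul' c v := by
    obtain ⟨N, hN⟩ := S.lower_locally_nilpotent v
    rw [S.finsum_eq_sum_range hN,
      S.finsum_eq_sum_range (N := N) fun n hn => by rw [map_smul, hN n hn, smul_zero],
      RingHom.id_apply, Finset.smul_sum]
    exact Finset.sum_congr rfl fun n _ => by rw [map_smul, smul_comm]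

theorem expL1_apply {x : ℂ} {v : V} {N : ℕ} (hN : ∀ n ≥ N, (S.rho sl2Lower ^ n) v = 0) :
    S.expL1 x v = ∑ n ∈ Finset.range N, (x ^ n / n.factorial) • (S.rho sl2Lower ^ n) v :=
  S.finsum_eq_sum_range hN

theorem expL1_mul (x y : ℂ) : S.expL1 x * S.expL1 y = S.expL1 (x + y) := by
  ext v
  obtain ⟨N, hN⟩ := S.lower_locally_nilpotent v
  have hz : ∀ m k, N ≤ m + k → (S.rho sl2Lower ^ m) ((S.rho sl2Lower ^ k) v) = 0 :=
    fun m k h => by rw [← Module.End.mul_apply, ← pow_add]; exact hN _ h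
  rw [Module.End.mul_apply, S.expL1_apply hN, S.expL1_apply hN, map_sum]
  have h1 : ∀ k ∈ Finset.range N,
      S.expL1 x ((y ^ k / k.factorial) • (S.rho sl2Lower ^ k) v) =
        ∑ m ∈ Finset.range (N - k),
          (y ^ k / k.factorial * (x ^ m / m.factorial)) • (S.rho sl2Lower ^ (k + m)) v := by
    intro k hk
    rw [map_smul, S.expL1_apply (N := N - k) fun n hn => hz n k (by omega), Finset.smul_sum]
    refine Finset.sum_congr rfl fun m _ => ?_
    rw [smul_smul, ← Module.End.mul_apply, ← pow_add, add_comm m k]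
  rw [Finset.sum_congr rfl h1, ← Finset.sum_range_diag_flip N fun k m =>
    (y ^ k / k.factorial * (x ^ m / m.factorial)) • (S.rho sl2Lower ^ (k + m)) v]
  refine Finset.sum_congr rfl fun p _ => ?_
  have h2 : ∀ k ∈ Finset.range (p + 1),
      (y ^ k / k.factorial * (x ^ (p - k) / (p - k).factorial)) •
          (S.rho sl2Lower ^ (k + (p - k))) v =
        (y ^ k / k.factorial * (x ^ (p - k) / (p - k).factorial)) • (S.rho sl2Lower ^ p) v := by
    intro k hk
    rw [Nat.add_sub_cancel' (by simpa [Nat.lt_succ_iff] using hk)]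
  rw [Finset.sum_congr rfl h2, ← Finset.sum_smul, add_comm x y, add_pow, Finset.sum_div]
  congr 1
  refine Finset.sum_congr rfl fun k hk => ?_
  rw [Nat.cast_choose ℂ (show k ≤ p by simpa [Nat.lt_succ_iff] using hk)]
  have := Nat.factorial_ne_zero p
  field_simp

theorem expL1_zero : S.expL1 0 = 1 := by
  ext v
  obtain ⟨N, hN⟩ := S.lower_locally_nilpotent v
  rw [S.expL1_apply (N := N + 1) fun n hn => hN n (by omega), Finset.sum_range_succ']
  simp

theorem powL0_mul (z w : ℂ) : S.powL0 z * S.powL0 w = S.powL0 (z * w) := by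
  ext v
  induction v using S.grading_induction with
  | h0 => simp only [map_zero]
  | hadd x y hx hy => simp only [map_add, hx, hy]
  | hmem m x hx =>
    rw [Module.End.mul_apply, S.powL0_apply w hx, map_smul, S.powL0_apply z hx,
      S.powL0_apply (z * w) hx, smul_smul, mul_zpow, mul_comm]

theorem powL0_one : S.powL0 1 = 1 := by
  ext v
  induction v using S.grading_induction with
  | h0 => simp only [map_zero]
  | hadd x y hx hy => simp only [map_add, hx, hy]
  | hmem m x hx => simp [S.powL0_apply 1 hx]

/-- The canonical cocycle `K(γ, τ) = exp (-c j(γ, τ) L(1)) j(γ, τ) ^ (-2 L(0))`. -/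
def cocycle (γ : SL(2, ℤ)) (τ : ℍ) : Module.End ℂ V :=
  S.expL1 (-(γ 1 0 : ℂ) * denom γ τ) * S.powL0 (denom γ τ ^ (-2 : ℤ))

/-- The inverse `K(γ, τ)⁻¹ = j(γ, τ) ^ (2 L(0)) exp (c j(γ, τ) L(1))` of the canonical cocycle. -/
def cocycleInv (γ : SL(2, ℤ)) (τ : ℍ) : Module.End ℂ V :=
  S.powL0 (denom γ τ ^ (2 : ℤ)) * S.expL1 ((γ 1 0 : ℂ) * denom γ τ)

theorem cocycle_mul_cocycleInv (γ : SL(2, ℤ)) (τ : ℍ) :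
    S.cocycle γ τ * S.cocycleInv γ τ = 1 := by
  have hd : denom γ τ ^ (-2 : ℤ) * denom γ τ ^ (2 : ℤ) = 1 := by
    rw [← zpow_add₀ (denom_ne_zero _ _)]
    simp
  rw [cocycle, cocycleInv, mul_assoc, ← mul_assoc (S.powL0 _), powL0_mul, hd, powL0_one, one_mul,
    expL1_mul, neg_mul, neg_add_cancel, expL1_zero]

theorem cocycleInv_mul_cocycle (γ : SL(2, ℤ)) (τ : ℍ) :
    S.cocycleInv γ τ * S.cocycle γ τ = 1 := by
  have hd : denom γ τ ^ (2 : ℤ) * denom γ τ ^ (-2 : ℤ) = 1 := by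
    rw [← zpow_add₀ (denom_ne_zero _ _)]
    simp
  rw [cocycle, cocycleInv, mul_assoc, ← mul_assoc (S.expL1 _), expL1_mul, neg_mul, add_neg_cancel,
    expL1_zero, one_mul, powL0_mul, hd, powL0_one]

end QVOA

/-! ### Quasi-modular forms of level one -/

/-- The function `X(γ, τ) = c / (c τ + d)`. -/
def cocycleX (γ : SL(2, ℤ)) (τ : ℍ) : ℂ := (γ 1 0 : ℂ) / denom γ τ

/-- A function on the upper half-plane is holomorphic, including at the cusp: it is holomorphic and
bounded as `Im τ → ∞`. For a holomorphic function of period `1` the second condition says that its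
`q`-expansion has no pole. -/
def IsHolomorphicWithCusp (f : ℍ → ℂ) : Prop :=
  MDiff f ∧ IsBoundedAtImInfty f

namespace IsHolomorphicWithCusp

theorem zero : IsHolomorphicWithCusp 0 :=
  ⟨mdifferentiable_const, Filter.const_boundedAtFilter _ (0 : ℂ)⟩

theorem one : IsHolomorphicWithCusp 1 :=
  ⟨mdifferentiable_const, Filter.const_boundedAtFilter _ (1 : ℂ)⟩

theorem add {f g : ℍ → ℂ} (hf : IsHolomorphicWithCusp f) (hg : IsHolomorphicWithCusp g) :
    IsHolomorphicWithCusp (f + g) :=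
  ⟨hf.1.add hg.1, Filter.BoundedAtFilter.add hf.2 hg.2⟩

theorem mul {f g : ℍ → ℂ} (hf : IsHolomorphicWithCusp f) (hg : IsHolomorphicWithCusp g) :
    IsHolomorphicWithCusp (f * g) :=
  ⟨hf.1.mul hg.1, Filter.BoundedAtFilter.mul hf.2 hg.2⟩

theorem smul (c : ℂ) {f : ℍ → ℂ} (hf : IsHolomorphicWithCusp f) :
    IsHolomorphicWithCusp (c • f) :=
  ⟨hf.1.const_smul c, Filter.BoundedAtFilter.smul c hf.2⟩

theorem ite {f : ℍ → ℂ} (hf : IsHolomorphicWithCusp f) (p : Prop) [Decidable p] :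
    IsHolomorphicWithCusp (if p then f else 0) := by
  split_ifs
  exacts [hf, zero]

theorem sum {ι : Type*} (t : Finset ι) (f : ι → ℍ → ℂ)
    (hf : ∀ i ∈ t, IsHolomorphicWithCusp (f i)) : IsHolomorphicWithCusp (∑ i ∈ t, f i) := by
  classical
  induction t using Finset.induction_on with
  | empty => simpa using zero
  | insert a t ha ih =>
    rw [Finset.sum_insert ha]
    exact (hf a (Finset.mem_insert_self _ _)).add
      (ih fun i hi => hf i (Finset.mem_insert_of_mem hi))

end IsHolomorphicWithCusp

theorem sum_range_eq_ite {M : Type*} [AddCommGroup M] [Module ℂ M] {x : ℂ} {a b : ℕ}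
    (A : ℕ → M) (h : a ≤ b) :
    ∑ n ∈ Finset.range a, x ^ n • A n =
      ∑ n ∈ Finset.range b, x ^ n • (if n < a then A n else 0) := by
  rw [← Finset.sum_subset (Finset.range_mono h)]
  · refine Finset.sum_congr rfl fun n hn => ?_
    rw [if_pos (Finset.mem_range.1 hn)]
  · intro n _ hn
    rw [if_neg (by simpa using hn), smul_zero]

/-- The space of holomorphic quasi-modular forms of weight `k` (and arbitrary depth `s`) for
`SL(2, ℤ)`: the functions `f` for which there are functions `A 0, …, A s`, holomorphic also at the
cusp, with `(f|ₖγ)(τ) = ∑ X(γ, τ) ^ n * A n τ`. The case `γ = 1` gives `f = A 0`. -/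
def quasiModularForms (k : ℤ) : Submodule ℂ (ℍ → ℂ) where
  carrier := {f | ∃ (s : ℕ) (A : ℕ → ℍ → ℂ), (∀ n, IsHolomorphicWithCusp (A n)) ∧
    ∀ (γ : SL(2, ℤ)) (τ : ℍ),
      (f ∣[k] γ) τ = ∑ n ∈ Finset.range (s + 1), cocycleX γ τ ^ n • A n τ}
  zero_mem' := ⟨0, 0, fun _ => .zero, fun γ τ => by simp⟩
  add_mem' := by
    rintro f g ⟨s, A, hA, hf⟩ ⟨t, B, hB, hg⟩
    refine ⟨max s t, fun n => (if n < s + 1 then A n else 0) + (if n < t + 1 then B n else 0),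
      fun n => ((hA n).ite _).add ((hB n).ite _), fun γ τ => ?_⟩
    rw [SlashAction.add_slash, Pi.add_apply, hf, hg,
      sum_range_eq_ite (fun n => A n τ) (show s + 1 ≤ max s t + 1 by omega),
      sum_range_eq_ite (fun n => B n τ) (show t + 1 ≤ max s t + 1 by omega),
      ← Finset.sum_add_distrib]
    refine Finset.sum_congr rfl fun n _ => ?_
    change _ = cocycleX γ τ ^ n •
      ((if n < s + 1 then A n else 0) + (if n < t + 1 then B n else 0)) τ
    rw [Pi.add_apply, smul_add]
    split_ifs <;> simp
  smul_mem' := by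
    rintro c f ⟨s, A, hA, hf⟩
    refine ⟨s, fun n => c • A n, fun n => (hA n).smul c, fun γ τ => ?_⟩
    rw [ModularForm.SL_smul_slash, Pi.smul_apply, hf, Finset.smul_sum]
    refine Finset.sum_congr rfl fun n _ => ?_
    simp only [Pi.smul_apply, smul_eq_mul]
    ring

theorem quasiModularForms_mul {k l : ℤ} {f g : ℍ → ℂ} (hf : f ∈ quasiModularForms k)
    (hg : g ∈ quasiModularForms l) : f * g ∈ quasiModularForms (k + l) := by
  obtain ⟨s, A, hA, hf⟩ := hf
  obtain ⟨t, B, hB, hg⟩ := hg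
  refine ⟨s + t, fun n => ∑ p ∈ Finset.range (s + 1) ×ˢ Finset.range (t + 1),
    if p.1 + p.2 = n then A p.1 * B p.2 else 0,
    fun n => .sum _ _ fun p _ => ((hA _).mul (hB _)).ite _, fun γ τ => ?_⟩
  rw [ModularForm.mul_slash_SL2, Pi.mul_apply, hf, hg, Finset.sum_mul_sum,
    ← Finset.sum_product']
  simp only [Finset.sum_apply, Finset.smul_sum]
  rw [Finset.sum_comm]
  refine Finset.sum_congr rfl fun p hp => ?_
  simp only [Finset.mem_product, Finset.mem_range] at hp
  rw [Finset.sum_eq_single (p.1 + p.2)]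
  · simp only [if_true, Pi.mul_apply, pow_add, smul_eq_mul]
    ring
  · intro n _ hn
    simp [if_neg (Ne.symm hn)]
  · intro h
    exact absurd (Finset.mem_range.2 (by omega)) h

/-- The algebra `Q = ⊕ Q_{2k}` of holomorphic quasi-modular forms. -/
def quasiModularAlgebra : Subalgebra ℂ (ℍ → ℂ) :=
  (⨆ k : ℕ, quasiModularForms (2 * k)).toSubalgebra
    (Submodule.mem_iSup_of_mem 0 ⟨0, fun _ => 1, fun _ => .one, fun γ τ => by
      simp [ModularForm.is_invariant_one]⟩)
    (by
      intro f g hf hg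
      induction hf using Submodule.iSup_induction' with
      | zero => rw [zero_mul]; exact Submodule.zero_mem _
      | add x y _ _ hx hy => rw [add_mul]; exact Submodule.add_mem _ hx hy
      | mem k x hx =>
        induction hg using Submodule.iSup_induction' with
        | zero => rw [mul_zero]; exact Submodule.zero_mem _
        | add y z _ _ hy hz => rw [mul_add]; exact Submodule.add_mem _ hy hz
        | mem l y hy =>
          refine Submodule.mem_iSup_of_mem (k + l) ?_
          have := quasiModularForms_mul hx hy
          rwa [Nat.cast_add, mul_add])

/-- The space `Q_{2k}`, as a subspace of `Q`; it is the space of conformal degree `k` of the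
regraded algebra. -/
def quasiModularDegree (k : ℤ) : Submodule ℂ quasiModularAlgebra :=
  (quasiModularForms (2 * k)).comap quasiModularAlgebra.toSubmodule.subtype

/-- Evaluation of polynomials in three variables at the Eisenstein series `E₂, E₄, E₆`. -/
def eisensteinEval : MvPolynomial (Fin 3) ℂ →ₐ[ℂ] (ℍ → ℂ) :=
  MvPolynomial.aeval ![E2, E₄, E₆]

/-! ### Quasi-modular forms with values in a quasi-vertex operator algebra -/

namespace QVOA

variable {V : Type*} [AddCommGroup V] [Module ℂ V] (S : QVOA V)

/-- The truncation `F_N V = ⊕_{n ≤ N} V_n`; it is finite-dimensional. -/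
def truncation (N : ℤ) : Submodule ℂ V := ⨆ n : {n : ℤ // n ≤ N}, S.grading n

/-- A map from the upper half-plane to `F_N V` is holomorphic, including at the cusp. As `F_N V` is
finite-dimensional, this may be tested on linear functionals. -/
def IsHolomorphicMap (N : ℤ) (f : ℍ → V) : Prop :=
  (∀ τ, f τ ∈ S.truncation N) ∧
    ∀ φ : Module.Dual ℂ V, IsHolomorphicWithCusp fun τ => φ (f τ)

theorem isHolomorphicMap_zero (N : ℤ) : S.IsHolomorphicMap N 0 :=
  ⟨fun _ => Submodule.zero_mem _, fun φ => by
    have h : (fun τ : ℍ => φ ((0 : ℍ → V) τ)) = 0 := funext fun _ => map_zero φ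
    rw [h]
    exact .zero⟩

variable {S} in
theorem IsHolomorphicMap.mono {N M : ℤ} {f : ℍ → V} (hf : S.IsHolomorphicMap N f) (h : N ≤ M) :
    S.IsHolomorphicMap M f :=
  ⟨fun τ => iSup_le (fun n : {n : ℤ // n ≤ N} =>
    le_iSup (fun n : {n : ℤ // n ≤ M} => S.grading n) ⟨n.1, n.2.trans h⟩) (hf.1 τ), hf.2⟩

variable {S} in
theorem IsHolomorphicMap.smul {N : ℤ} {f : ℍ → V} (c : ℂ) (hf : S.IsHolomorphicMap N f) :
    S.IsHolomorphicMap N (c • f) :=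
  ⟨fun τ => Submodule.smul_mem _ c (hf.1 τ), fun φ => by
    have h : (fun τ => φ ((c • f) τ)) = c • fun τ => φ (f τ) := funext fun τ => map_smul φ c (f τ)
    rw [h]
    exact (hf.2 φ).smul c⟩

variable {S} in
theorem IsHolomorphicMap.add {N : ℤ} {f g : ℍ → V} (hf : S.IsHolomorphicMap N f)
    (hg : S.IsHolomorphicMap N g) : S.IsHolomorphicMap N (f + g) :=
  ⟨fun τ => Submodule.add_mem _ (hf.1 τ) (hg.1 τ), fun φ => by
    have h : (fun τ => φ ((f + g) τ)) = (fun τ => φ (f τ)) + fun τ => φ (g τ) :=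
      funext fun τ => map_add φ (f τ) (g τ)
    rw [h]
    exact (hf.2 φ).add (hg.2 φ)⟩

variable {S} in
theorem IsHolomorphicMap.ite {N : ℤ} {f : ℍ → V} (hf : S.IsHolomorphicMap N f) (p : Prop)
    [Decidable p] : S.IsHolomorphicMap N (if p then f else 0) := by
  split_ifs
  exacts [hf, S.isHolomorphicMap_zero N]

/-- The action `(f||ₖγ)(τ) = j(γ, τ) ^ (-k) K(γ, τ)⁻¹ f(γτ)`. -/
def slash (k : ℤ) (γ : SL(2, ℤ)) (f : ℍ → V) (τ : ℍ) : V :=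
  denom γ τ ^ (-k) • S.cocycleInv γ τ (f (γ • τ))

/-- The space of holomorphic `V`-valued quasi-modular forms of weight `k` (and arbitrary depth and
conformal degree): `(f||ₖγ)(τ) = ∑ X(γ, τ) ^ n • A n τ` for maps `A 0, …, A s` to some `F_N V` that
are holomorphic also at the cusp. The case `γ = 1` gives `f = A 0`. -/
def valuedForms (k : ℤ) : Submodule ℂ (ℍ → V) where
  carrier := {f | ∃ (N : ℤ) (s : ℕ) (A : ℕ → ℍ → V), (∀ n, S.IsHolomorphicMap N (A n)) ∧
    ∀ (γ : SL(2, ℤ)) (τ : ℍ),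
      S.slash k γ f τ = ∑ n ∈ Finset.range (s + 1), cocycleX γ τ ^ n • A n τ}
  zero_mem' := ⟨0, 0, 0, fun _ => S.isHolomorphicMap_zero 0, fun γ τ => by simp [slash]⟩
  add_mem' := by
    rintro f g ⟨N, s, A, hA, hf⟩ ⟨M, t, B, hB, hg⟩
    refine ⟨max N M, max s t,
      fun n => (if n < s + 1 then A n else 0) + (if n < t + 1 then B n else 0),
      fun n => (((hA n).mono (le_max_left _ _)).ite _).add (((hB n).mono (le_max_right _ _)).ite _),
      fun γ τ => ?_⟩
    have h := congrArg₂ (· + ·) (hf γ τ) (hg γ τ)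
    simp only [sum_range_eq_ite (fun n => A n τ) (show s + 1 ≤ max s t + 1 by omega),
      sum_range_eq_ite (fun n => B n τ) (show t + 1 ≤ max s t + 1 by omega),
      ← Finset.sum_add_distrib] at h
    rw [slash, Pi.add_apply, map_add, smul_add]
    refine h.trans (Finset.sum_congr rfl fun n _ => ?_)
    change _ = cocycleX γ τ ^ n •
      ((if n < s + 1 then A n else 0) + (if n < t + 1 then B n else 0)) τ
    rw [Pi.add_apply, smul_add]
    split_ifs <;> simp
  smul_mem' := by
    rintro c f ⟨N, s, A, hA, hf⟩
    refine ⟨N, s, fun n => c • A n, fun n => (hA n).smul c, fun γ τ => ?_⟩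
    have h := congrArg (c • ·) (hf γ τ)
    simp only [Finset.smul_sum] at h
    rw [slash, Pi.smul_apply, map_smul, smul_comm]
    refine h.trans (Finset.sum_congr rfl fun n _ => ?_)
    exact smul_comm _ _ _

/-- The space `Q(V)` of holomorphic `V`-valued quasi-modular forms of all even weights. -/
def valuedFormSpace : Submodule ℂ (ℍ → V) := ⨆ k : ℤ, S.valuedForms (2 * k)

/-- The space of forms of weight `m`, as a subspace of `Q(V)`. -/
def valuedWeight (m : ℤ) : Submodule ℂ S.valuedFormSpace :=
  (S.valuedForms m).comap S.valuedFormSpace.subtype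

end QVOA

end

/-! Generation. A level-one modular form of weight 2m, m ≥ 2, becomes cuspidal after subtracting a
multiple of some E₄ᵃE₆ᵇ. Dividing by Δ = (E₄³ − E₆²)/1728 then lowers the weight, so induction gives
a polynomial in E₄ and E₆ (`exists_isModularPolynomial`). For a quasi-modular form, comparing γ with
γβ⁻¹ and β shows that the top coefficient Q_s is an honest modular form of weight k − 2s
(`HasExpansion.slash_top`). Since E₂|γ = E₂ + (6/πi) X, subtracting a multiple of E₂ˢQ_s lowers the
depth.

Independence. Evaluate a relation p(E₂, E₄, E₆) = 0 at γτ. Both c and j take enough values to be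
treated as free variables, so p vanishes at (w, y⁴E₄(τ), y⁶E₆(τ)) for all w and all y ≠ 0. At τ = i,
E₆ vanishes and E₄ does not, so the third variable divides p. It can be cancelled because
holomorphic functions on ℍ have no zero divisors, and descent on the degree gives p = 0.

The action of sl₂. The Serre derivative maps modular forms to modular forms, and θE₂ − E₂²/12 is
modular too. Hence θ is a derivation of C[E₂, E₄, E₆] whose values on the generators are known
modulo polynomials in E₄ and E₆. This is exactly what the commutator with 12 ∂/∂E₂ detects, so the
sl₂ relations hold on generators and therefore everywhere.

Vertex algebras. A single construction serves both parts: for a commutative algebra U with a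
derivation D and a vertex algebra V, put (a ⊗ b)(n)(c ⊗ d) = ∑ (Dⁱa/i!) c ⊗ b(n + i)d. Its Jacobi
identity at (r, s, t) is the sum over m, l of (Dᵐa/m!)(Dˡa'/l!) c tensored with the Jacobi identity
of V at (r + m, s + l, t). The algebra on Q itself is the case V = ℂ, where the Jacobi identity is a
binomial identity.

V-valued forms. Moving the power of j past the exponential gives K⁻¹ = exp(X L(1)) j^{2L(0)}
(`cocycleInv_eq`). So f ⊗ v transforms by the product of the expansion of f with the polynomial
exp(X L(1))v. Conversely, applying exp(−X L(1)) to the transformation law and taking the coordinate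
along a basis vector of degree l leaves a scalar quasi-modular form of weight m − 2l. Values lie in
finitely many degrees, so these coordinates recover the form as a finite sum of tensors. -/

noncomputable section

/-! ### Modular forms of level one are polynomials in `E₄` and `E₆` -/

namespace QuasiModular

/-- The conformal degrees of the generators `E₂, E₄, E₆`. -/
def eisensteinDegree : Fin 3 → ℤ := ![1, 2, 3]

/-- A polynomial in the last two variables, homogeneous of conformal degree `m`. -/
def IsModularPolynomial (m : ℤ) (p : MvPolynomial (Fin 3) ℂ) : Prop :=
  p.IsWeightedHomogeneous eisensteinDegree m ∧ MvPolynomial.pderiv 0 p = 0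

theorem isModularPolynomial_zero (m : ℤ) : IsModularPolynomial m 0 :=
  ⟨MvPolynomial.isWeightedHomogeneous_zero _ _ _, map_zero _⟩

theorem IsModularPolynomial.add {m : ℤ} {p q : MvPolynomial (Fin 3) ℂ}
    (hp : IsModularPolynomial m p) (hq : IsModularPolynomial m q) :
    IsModularPolynomial m (p + q) :=
  ⟨hp.1.add hq.1, by rw [map_add, hp.2, hq.2, add_zero]⟩

theorem IsModularPolynomial.smul {m : ℤ} {p : MvPolynomial (Fin 3) ℂ} (c : ℂ)
    (hp : IsModularPolynomial m p) : IsModularPolynomial m (c • p) :=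
  ⟨Submodule.smul_mem (MvPolynomial.weightedHomogeneousSubmodule ℂ eisensteinDegree m) c hp.1,
    by rw [Derivation.map_smul, hp.2, smul_zero]⟩

theorem IsModularPolynomial.sub {m : ℤ} {p q : MvPolynomial (Fin 3) ℂ}
    (hp : IsModularPolynomial m p) (hq : IsModularPolynomial m q) :
    IsModularPolynomial m (p - q) := by
  rw [sub_eq_add_neg, ← neg_one_smul ℂ q]
  exact hp.add (hq.smul _)

theorem IsModularPolynomial.mul {m n : ℤ} {p q : MvPolynomial (Fin 3) ℂ}
    (hp : IsModularPolynomial m p) (hq : IsModularPolynomial n q) :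
    IsModularPolynomial (m + n) (p * q) :=
  ⟨hp.1.mul hq.1, by rw [Derivation.leibniz, hp.2, hq.2, smul_zero, smul_zero, add_zero]⟩

theorem isModularPolynomial_one : IsModularPolynomial 0 1 :=
  ⟨MvPolynomial.isWeightedHomogeneous_one _ _, by simp⟩

theorem IsModularPolynomial.pow {m : ℤ} {p : MvPolynomial (Fin 3) ℂ}
    (hp : IsModularPolynomial m p) (n : ℕ) : IsModularPolynomial (n * m) (p ^ n) := by
  induction n with
  | zero => simpa using isModularPolynomial_one
  | succ n ih =>
    rw [pow_succ, show ((n + 1 : ℕ) : ℤ) * m = n * m + m by push_cast; ring]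
    exact ih.mul hp

theorem isModularPolynomial_X_one : IsModularPolynomial 2 (MvPolynomial.X 1) :=
  ⟨MvPolynomial.isWeightedHomogeneous_X _ _ _, by simp [MvPolynomial.pderiv_X]⟩

theorem isModularPolynomial_X_two : IsModularPolynomial 3 (MvPolynomial.X 2) :=
  ⟨MvPolynomial.isWeightedHomogeneous_X _ _ _, by simp [MvPolynomial.pderiv_X]⟩

@[simp] theorem eisensteinEval_X_zero : eisensteinEval (MvPolynomial.X 0) = E2 := by
  simp [eisensteinEval]

@[simp] theorem eisensteinEval_X_one : eisensteinEval (MvPolynomial.X 1) = (E₄ : ℍ → ℂ) := by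
  simp [eisensteinEval]

@[simp] theorem eisensteinEval_X_two : eisensteinEval (MvPolynomial.X 2) = (E₆ : ℍ → ℂ) := by
  simp [eisensteinEval]

theorem isBoundedAtImInfty_of_modularForm {k : ℤ} (f : ModularForm 𝒮ℒ k) :
    IsBoundedAtImInfty (f : ℍ → ℂ) :=
  ModularFormClass.bdd_at_infty f

theorem isHolomorphicWithCusp_of_modularForm {k : ℤ} (f : ModularForm 𝒮ℒ k) :
    IsHolomorphicWithCusp f :=
  ⟨f.holo', isBoundedAtImInfty_of_modularForm f⟩

theorem modularForm_slash {k : ℤ} (f : ModularForm 𝒮ℒ k) (γ : SL(2, ℤ)) :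
    (f : ℍ → ℂ) ∣[k] γ = f :=
  f.slash_action_eq' _ ⟨γ, rfl⟩

/-- A modular form of level one given by its slash invariance and its behaviour at the cusp. -/
def modularFormOf {k : ℤ} (f : ℍ → ℂ) (hf : IsHolomorphicWithCusp f)
    (h : ∀ γ : SL(2, ℤ), f ∣[k] γ = f) : ModularForm 𝒮ℒ k where
  toFun := f
  slash_action_eq' := fun _ ⟨γ, hγ⟩ => hγ ▸ h γ
  holo' := hf.1
  -- Every cusp is an SL(2, ℤ)-translate of ∞ and `f` is invariant, so boundedness at i∞ suffices.
  bdd_at_cusps' {c} hc := by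
    rw [Subgroup.IsArithmetic.isCusp_iff_isCusp_SL2Z] at hc
    rw [OnePoint.isBoundedAt_iff_forall_SL2Z hc]
    intro γ _
    rw [h γ]
    exact hf.2

@[simp] theorem coe_modularFormOf {k : ℤ} (f : ℍ → ℂ) (hf : IsHolomorphicWithCusp f)
    (h : ∀ γ : SL(2, ℤ), f ∣[k] γ = f) : (modularFormOf f hf h : ℍ → ℂ) = f := rfl

/-- A vanishing constant term makes the form cuspidal, and Δ has no zero on ℍ and a simple zero at
the cusp. This is the step that lowers the weight. -/
theorem exists_mul_discriminant {k : ℤ} (f : ModularForm 𝒮ℒ k)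
    (hf : (qExpansion 1 f).coeff 0 = 0) :
    ∃ g : ModularForm 𝒮ℒ (k - 12), (f : ℍ → ℂ) = discriminant * (g : ℍ → ℂ) :=
  ⟨CuspForm.discriminantEquiv (toCuspForm f hf),
    (discriminant_mul_discriminantEquiv (toCuspForm f hf)).symm⟩

/-- Every integer m ≥ 2 has the form 2a + 3b, and E₄ᵃE₆ᵇ has constant term 1. It serves to remove
the constant term of a form of the same weight. -/
theorem exists_isModularPolynomial_of_coeff_eq_one {m : ℤ} (hm : 2 ≤ m) :
    ∃ (p : MvPolynomial (Fin 3) ℂ) (g : ModularForm 𝒮ℒ (2 * m)), IsModularPolynomial m p ∧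
      eisensteinEval p = g ∧ (qExpansion 1 g).coeff 0 = 1 := by
  obtain ⟨a, b, hab⟩ : ∃ a b : ℕ, m = a * 2 + b * 3 := by
    obtain ⟨k, rfl⟩ | ⟨k, rfl⟩ := Int.even_or_odd m
    · exact ⟨k.toNat, 0, by omega⟩
    · exact ⟨(k - 1).toNat, 1, by omega⟩
  refine ⟨MvPolynomial.X 1 ^ a * MvPolynomial.X 2 ^ b,
    ModularForm.mcast (by rw [hab]; ring) ((E₄.pow a).mul (E₆.pow b)), ?_, ?_, ?_⟩
  · rw [hab]
    exact (isModularPolynomial_X_one.pow a).mul (isModularPolynomial_X_two.pow b)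
  · simp
  · simp only [coe_mcast]
    rw [ModularForm.qExpansion_mul one_pos one_mem_strictPeriods_SL,
      ModularForm.qExpansion_pow one_pos one_mem_strictPeriods_SL,
      ModularForm.qExpansion_pow one_pos one_mem_strictPeriods_SL]
    have h4 := E_qExpansion_coeff_zero (k := 4) (by norm_num) ⟨2, rfl⟩
    have h6 := E_qExpansion_coeff_zero (k := 6) (by norm_num) ⟨3, rfl⟩
    simp only [PowerSeries.coeff_zero_eq_constantCoeff] at h4 h6 ⊢
    simp [h4, h6]

/-- The polynomial representing the discriminant. -/
def discriminantPolynomial : MvPolynomial (Fin 3) ℂ :=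
  (1 / 1728 : ℂ) • (MvPolynomial.X 1 ^ 3 - MvPolynomial.X 2 ^ 2)

theorem isModularPolynomial_discriminantPolynomial :
    IsModularPolynomial 6 discriminantPolynomial :=
  ((isModularPolynomial_X_one.pow 3).sub (isModularPolynomial_X_two.pow 2)).smul _

theorem eisensteinEval_discriminantPolynomial :
    eisensteinEval discriminantPolynomial = discriminant := by
  ext τ
  simp [discriminantPolynomial, discriminant_eq_E₄_cube_sub_E₆_sq]
  ring

/-- A modular form of level one is a polynomial in `E₄` and `E₆`. -/
theorem exists_isModularPolynomial (m : ℤ) (f : ModularForm 𝒮ℒ (2 * m)) :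
    ∃ p, IsModularPolynomial m p ∧ eisensteinEval p = f := by
  -- Division by Δ replaces m by m − 6, possibly negative, so the induction runs over an upper bound
  -- for m.
  suffices H : ∀ (n : ℕ) (m : ℤ), m < n → ∀ f : ModularForm 𝒮ℒ (2 * m),
      ∃ p, IsModularPolynomial m p ∧ eisensteinEval p = f from
    H (m + 1).toNat m (by omega) f
  intro n
  induction n with
  | zero =>
    intro m hm f
    refine ⟨0, isModularPolynomial_zero m, ?_⟩
    rw [map_zero]
    exact (ModularFormClass.levelOne_neg_weight_eq_zero (by simp at hm; omega) f).symm
  | succ n ih =>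
    intro m hm f
    obtain h | rfl | rfl | h : m < 0 ∨ m = 0 ∨ m = 1 ∨ 2 ≤ m := by omega
    · refine ⟨0, isModularPolynomial_zero m, ?_⟩
      rw [map_zero]
      exact (ModularFormClass.levelOne_neg_weight_eq_zero (by omega) f).symm
    · obtain ⟨c, hc⟩ := ModularFormClass.levelOne_weight_zero_const f
      refine ⟨c • 1, isModularPolynomial_one.smul c, ?_⟩
      rw [hc, map_smul, map_one]
      ext
      simp
    · refine ⟨0, isModularPolynomial_zero _, ?_⟩
      have := rank_zero_iff_forall_zero.1 levelOne_weight_two_rank_zero f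
      rw [this, map_zero]
      rfl
    · obtain ⟨p, g, hp, hpg, hg⟩ := exists_isModularPolynomial_of_coeff_eq_one h
      set c := (qExpansion 1 f).coeff 0
      obtain ⟨u, hu⟩ := exists_mul_discriminant (f - c • g) (by
        rw [FunLike.coe_sub, ModularForm.qExpansion_sub, FunLike.coe_smul,
          ModularForm.qExpansion_smul, map_sub, PowerSeries.coeff_smul, hg, smul_eq_mul, mul_one,
          sub_self]
        all_goals simp)
      obtain ⟨q, hq, hqu⟩ := ih (m - 6) (by push_cast at hm; omega)
        (ModularForm.mcast (by ring) u)
      rw [coe_mcast] at hqu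
      refine ⟨discriminantPolynomial * q + c • p, ?_, ?_⟩
      · refine IsModularPolynomial.add ?_ (hp.smul c)
        have := isModularPolynomial_discriminantPolynomial.mul hq
        rwa [add_sub_cancel] at this
      · rw [map_add, map_mul, eisensteinEval_discriminantPolynomial, hqu, ← hu, map_smul, hpg]
        ext τ
        simp

end QuasiModular

/-! ### Quasi-modular forms are polynomials in `E₂`, `E₄` and `E₆` -/

namespace QuasiModular

/-! ### The cocycle X and its values. -/

theorem D2_eq_cocycleX (γ : SL(2, ℤ)) (τ : ℍ) :
    D2 γ τ = 2 * Real.pi * Complex.I * cocycleX γ τ := by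
  rw [D2, cocycleX, mul_div_assoc]

theorem slash_apply (k : ℤ) (f : ℍ → ℂ) (γ : SL(2, ℤ)) (τ : ℍ) :
    (f ∣[k] γ) τ = f (γ • τ) * denom γ τ ^ (-k) :=
  ModularForm.SL_slash_apply f γ τ

/-- Up to the factor 2πi, X is the correction term in the transformation of E₂, so it inherits the
cocycle relation of `D2`. -/
theorem cocycleX_mul (α β : SL(2, ℤ)) (τ : ℍ) :
    cocycleX (α * β) τ = cocycleX α (β • τ) * denom β τ ^ (-2 : ℤ) + cocycleX β τ := by
  have h := congrFun (D2_mul α β) τ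
  rw [Pi.add_apply, slash_apply, D2_eq_cocycleX, D2_eq_cocycleX, D2_eq_cocycleX] at h
  have hpi : (2 * Real.pi * Complex.I : ℂ) ≠ 0 := Complex.two_pi_I_ne_zero
  refine mul_left_cancel₀ hpi (h.trans ?_)
  ring

theorem cocycleX_one (τ : ℍ) : cocycleX 1 τ = 0 := by
  simp [cocycleX]

theorem denom_SL (γ : SL(2, ℤ)) (τ : ℍ) :
    denom γ τ = (γ 1 0 : ℂ) * τ + (γ 1 1 : ℂ) := by
  simp [denom]

/-- The lower triangular unipotent matrix with lower left entry `c`. -/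
def lowerUnipotent (c : ℤ) : SL(2, ℤ) := ⟨!![1, 0; c, 1], by simp⟩

theorem cocycleX_lowerUnipotent (c : ℤ) (τ : ℍ) :
    cocycleX (lowerUnipotent c) τ = c / (c * τ + 1) := by
  rw [cocycleX, denom_SL]
  simp [lowerUnipotent]

/-- This permits comparing coefficients: at fixed τ, two polynomials that agree at X(γ, τ) for all γ
are equal. -/
theorem infinite_range_cocycleX (τ : ℍ) : (Set.range fun γ => cocycleX γ τ).Infinite := by
  refine (Set.infinite_range_of_injective (f := fun c : ℤ => cocycleX (lowerUnipotent c) τ)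
    fun c d h => ?_).mono ?_
  · simp only [cocycleX_lowerUnipotent] at h
    have hne : ∀ c : ℤ, (c * τ + 1 : ℂ) ≠ 0 := fun c => by
      have := denom_ne_zero (lowerUnipotent c : GL (Fin 2) ℝ) τ
      rw [denom_SL] at this
      simpa [lowerUnipotent] using this
    rw [div_eq_div_iff (hne c) (hne d)] at h
    have h2 : (c : ℂ) = d := by linear_combination h
    exact_mod_cast h2
  · rintro _ ⟨c, rfl⟩
    exact ⟨_, rfl⟩

/-! ### Reduction of the depth. -/

/-- The function `f` transforms in weight `k` with coefficients `A n`, `n < s`. -/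
def HasExpansion (k : ℤ) (s : ℕ) (A : ℕ → ℍ → ℂ) (f : ℍ → ℂ) : Prop :=
  ∀ (γ : SL(2, ℤ)) (τ : ℍ), (f ∣[k] γ) τ = ∑ n ∈ Finset.range s, cocycleX γ τ ^ n * A n τ

/-- Expand f|γ directly and as (f|γβ⁻¹)|β. The cocycle relation gives X(γβ⁻¹, βτ) j(β, τ)⁻² = X(γ,
τ) − X(β, τ), so both expansions are polynomials in X(γ, τ) that agree at infinitely many values. -/
theorem HasExpansion.sum_eq {k : ℤ} {s : ℕ} {A : ℕ → ℍ → ℂ} {f : ℍ → ℂ}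
    (h : HasExpansion k s A f) (β : SL(2, ℤ)) (τ : ℍ) :
    ∑ n ∈ Finset.range s, Polynomial.C (A n τ) * Polynomial.X ^ n =
      ∑ n ∈ Finset.range s, Polynomial.C ((A n ∣[k - 2 * n] β) τ) *
        (Polynomial.X - Polynomial.C (cocycleX β τ)) ^ n := by
  refine Polynomial.eq_of_infinite_eval_eq _ _ ((infinite_range_cocycleX τ).mono ?_)
  rintro _ ⟨γ, rfl⟩
  have hγ : γ = γ * β⁻¹ * β := by group
  have hX : cocycleX γ τ - cocycleX β τ =
      cocycleX (γ * β⁻¹) (β • τ) * denom β τ ^ (-2 : ℤ) := by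
    rw [sub_eq_iff_eq_add, ← cocycleX_mul, ← hγ]
  simp only [Set.mem_ofPred_eq, Polynomial.eval_finsetSum, Polynomial.eval_mul, Polynomial.eval_C,
    Polynomial.eval_pow, Polynomial.eval_X, Polynomial.eval_sub, hX]
  have h1 := h γ τ
  rw [hγ, SlashAction.slash_mul, slash_apply, h, ← hγ, Finset.sum_mul] at h1
  calc _ = ∑ n ∈ Finset.range s, cocycleX γ τ ^ n * A n τ :=
        Finset.sum_congr rfl fun n _ => mul_comm _ _
    _ = _ := h1.symm
    _ = _ := Finset.sum_congr rfl fun n _ => by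
        rw [slash_apply, mul_pow, ← zpow_natCast (_ ^ (-2 : ℤ)) n, ← zpow_mul,
          show -(k - 2 * n : ℤ) = -k - (-2 * n) by ring, zpow_sub₀ (denom_ne_zero _ _)]
        have := zpow_ne_zero (-2 * (n : ℤ)) (denom_ne_zero (β : GL (Fin 2) ℝ) τ)
        field_simp

/-- Compare the coefficients of Xˢ in `HasExpansion.sum_eq`: a shift of the variable leaves the
leading coefficient unchanged. -/
theorem HasExpansion.slash_top {k : ℤ} {s : ℕ} {A : ℕ → ℍ → ℂ} {f : ℍ → ℂ}
    (h : HasExpansion k (s + 1) A f) (β : SL(2, ℤ)) : A s ∣[k - 2 * s] β = A s := by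
  ext τ
  have h1 := congrArg (fun p => Polynomial.coeff p s) (h.sum_eq β τ)
  simp only [Polynomial.finsetSum_coeff, Polynomial.coeff_C_mul, Polynomial.coeff_X_pow,
    sub_eq_add_neg (Polynomial.X : Polynomial ℂ), ← map_neg Polynomial.C,
    Polynomial.coeff_X_add_C_pow] at h1
  rw [Finset.sum_range_succ, Finset.sum_range_succ, Finset.sum_eq_zero, Finset.sum_eq_zero] at h1
  · simpa using h1.symm
  · intro n hn
    rw [Nat.choose_eq_zero_of_lt (Finset.mem_range.1 hn)]
    simp
  · intro n hn
    rw [if_neg (Finset.mem_range.1 hn).ne']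
    simp

/-- The constant `6 / (π i)` in the transformation law of `E₂`. -/
def anomaly : ℂ := 6 / (Real.pi * Complex.I)

theorem anomaly_ne_zero : anomaly ≠ 0 := by
  simp [anomaly, Real.pi_ne_zero]

theorem E2_slash (γ : SL(2, ℤ)) (τ : ℍ) :
    (E2 ∣[(2 : ℤ)] γ) τ = E2 τ + anomaly * cocycleX γ τ := by
  rw [E2_slash_action]
  simp only [Pi.sub_apply, Pi.smul_apply, smul_eq_mul, D2_eq_cocycleX, riemannZeta_two, anomaly]
  have : (Real.pi : ℂ) ≠ 0 := by exact_mod_cast Real.pi_ne_zero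
  field_simp
  linear_combination (-6 * cocycleX γ τ) * Complex.I_sq

theorem E2_pow_slash (γ : SL(2, ℤ)) (τ : ℍ) (s : ℕ) :
    ((E2 ^ s) ∣[(2 * s : ℤ)] γ) τ = (E2 τ + anomaly * cocycleX γ τ) ^ s := by
  rw [← E2_slash, slash_apply, slash_apply, mul_pow, ← zpow_natCast (_ ^ (-2 : ℤ)), ← zpow_mul,
    neg_mul]
  rfl

theorem isHolomorphicWithCusp_E2 : IsHolomorphicWithCusp E2 :=
  ⟨E2_mdifferentiable, isBoundedAtImInfty_E2⟩

theorem isHolomorphicWithCusp_pow {f : ℍ → ℂ} (hf : IsHolomorphicWithCusp f) (n : ℕ) :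
    IsHolomorphicWithCusp (f ^ n) := by
  induction n with
  | zero => rw [pow_zero]; exact .one
  | succ n ih => rw [pow_succ]; exact ih.mul hf

theorem isWeightedHomogeneous_X_zero :
    (MvPolynomial.X 0 : MvPolynomial (Fin 3) ℂ).IsWeightedHomogeneous eisensteinDegree 1 :=
  MvPolynomial.isWeightedHomogeneous_X _ _ _

/-- A function with a quasi-modular expansion is a polynomial in the Eisenstein series. -/
theorem HasExpansion.exists_polynomial {m : ℤ} {s : ℕ} {A : ℕ → ℍ → ℂ} {f : ℍ → ℂ}
    (hA : ∀ n, IsHolomorphicWithCusp (A n)) (h : HasExpansion (2 * m) s A f) :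
    ∃ p : MvPolynomial (Fin 3) ℂ, p.IsWeightedHomogeneous eisensteinDegree m ∧
      eisensteinEval p = f := by
  induction s generalizing A f with
  | zero =>
    refine ⟨0, MvPolynomial.isWeightedHomogeneous_zero _ _ _, ?_⟩
    rw [map_zero]
    ext τ
    have := h 1 τ
    simpa using this.symm
  | succ s ih =>
    have htop : ∀ γ : SL(2, ℤ), A s ∣[2 * (m - s)] γ = A s := fun γ => by
      rw [mul_sub]
      exact h.slash_top γ
    obtain ⟨q, hq, hqA⟩ := exists_isModularPolynomial (m - s) (modularFormOf (A s) (hA s) htop)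
    rw [coe_modularFormOf] at hqA
    -- With this constant the Xˢ-coefficient of (c E₂ˢ A_s)|γ is exactly A_s, so the difference has
    -- one term fewer.
    set c : ℂ := (anomaly⁻¹) ^ s
    have hgs : ∀ (γ : SL(2, ℤ)) (τ : ℍ), ((c • (E2 ^ s * A s)) ∣[2 * m] γ) τ =
        c * ((E2 τ + anomaly * cocycleX γ τ) ^ s * A s τ) := fun γ τ => by
      rw [ModularForm.SL_smul_slash, Pi.smul_apply, show 2 * m = 2 * (s : ℤ) + 2 * (m - s) by ring,
        ModularForm.mul_slash_SL2, Pi.mul_apply, E2_pow_slash, htop, smul_eq_mul]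
    obtain ⟨p, hp, hpf⟩ := ih (f := f - c • (E2 ^ s * A s))
      -- The corrections are the binomial coefficients of c (E₂ + `anomaly` X)ˢ A_s below Xˢ.
      (A := fun n => A n + (-(s.choose n * c * anomaly ^ n)) • (E2 ^ (s - n) * A s))
      (fun n => (hA n).add (((isHolomorphicWithCusp_pow isHolomorphicWithCusp_E2 _).mul
        (hA s)).smul _)) (fun γ τ => by
        rw [sub_eq_add_neg, SlashAction.add_slash, Pi.add_apply, SlashAction.neg_slash,
          Pi.neg_apply, hgs, h γ τ, ← sub_eq_add_neg, sub_eq_iff_eq_add, add_comm (E2 τ), add_pow,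
          Finset.sum_mul, Finset.mul_sum, Finset.sum_range_succ, Finset.sum_range_succ,
          ← add_assoc, ← Finset.sum_add_distrib]
        congr 1
        · refine Finset.sum_congr rfl fun n _ => ?_
          simp only [Pi.add_apply, Pi.smul_apply, Pi.mul_apply, Pi.pow_apply, smul_eq_mul]
          ring
        · have : c * anomaly ^ s = 1 := by
            rw [← mul_pow, inv_mul_cancel₀ anomaly_ne_zero, one_pow]
          rw [Nat.choose_self, Nat.sub_self]
          linear_combination (-cocycleX γ τ ^ s * A s τ) * this)
    refine ⟨p + c • (MvPolynomial.X 0 ^ s * q), hp.add (Submodule.smul_mem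
      (MvPolynomial.weightedHomogeneousSubmodule ℂ eisensteinDegree m) c ?_), ?_⟩
    · have := (isWeightedHomogeneous_X_zero.pow s).mul hq.1
      rw [MvPolynomial.mem_weightedHomogeneousSubmodule]
      simpa using this
    · rw [map_add, hpf, map_smul, map_mul, map_pow, hqA, eisensteinEval_X_zero, sub_add_cancel]

theorem exists_polynomial_of_mem {m : ℤ} {f : ℍ → ℂ} (hf : f ∈ quasiModularForms (2 * m)) :
    ∃ p : MvPolynomial (Fin 3) ℂ, p.IsWeightedHomogeneous eisensteinDegree m ∧
      eisensteinEval p = f := by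
  obtain ⟨s, A, hA, h⟩ := hf
  exact HasExpansion.exists_polynomial (s := s + 1) hA h

/-- The matrix −1 fixes τ and has X = 0, but j = −1, so the law gives f = −f. -/
theorem eq_zero_of_mem_odd {k : ℤ} (hk : Odd k) {f : ℍ → ℂ} (hf : f ∈ quasiModularForms k) :
    f = 0 := by
  obtain ⟨s, A, hA, h⟩ := hf
  ext τ
  have h1 := h 1 τ
  have h2 := h (-1) τ
  have hX : cocycleX (-1) τ = 0 := by simp [cocycleX]
  rw [hX, slash_apply, denom_SL] at h2
  rw [cocycleX_one, SlashAction.slash_one, ← h2] at h1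
  have h3 : f τ = -f τ := by
    simpa [Odd.neg_one_zpow hk.neg] using h1
  exact self_eq_neg.1 h3

/-- Positivity of the coefficients 1, 2, 3 is what excludes negative degrees and leaves finitely
many monomials in each degree. -/
theorem isModularPolynomial_degree_nonneg (d : Fin 3 →₀ ℕ) :
    Finsupp.weight eisensteinDegree d = d 0 + 2 * d 1 + 3 * d 2 := by
  simp [Finsupp.weight_apply, Finsupp.sum_fintype, Fin.sum_univ_three, eisensteinDegree]
  ring

theorem eq_zero_of_mem_neg {m : ℤ} (hm : m < 0) {f : ℍ → ℂ}
    (hf : f ∈ quasiModularForms (2 * m)) : f = 0 := by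
  obtain ⟨p, hp, rfl⟩ := exists_polynomial_of_mem hf
  have : p = 0 := by
    ext d
    by_contra h
    have := hp h
    rw [isModularPolynomial_degree_nonneg] at this
    omega
  rw [this, map_zero]

theorem mem_quasiModularForms_of_modularForm {k : ℤ} (f : ModularForm 𝒮ℒ k) :
    (f : ℍ → ℂ) ∈ quasiModularForms k :=
  ⟨0, fun _ => f, fun _ => isHolomorphicWithCusp_of_modularForm f, fun γ τ => by
    simp [modularForm_slash]⟩

theorem E2_mem_quasiModularForms : E2 ∈ quasiModularForms 2 :=
  ⟨1, fun n => if n = 0 then E2 else anomaly • 1, fun n => by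
    dsimp only
    split_ifs
    exacts [isHolomorphicWithCusp_E2, IsHolomorphicWithCusp.one.smul _], fun γ τ => by
    rw [E2_slash]
    simp [Finset.sum_range_succ]
    ring⟩

theorem quasiModularForms_pow {k : ℤ} {f : ℍ → ℂ} (hf : f ∈ quasiModularForms k) (n : ℕ) :
    f ^ n ∈ quasiModularForms (n * k) := by
  induction n with
  | zero =>
    rw [pow_zero, Nat.cast_zero, zero_mul]
    exact ⟨0, fun _ => 1, fun _ => .one, fun γ τ => by simp [ModularForm.is_invariant_one]⟩
  | succ n ih =>
    rw [pow_succ, show ((n + 1 : ℕ) : ℤ) * k = n * k + k by push_cast; ring]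
    exact quasiModularForms_mul ih hf

theorem eisensteinEval_mem {m : ℤ} {p : MvPolynomial (Fin 3) ℂ}
    (hp : p.IsWeightedHomogeneous eisensteinDegree m) :
    eisensteinEval p ∈ quasiModularForms (2 * m) := by
  rw [p.as_sum, map_sum]
  refine Submodule.sum_mem _ fun d hd => ?_
  have hw := hp (MvPolynomial.mem_support_iff.1 hd)
  rw [isModularPolynomial_degree_nonneg] at hw
  rw [MvPolynomial.monomial_eq, ← smul_eq_mul, MvPolynomial.C_mul', smul_eq_mul, map_smul]
  refine Submodule.smul_mem _ _ ?_
  rw [Finsupp.prod_fintype _ _ fun _ => pow_zero _, Fin.prod_univ_three]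
  simp only [map_mul, map_pow, eisensteinEval_X_zero, eisensteinEval_X_one, eisensteinEval_X_two]
  have := quasiModularForms_mul (quasiModularForms_mul
    (quasiModularForms_pow E2_mem_quasiModularForms (d 0))
    (quasiModularForms_pow (mem_quasiModularForms_of_modularForm E₄) (d 1)))
    (quasiModularForms_pow (mem_quasiModularForms_of_modularForm E₆) (d 2))
  rwa [← hw, show (2 * (d 0 + 2 * d 1 + 3 * d 2) : ℤ) = d 0 * 2 + d 1 * 4 + d 2 * 6 by ring]

/-- The algebra is the sum over nonnegative even weights, while degrees are indexed by all integers;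
negative weights contribute only zero. -/
theorem quasiModularForms_le (m : ℤ) :
    quasiModularForms (2 * m) ≤ Subalgebra.toSubmodule quasiModularAlgebra := by
  intro f hf
  obtain h | h := lt_or_ge m 0
  · rw [eq_zero_of_mem_neg h hf]
    exact Submodule.zero_mem _
  · lift m to ℕ using h
    exact Submodule.mem_iSup_of_mem m hf

theorem eisensteinEval_range : eisensteinEval.range = quasiModularAlgebra := by
  refine le_antisymm ?_ fun f hf => ?_
  · rw [eisensteinEval, ← Algebra.adjoin_range_eq_range_aeval, Algebra.adjoin_le_iff]
    rintro _ ⟨i, rfl⟩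
    fin_cases i
    · exact quasiModularForms_le 1 E2_mem_quasiModularForms
    · exact quasiModularForms_le 2 (mem_quasiModularForms_of_modularForm E₄)
    · exact quasiModularForms_le 3 (mem_quasiModularForms_of_modularForm E₆)
  · have hle : (⨆ k : ℕ, quasiModularForms (2 * k)) ≤
        Subalgebra.toSubmodule eisensteinEval.range := iSup_le fun k g hg => by
      obtain ⟨p, -, rfl⟩ := exists_polynomial_of_mem hg
      exact ⟨p, rfl⟩
    exact hle hf

end QuasiModular

/-! ### Algebraic independence of `E₂`, `E₄` and `E₆` -/

namespace QuasiModular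

/-- Near a point where `f` is nonzero `g` must vanish, and the identity theorem on the connected ℍ
does the rest. -/
theorem eq_zero_of_mul_eq_zero {f g : ℍ → ℂ} (hf : MDiff f) (hg : MDiff g) (hfg : f * g = 0)
    (hne : f ≠ 0) : g = 0 := by
  obtain ⟨τ, hτ⟩ := Function.ne_iff.1 hne
  rw [UpperHalfPlane.mdifferentiable_iff] at hf hg
  have hconv : IsPreconnected upperHalfPlaneSet :=
    (convex_halfSpace_im_gt 0).isPreconnected
  have hcont : ∀ᶠ z in nhds (τ : ℂ), (f ∘ ofComplex) z ≠ 0 := by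
    refine ContinuousAt.eventually_ne ?_ (by simpa using hτ)
    exact (hf.differentiableAt (isOpen_upperHalfPlaneSet.mem_nhds τ.im_pos)).continuousAt
  have hev : g ∘ ofComplex =ᶠ[nhds (τ : ℂ)] 0 := by
    filter_upwards [hcont] with z hz
    have := congrFun hfg (ofComplex z)
    exact (mul_eq_zero.1 this).resolve_left hz
  have := (hg.analyticOnNhd isOpen_upperHalfPlaneSet).eqOn_zero_of_preconnected_of_eventuallyEq_zero
    hconv τ.im_pos hev
  ext σ
  simpa using this σ.im_pos

theorem eisensteinEval_apply (p : MvPolynomial (Fin 3) ℂ) (τ : ℍ) :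
    eisensteinEval p τ = MvPolynomial.aeval ![E2 τ, E₄ τ, E₆ τ] p := by
  have h : (Pi.evalAlgHom ℂ (fun _ : ℍ => ℂ) τ).comp eisensteinEval =
      MvPolynomial.aeval ![E2 τ, E₄ τ, E₆ τ] := by
    ext i
    fin_cases i <;> simp [eisensteinEval]
  exact DFunLike.congr_fun h p

theorem mdifferentiable_eval (p : MvPolynomial (Fin 3) ℂ) {f : Fin 3 → ℍ → ℂ}
    (hf : ∀ i, MDiff (f i)) : MDiff (MvPolynomial.aeval f p) := by
  induction p using MvPolynomial.induction_on with
  | C c =>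
    rw [MvPolynomial.aeval_C]
    exact mdifferentiable_const
  | add p q hp hq => rw [map_add]; exact hp.add hq
  | mul_X p i hp => rw [map_mul, MvPolynomial.aeval_X]; exact hp.mul (hf i)

theorem mdifferentiable_eisenstein (i : Fin 3) :
    MDiff ((![E2, E₄, E₆] : Fin 3 → ℍ → ℂ) i) := by
  fin_cases i
  exacts [E2_mdifferentiable, E₄.holo', E₆.holo']

theorem mdifferentiable_eisensteinEval (p : MvPolynomial (Fin 3) ℂ) :
    MDiff (eisensteinEval p) :=
  mdifferentiable_eval p mdifferentiable_eisenstein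

theorem E2_smul (γ : SL(2, ℤ)) (τ : ℍ) :
    E2 (γ • τ) = denom γ τ ^ 2 * E2 τ + anomaly * (γ 1 0 : ℂ) * denom γ τ := by
  have h := E2_slash γ τ
  rw [slash_apply, cocycleX] at h
  have hd := denom_ne_zero (γ : GL (Fin 2) ℝ) τ
  rw [zpow_neg] at h
  field_simp at h
  linear_combination h

theorem modularForm_smul {k : ℕ} (f : ModularForm 𝒮ℒ k) (γ : SL(2, ℤ)) (τ : ℍ) :
    f (γ • τ) = denom γ τ ^ k * f τ := by
  have h := congrFun (modularForm_slash f γ) τ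
  rw [slash_apply, zpow_neg, zpow_natCast] at h
  rw [← h]
  have hd := pow_ne_zero k (denom_ne_zero (γ : GL (Fin 2) ℝ) τ)
  field_simp

/-- The integral matrix with lower row `(c, c n + 1)`. -/
def lowerRowMatrix (c n : ℤ) : SL(2, ℤ) := ⟨!![1, n; c, c * n + 1], by simp [mul_comm]⟩

theorem denom_lowerRowMatrix (c n : ℤ) (τ : ℍ) :
    denom (lowerRowMatrix c n) τ = c * τ + c * n + 1 := by
  rw [denom_SL]
  simp [lowerRowMatrix]
  ring

/-- The relation at γτ is a polynomial identity in c and j. For a lower row (c, cn + 1) with fixed c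
≠ 0, j = cτ + cn + 1 takes infinitely many values as n varies, so j may be replaced by any y. The
result is polynomial in c and holds at all positive integers, so c may be replaced by any x. -/
theorem aeval_eq_zero_of_lowerRow {p : MvPolynomial (Fin 3) ℂ} (hp : eisensteinEval p = 0)
    (τ : ℍ) (x y : ℂ) :
    MvPolynomial.aeval ![y ^ 2 * E2 τ + anomaly * x * y, y ^ 4 * E₄ τ, y ^ 6 * E₆ τ] p = 0 := by
  have h0 (c n : ℤ) : MvPolynomial.aeval ![(c * τ + c * n + 1 : ℂ) ^ 2 * E2 τ +
      anomaly * c * (c * τ + c * n + 1), (c * τ + c * n + 1 : ℂ) ^ 4 * E₄ τ,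
      (c * τ + c * n + 1 : ℂ) ^ 6 * E₆ τ] p = 0 := by
    have h := congrFun hp (lowerRowMatrix c n • τ)
    rw [eisensteinEval_apply, E2_smul, modularForm_smul (k := 4) E₄,
      modularForm_smul (k := 6) E₆, denom_lowerRowMatrix] at h
    exact h
  have h1 (c : ℕ) (hc : c ≠ 0) (y : ℂ) : MvPolynomial.aeval ![y ^ 2 * E2 τ +
      anomaly * c * y, y ^ 4 * E₄ τ, y ^ 6 * E₆ τ] p = 0 := by
    let P : Polynomial ℂ := MvPolynomial.aeval ![Polynomial.X ^ 2 * Polynomial.C (E2 τ) +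
      Polynomial.C (anomaly * c) * Polynomial.X, Polynomial.X ^ 4 * Polynomial.C (E₄ τ),
      Polynomial.X ^ 6 * Polynomial.C (E₆ τ)] p
    have hP (y : ℂ) : P.eval y = MvPolynomial.aeval ![y ^ 2 * E2 τ +
        anomaly * c * y, y ^ 4 * E₄ τ, y ^ 6 * E₆ τ] p := by
      rw [← Polynomial.coe_aeval_eq_eval, MvPolynomial.comp_aeval_apply]
      congr 2
      ext i
      fin_cases i <;> simp <;> ring
    have hP0 : P = 0 := by
      refine Polynomial.eq_zero_of_infinite_isRoot P ((Set.infinite_range_of_injective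
        (f := fun n : ℤ => (c * τ + c * n + 1 : ℂ)) fun m n hmn => ?_).mono ?_)
      · have hc' : (c : ℂ) ≠ 0 := by exact_mod_cast hc
        have h2 : (m : ℂ) = n := mul_left_cancel₀ hc' (by linear_combination hmn)
        exact_mod_cast h2
      · rintro _ ⟨n, rfl⟩
        have := h0 c n
        simp only [Int.cast_natCast] at this
        exact (hP _).trans this
    rw [← hP, hP0, Polynomial.eval_zero]
  let P : Polynomial ℂ := MvPolynomial.aeval ![Polynomial.C (y ^ 2 * E2 τ) +
    Polynomial.C (anomaly * y) * Polynomial.X, Polynomial.C (y ^ 4 * E₄ τ),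
    Polynomial.C (y ^ 6 * E₆ τ)] p
  have hP (x : ℂ) : P.eval x = MvPolynomial.aeval ![y ^ 2 * E2 τ +
      anomaly * x * y, y ^ 4 * E₄ τ, y ^ 6 * E₆ τ] p := by
    rw [← Polynomial.coe_aeval_eq_eval, MvPolynomial.comp_aeval_apply]
    congr 2
    ext i
    fin_cases i <;> simp
    ring
  have hP0 : P = 0 := by
    refine Polynomial.eq_zero_of_infinite_isRoot P ((Set.infinite_range_of_injective
      (f := fun n : ℕ => ((n + 1 : ℕ) : ℂ)) fun m n hmn => ?_).mono ?_)
    · have h2 : ((m + 1 : ℕ) : ℂ) = ((n + 1 : ℕ) : ℂ) := hmn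
      have : m + 1 = n + 1 := by exact_mod_cast h2
      omega
    · rintro _ ⟨n, rfl⟩
      exact (hP _).trans (h1 (n + 1) n.succ_ne_zero y)
  rw [← hP, hP0, Polynomial.eval_zero]

/-- The parameter x enters only the first argument, with the nonzero coefficient `anomaly * y`, so
that argument can be given any value w. -/
theorem aeval_eq_zero_of_scaling {p : MvPolynomial (Fin 3) ℂ} (hp : eisensteinEval p = 0)
    (w y : ℂ) (hy : y ≠ 0) (τ : ℍ) :
    MvPolynomial.aeval ![w, y ^ 4 * E₄ τ, y ^ 6 * E₆ τ] p = 0 := by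
  have h := aeval_eq_zero_of_lowerRow hp τ ((w - y ^ 2 * E2 τ) / (anomaly * y)) y
  have ha := anomaly_ne_zero
  rwa [show y ^ 2 * E2 τ + anomaly * ((w - y ^ 2 * E2 τ) / (anomaly * y)) * y = w by
    field_simp; ring] at h

/-- S fixes i and j(S, i)⁶ = i⁶ = −1, so E₆(i) equals its own negative. -/
theorem E₆_I : E₆ UpperHalfPlane.I = 0 := by
  have h := modularForm_smul (k := 6) E₆ ModularGroup.S UpperHalfPlane.I
  rw [show ModularGroup.S • UpperHalfPlane.I = UpperHalfPlane.I by
    rw [modular_S_smul]; ext; simp, denom_SL] at h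
  have h6 : (Complex.I : ℂ) ^ 6 = -1 := by
    rw [show (6 : ℕ) = 2 * 3 from rfl, pow_mul, Complex.I_sq]; norm_num
  have h7 : E₆ UpperHalfPlane.I = - E₆ UpperHalfPlane.I := by
    simpa [ModularGroup.S, h6] using h
  exact self_eq_neg.1 h7

theorem E₄_I_ne_zero : E₄ UpperHalfPlane.I ≠ 0 := fun h => by
  refine discriminant_ne_zero UpperHalfPlane.I ?_
  rw [discriminant_eq_E₄_cube_sub_E₆_sq, h, E₆_I]
  simp

theorem E₆_ne_zero : (E₆ : ℍ → ℂ) ≠ 0 := fun h =>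
  E_ne_zero (k := 6) (by norm_num) ⟨3, rfl⟩ (DFunLike.coe_injective h)

/-- The remainder of `p` modulo the third variable does not involve that variable, and it vanishes
wherever the second argument is nonzero. -/
theorem aeval_modMonomial_zero {p : MvPolynomial (Fin 3) ℂ}
    (h : ∀ w u : ℂ, u ≠ 0 → MvPolynomial.aeval ![w, u, 0] p = 0) :
    MvPolynomial.X 2 ∣ p := by
  rw [MvPolynomial.X_dvd_iff_modMonomial_eq_zero]
  set r := p.modMonomial (Finsupp.single 2 1)
  have hr (w u v : ℂ) : MvPolynomial.aeval ![w, u, v] r = MvPolynomial.aeval ![w, u, 0] r := by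
    rw [MvPolynomial.aeval_def, MvPolynomial.aeval_def, MvPolynomial.eval₂_eq',
      MvPolynomial.eval₂_eq']
    refine Finset.sum_congr rfl fun d hd => ?_
    have hd2 : d 2 = 0 := by
      by_contra h0
      refine MvPolynomial.mem_support_iff.1 hd (MvPolynomial.coeff_modMonomial_of_le p ?_)
      rw [Finsupp.single_le_iff]
      omega
    simp [Fin.prod_univ_three, hd2]
  have hr0 (w u : ℂ) (hu : u ≠ 0) : MvPolynomial.aeval ![w, u, 0] r = 0 := by
    have h1 := h w u hu
    rw [← MvPolynomial.divMonomial_add_modMonomial_single p 2, map_add, map_mul] at h1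
    simpa using h1
  -- The factor `X 1` takes care of the excluded points u = 0; it is cancelled afterwards.
  have hX : MvPolynomial.X 1 * r = 0 := by
    refine MvPolynomial.funext fun x => ?_
    have hx : x = ![x 0, x 1, x 2] := by
      ext i
      fin_cases i <;> rfl
    rw [map_mul, MvPolynomial.eval_X, map_zero]
    by_cases h1 : x 1 = 0
    · rw [h1, zero_mul]
    · have := hr0 (x 0) (x 1) h1
      rw [← hr _ _ (x 2), ← hx, MvPolynomial.aeval_eq_eval] at this
      exact mul_eq_zero_of_right _ this
  exact (mul_eq_zero.1 hX).resolve_left (MvPolynomial.X_ne_zero _)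

/-- Descent on the total degree. At τ = i the third argument vanishes and y⁴E₄(i) runs through all
nonzero numbers, so `X 2` divides `p`. The quotient satisfies the same hypothesis, because the
factor y⁶E₆ is not identically zero and can be cancelled as a function of τ. -/
theorem eq_zero_of_scaling (p : MvPolynomial (Fin 3) ℂ)
    (hp : ∀ (w y : ℂ) (τ : ℍ), y ≠ 0 →
      MvPolynomial.aeval ![w, y ^ 4 * E₄ τ, y ^ 6 * E₆ τ] p = 0) : p = 0 := by
  induction hn : p.totalDegree using Nat.strong_induction_on generalizing p with
  | _ n ih =>
    by_contra hne
    obtain ⟨q, rfl⟩ := aeval_modMonomial_zero (p := p) fun w u hu => by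
      obtain ⟨y, hy⟩ := IsAlgClosed.exists_pow_nat_eq (u / E₄ UpperHalfPlane.I) (n := 4)
        (by norm_num)
      have hy0 : y ≠ 0 := by
        rintro rfl
        rw [zero_pow (by norm_num), eq_comm, div_eq_zero_iff] at hy
        exact hy.elim hu E₄_I_ne_zero
      have h := hp w y UpperHalfPlane.I hy0
      rwa [hy, E₆_I, mul_zero, div_mul_cancel₀ _ E₄_I_ne_zero] at h
    have hq : q ≠ 0 := fun h => hne (by rw [h, mul_zero])
    refine hq (ih _ ?_ q (fun w y τ hy => ?_) rfl)
    · rw [← hn, MvPolynomial.totalDegree_mul_of_isDomain (MvPolynomial.X_ne_zero _) hq,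
        MvPolynomial.totalDegree_X]
      omega
    · set F : Fin 3 → ℍ → ℂ := ![fun _ => w, y ^ 4 • (E₄ : ℍ → ℂ), y ^ 6 • (E₆ : ℍ → ℂ)]
      have hF : ∀ i, MDiff (F i) := fun i => by
        fin_cases i
        exacts [mdifferentiable_const, MDifferentiable.const_smul _ E₄.holo',
          MDifferentiable.const_smul _ E₆.holo']
      have hFa (p : MvPolynomial (Fin 3) ℂ) (σ : ℍ) : MvPolynomial.aeval F p σ =
          MvPolynomial.aeval ![w, y ^ 4 * E₄ σ, y ^ 6 * E₆ σ] p := by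
        have h : (Pi.evalAlgHom ℂ (fun _ : ℍ => ℂ) σ).comp (MvPolynomial.aeval F) =
            MvPolynomial.aeval ![w, y ^ 4 * E₄ σ, y ^ 6 * E₆ σ] := by
          ext i
          fin_cases i <;> simp [F]
        exact DFunLike.congr_fun h p
      have h0 := eq_zero_of_mul_eq_zero E₆.holo' (mdifferentiable_eval q hF) (by
        ext σ
        have h := hp w y σ hy
        rw [map_mul, MvPolynomial.aeval_X] at h
        have hy6 := pow_ne_zero 6 hy
        rw [Pi.mul_apply, hFa]
        have h' : y ^ 6 * (E₆ σ *
          MvPolynomial.aeval ![w, y ^ 4 * E₄ σ, y ^ 6 * E₆ σ] q) = 0 := by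
          rw [← mul_assoc]; exact h
        exact (mul_eq_zero.1 h').resolve_left hy6) E₆_ne_zero
      rw [← hFa, h0]
      rfl

theorem eisensteinEval_injective : Function.Injective eisensteinEval :=
  (injective_iff_map_eq_zero _).2 fun p hp =>
    eq_zero_of_scaling p fun w y τ hy => aeval_eq_zero_of_scaling hp w y hy τ

end QuasiModular

/-! ### The derivation `θ` on quasi-modular forms -/

namespace QuasiModular

open Derivative

/-- Cauchy's estimate on the unit disc around z. Requiring Im z ≥ max(A, 0) + 2 keeps that disc
inside ℍ and inside the region where `f` is bounded by M. -/
theorem isBoundedAtImInfty_derivative {f : ℍ → ℂ} (hf : IsHolomorphicWithCusp f) :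
    IsBoundedAtImInfty (normalizedDerivOfComplex f) := by
  obtain ⟨hd, hb⟩ := hf
  rw [isBoundedAtImInfty_iff] at hb ⊢
  obtain ⟨M, A, hM⟩ := hb
  rw [UpperHalfPlane.mdifferentiable_iff] at hd
  refine ⟨‖(2 * Real.pi * Complex.I : ℂ)⁻¹‖ * (M / 1), max A 0 + 2, fun z hz => ?_⟩
  have him : ∀ w ∈ Metric.closedBall (z : ℂ) 1, max A 0 + 1 ≤ w.im := fun w hw => by
    have h1 : |w.im - z.im| ≤ 1 := by
      have := (Complex.abs_im_le_norm (w - z)).trans (mem_closedBall_iff_norm.1 hw)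
      rwa [Complex.sub_im] at this
    have := (abs_le.1 h1).1
    linarith
  rw [normalizedDerivOfComplex, norm_mul]
  refine mul_le_mul_of_nonneg_left (Complex.norm_deriv_le_of_forall_mem_sphere_norm_le one_pos
    (DifferentiableOn.diffContOnCl_ball (hd) fun w hw => ?_) fun w hw => ?_) (norm_nonneg _)
  · have := him w hw
    have := le_max_right A 0
    change 0 < w.im
    linarith
  · have h1 := him w (Metric.sphere_subset_closedBall hw)
    have h2 := le_max_left A 0
    have h3 := le_max_right A 0
    have hw0 : 0 < w.im := by linarith
    rw [Function.comp_apply, ofComplex_apply_of_im_pos hw0]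
    exact hM ⟨w, hw0⟩ (by change A ≤ w.im; linarith)

theorem isHolomorphicWithCusp_derivative {f : ℍ → ℂ} (hf : IsHolomorphicWithCusp f) :
    IsHolomorphicWithCusp (normalizedDerivOfComplex f) :=
  ⟨normalizedDerivOfComplex_mdifferentiable hf.1, isBoundedAtImInfty_derivative hf⟩

theorem isHolomorphicWithCusp_serreDerivative (k : ℂ) {f : ℍ → ℂ}
    (hf : IsHolomorphicWithCusp f) : IsHolomorphicWithCusp (serreDerivative k f) := by
  have h : serreDerivative k f = normalizedDerivOfComplex f + (-(k * 12⁻¹)) • (E2 * f) := by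
    ext τ
    simp only [serreDerivative_apply, Pi.add_apply, Pi.smul_apply, Pi.mul_apply, smul_eq_mul]
    ring
  rw [h]
  exact (isHolomorphicWithCusp_derivative hf).add ((isHolomorphicWithCusp_E2.mul hf).smul _)

/-- The derivative of a modular form of weight `2 m` is `(m / 6) E₂ f` plus a modular form. -/
theorem exists_derivative_eq {m : ℤ} (f : ModularForm 𝒮ℒ (2 * m)) :
    ∃ p, IsModularPolynomial (m + 1) p ∧
      normalizedDerivOfComplex f = (m / 6 : ℂ) • (E2 * f) + eisensteinEval p := by
  -- The Serre derivative θf − (k/12) E₂ f is modular of weight k + 2; here k = 2m, whence the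
  -- coefficient m/6.
  obtain ⟨p, hp, hpf⟩ := exists_isModularPolynomial (m + 1) (modularFormOf
    (serreDerivative (2 * m : ℤ) f)
    (isHolomorphicWithCusp_serreDerivative _ (isHolomorphicWithCusp_of_modularForm f))
    fun γ => by
      rw [mul_add, mul_one]
      exact serreDerivative_slash_invariant f.holo' (modularForm_slash f γ))
  refine ⟨p, hp, ?_⟩
  rw [hpf, coe_modularFormOf]
  ext τ
  simp only [serreDerivative_apply, Pi.add_apply, Pi.smul_apply, Pi.mul_apply, smul_eq_mul]
  push_cast
  ring

theorem hasDerivAt_cocycleX (γ : SL(2, ℤ)) (τ : ℍ) :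
    HasDerivAt (fun z : ℂ => cocycleX γ (ofComplex z)) (-cocycleX γ τ ^ 2) τ := by
  have hne : (γ 1 0 : ℂ) * τ + (γ 1 1 : ℂ) ≠ 0 := by
    rw [← denom_SL]
    exact denom_ne_zero _ _
  have h1 : HasDerivAt (fun z : ℂ => (γ 1 0 : ℂ) * z + (γ 1 1 : ℂ)) (γ 1 0 : ℂ) τ := by
    simpa using ((hasDerivAt_id (τ : ℂ)).const_mul (γ 1 0 : ℂ)).add_const (γ 1 1 : ℂ)
  have h2 := (hasDerivAt_const (τ : ℂ) (γ 1 0 : ℂ)).div h1 hne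
  refine (h2.congr_deriv ?_).congr_of_eventuallyEq ?_
  · rw [cocycleX, denom_SL]
    field_simp
    ring
  · filter_upwards [isOpen_upperHalfPlaneSet.mem_nhds τ.im_pos] with z hz
    rw [cocycleX, denom_SL, ofComplex_apply_of_im_pos hz]
    rfl

/-- The parameter of the Serre derivative is 1, although E₂ has weight 2. Writing a for `anomaly` =
12/(2πi), θE₂ acquires (2XE₂ + aX²)/(2πi) and E₂²/12 acquires aXE₂/6 + a²X²/12, which are equal. -/
theorem derivative_E2_slash (γ : SL(2, ℤ)) :
    serreDerivative 1 E2 ∣[(4 : ℤ)] γ = serreDerivative 1 E2 := by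
  have hslash : E2 ∣[(2 : ℤ)] γ = fun τ => E2 τ + anomaly * cocycleX γ τ :=
    funext fun τ => E2_slash γ τ
  have hpi : (Real.pi : ℂ) ≠ 0 := by exact_mod_cast Real.pi_ne_zero
  ext τ
  have h := congrFun (normalizedDerivOfComplex_SL_slash (k := 2) E2_mdifferentiable (γ := γ)) τ
  have hX := hasDerivAt_cocycleX γ τ
  have hE : DifferentiableAt ℂ (E2 ∘ ofComplex) τ :=
    UpperHalfPlane.mdifferentiableAt_iff.mp (E2_mdifferentiable τ)
  have hD : normalizedDerivOfComplex (E2 ∣[(2 : ℤ)] γ) τ = normalizedDerivOfComplex E2 τ +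
      (2 * Real.pi * Complex.I)⁻¹ * (anomaly * -cocycleX γ τ ^ 2) := by
    rw [hslash, normalizedDerivOfComplex, normalizedDerivOfComplex,
      ← mul_add]
    congr 1
    exact (hE.hasDerivAt.add (hX.const_mul anomaly)).deriv
  rw [hD, Pi.sub_apply, E2_slash] at h
  change _ = _ - _ * cocycleX γ τ * _ at h
  have hDs : (normalizedDerivOfComplex E2 ∣[(4 : ℤ)] γ) τ = normalizedDerivOfComplex E2 τ +
      (2 * Real.pi * Complex.I)⁻¹ * (anomaly * -cocycleX γ τ ^ 2) +
      ((2 : ℤ) : ℂ) * (2 * Real.pi * Complex.I)⁻¹ * cocycleX γ τ *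
        (E2 τ + anomaly * cocycleX γ τ) := by
    rw [h]
    exact (sub_add_cancel _ _).symm
  have hE2 : (E2 (γ • τ)) ^ 2 * denom γ τ ^ (-4 : ℤ) = (E2 τ + anomaly * cocycleX γ τ) ^ 2 := by
    rw [← E2_slash, slash_apply, mul_pow, ← zpow_natCast (_ ^ (-2 : ℤ)), ← zpow_mul]
    rfl
  rw [slash_apply] at hDs ⊢
  rw [serreDerivative_apply, serreDerivative_apply, sub_mul, hDs, mul_assoc (_ * _) (E2 _) (E2 _),
    ← pow_two, mul_assoc _ (_ ^ 2), hE2, anomaly]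
  push_cast
  field_simp
  ring

theorem exists_derivative_E2_eq :
    ∃ p, IsModularPolynomial 2 p ∧
      normalizedDerivOfComplex E2 = (1 / 12 : ℂ) • (E2 * E2) + eisensteinEval p := by
  obtain ⟨p, hp, hpf⟩ := exists_isModularPolynomial 2 (modularFormOf
    (serreDerivative 1 E2) (isHolomorphicWithCusp_serreDerivative _ isHolomorphicWithCusp_E2)
    derivative_E2_slash)
  refine ⟨p, hp, ?_⟩
  rw [hpf, coe_modularFormOf]
  ext τ
  simp only [serreDerivative_apply, Pi.add_apply, Pi.smul_apply, Pi.mul_apply, smul_eq_mul]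
  ring

/-- The derivation `θ` raises the degree by one, and `12 ∂/∂E₂` of it is `2 L(0)`, on generators. -/
theorem exists_theta_generators :
    ∃ g : Fin 3 → MvPolynomial (Fin 3) ℂ, ∀ i,
      (g i).IsWeightedHomogeneous eisensteinDegree (eisensteinDegree i + 1) ∧
      (12 : ℂ) • MvPolynomial.pderiv 0 (g i) =
        (2 * eisensteinDegree i : ℂ) • MvPolynomial.X i ∧
      eisensteinEval (g i) = normalizedDerivOfComplex (eisensteinEval (MvPolynomial.X i)) := by
  obtain ⟨p2, h2, e2⟩ := exists_derivative_E2_eq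
  obtain ⟨p4, h4, e4⟩ := exists_derivative_eq (m := 2) E₄
  obtain ⟨p6, h6, e6⟩ := exists_derivative_eq (m := 3) E₆
  have hX0 := isWeightedHomogeneous_X_zero
  have key (c : ℂ) {i : Fin 3} {q} (hq : IsModularPolynomial (eisensteinDegree i + 1) q) :
      (c • (MvPolynomial.X 0 * MvPolynomial.X i) + q).IsWeightedHomogeneous eisensteinDegree
        (eisensteinDegree i + 1) := by
    refine MvPolynomial.IsWeightedHomogeneous.add (Submodule.smul_mem
      (MvPolynomial.weightedHomogeneousSubmodule ℂ eisensteinDegree _) c ?_) hq.1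
    rw [add_comm]
    exact hX0.mul (MvPolynomial.isWeightedHomogeneous_X _ _ _)
  -- Only the terms containing E₂ matter for ∂/∂E₂. The unspecified `p2`, `p4`, `p6` are killed by
  -- it, so Ramanujan's explicit formulas are not needed.
  refine ⟨![(1 / 12 : ℂ) • (MvPolynomial.X 0 * MvPolynomial.X 0) + p2,
    ((2 : ℤ) / 6 : ℂ) • (MvPolynomial.X 0 * MvPolynomial.X 1) + p4,
    ((3 : ℤ) / 6 : ℂ) • (MvPolynomial.X 0 * MvPolynomial.X 2) + p6], fun i => ?_⟩
  fin_cases i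
  · refine ⟨key _ (i := 0) h2, ?_, ?_⟩
    · simp [h2.2, MvPolynomial.pderiv_X, eisensteinDegree, smul_smul]
      rw [← two_smul ℂ]
    · simp [e2]
  · refine ⟨key _ (i := 1) h4, ?_, ?_⟩
    · simp [h4.2, MvPolynomial.pderiv_X, eisensteinDegree, smul_smul]
      norm_num
    · simp [e4]
  · refine ⟨key _ (i := 2) h6, ?_, ?_⟩
    · simp [h6.2, MvPolynomial.pderiv_X, eisensteinDegree, smul_smul]
      norm_num
    · simp [e6]

end QuasiModular

/-! ### Finite support in vertex algebras -/

namespace VertexAlg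

variable {V : Type*} [AddCommGroup V] [Module ℂ V] (S : VertexAlg V)

theorem mode_add (a b : V) (n : ℤ) : S.mode (a + b) n = S.mode a n + S.mode b n := by
  rw [mode, map_add, map_add]
  rfl

theorem mode_smul (c : ℂ) (a : V) (n : ℤ) : S.mode (c • a) n = c • S.mode a n := by
  rw [mode, map_smul, map_smul]
  rfl

theorem mode_zero (n : ℤ) : S.mode 0 n = 0 := by
  rw [mode, map_zero, map_zero]
  rfl

theorem exists_mode_eq_zero (a b : V) (x : ℤ) :
    ∃ R : ℕ, ∀ k : ℕ, R ≤ k → S.mode a (x + k) b = 0 := by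
  set o := HahnSeries.order ((HahnModule.of ℂ).symm (S.Y a b))
  refine ⟨(-x - o).toNat, fun k hk => ?_⟩
  exact VertexOperator.ncoeff_eq_zero_of_lt_order (S.Y a) (x + k) b (by omega)

/-- The bound is uniform in i and l, which lets every sum in the Jacobi identity be cut at one
common R. The inner mode depends only on i + l and vanishes for i + l ≥ K; the remaining finitely
many inner states have individual bounds, which are added up. -/
theorem exists_mode_mode_eq_zero (a b c : V) (x y : ℤ) :
    ∃ R : ℕ, ∀ i l m : ℕ, R ≤ m → S.mode a (x - i + m) (S.mode b (y + i + l) c) = 0 := by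
  obtain ⟨K, hK⟩ := S.exists_mode_eq_zero b c y
  choose R hR using fun k : ℕ => S.exists_mode_eq_zero a (S.mode b (y + k) c) x
  refine ⟨K + ∑ k ∈ Finset.range K, R k, fun i l m hm => ?_⟩
  rw [add_assoc, ← Nat.cast_add]
  obtain h | h := le_or_gt K (i + l)
  · rw [hK _ h, map_zero]
  · have h1 : R (i + l) ≤ ∑ k ∈ Finset.range K, R k :=
      Finset.single_le_sum (fun _ _ => Nat.zero_le _) (Finset.mem_range.2 h)
    have h2 := hR (i + l) (m - i) (by omega)
    rwa [Nat.cast_sub (by omega), show x + ((m : ℤ) - i) = x - i + m by ring] at h2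

/-- The same uniformity for iterated products: only finitely many k give a nonzero state a(t + k)b.
-/
theorem exists_mode_of_mode_eq_zero (a b c : V) (x t : ℤ) :
    ∃ R : ℕ, ∀ k e : ℕ, R ≤ e → S.mode (S.mode a (t + k) b) (x - k + e) c = 0 := by
  obtain ⟨K, hK⟩ := S.exists_mode_eq_zero a b t
  choose R hR using fun k : ℕ => S.exists_mode_eq_zero (S.mode a (t + k) b) c x
  refine ⟨K + ∑ k ∈ Finset.range K, R k, fun k e he => ?_⟩
  obtain h | h := le_or_gt K k
  · rw [hK _ h, mode_zero, LinearMap.zero_apply]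
  · have h1 : R k ≤ ∑ k ∈ Finset.range K, R k :=
      Finset.single_le_sum (fun _ _ => Nat.zero_le _) (Finset.mem_range.2 h)
    have h2 := hR k (e - k) (by omega)
    rwa [Nat.cast_sub (by omega), show x + ((e : ℤ) - k) = x - k + e by ring] at h2

end VertexAlg

theorem finsum_eq_sum_range_of_le {M : Type*} [AddCommMonoid M] (f : ℕ → M) (R : ℕ)
    (h : ∀ i, R ≤ i → f i = 0) : ∑ᶠ i, f i = ∑ i ∈ Finset.range R, f i := by
  refine finsum_eq_sum_of_support_subset _ fun i hi => ?_
  by_contra h'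
  simp only [Finset.coe_range, Set.mem_Iio, not_lt] at h'
  exact hi (h i h')

/-! ### Families of products with finite support -/

/-- A family of bilinear products `a(n)b` such that `a(n)b = 0` for large `n`. -/
structure ModeFamily (M : Type*) [AddCommGroup M] [Module ℂ M] where
  /-- the products -/
  mode : ℤ → M →ₗ[ℂ] M →ₗ[ℂ] M
  exists_eq_zero : ∀ (a b : M) (x : ℤ), ∃ R : ℕ, ∀ k : ℕ, R ≤ k → mode (x + k) a b = 0

namespace ModeFamily

variable {M : Type*} [AddCommGroup M] [Module ℂ M] (μ : ModeFamily M)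

/-- The summands of the left hand side of the Jacobi identity. -/
def jacobiLeft (a b c : M) (r s t : ℤ) (i : ℕ) : M :=
  Ring.choose r i • μ.mode (r + s - i) (μ.mode (t + i) a b) c

/-- The summands of the right hand side of the Jacobi identity. -/
def jacobiRight (a b c : M) (r s t : ℤ) (i : ℕ) : M :=
  ((-1 : ℤ) ^ i * Ring.choose t i) • (μ.mode (r + t - i) a (μ.mode (s + i) b c) -
    (Int.negOnePow t : ℤ) • μ.mode (s + t - i) b (μ.mode (r + i) a c))

theorem finite_support_of_le {M : Type*} [AddCommGroup M] {f : ℕ → M} {R : ℕ}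
    (h : ∀ i, R ≤ i → f i = 0) :
    (Function.support f).Finite :=
  (Finset.range R).finite_toSet.subset fun i hi => by
    by_contra h'
    simp only [Finset.coe_range, Set.mem_Iio, not_lt] at h'
    exact hi (h i h')

theorem jacobiLeft_finite (a b c : M) (r s t : ℤ) :
    (Function.support (μ.jacobiLeft a b c r s t)).Finite := by
  obtain ⟨R, hR⟩ := μ.exists_eq_zero a b t
  exact finite_support_of_le (R := R) fun i hi => by
    rw [jacobiLeft, hR i hi, map_zero, LinearMap.zero_apply, smul_zero]

theorem jacobiRight_finite (a b c : M) (r s t : ℤ) :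
    (Function.support (μ.jacobiRight a b c r s t)).Finite := by
  obtain ⟨R, hR⟩ := μ.exists_eq_zero b c s
  obtain ⟨R', hR'⟩ := μ.exists_eq_zero a c r
  exact finite_support_of_le (R := max R R') fun i hi => by
    rw [jacobiRight, hR i (le_trans (le_max_left _ _) hi),
      hR' i (le_trans (le_max_right _ _) hi), map_zero, map_zero, smul_zero, sub_zero, smul_zero]

/-- The Jacobi identity for three states. -/
def Jacobi (a b c : M) : Prop :=
  ∀ r s t : ℤ, ∑ᶠ i, μ.jacobiLeft a b c r s t i = ∑ᶠ i, μ.jacobiRight a b c r s t i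

variable {μ}

/-- Both sides have finite support, so the sums split. Additivity in each of the three states
reduces the identity on a tensor product to pure tensors. -/
theorem Jacobi.add_left {a a' b c : M} (h : μ.Jacobi a b c) (h' : μ.Jacobi a' b c) :
    μ.Jacobi (a + a') b c := fun r s t => by
  have hl : μ.jacobiLeft (a + a') b c r s t =
      fun i => μ.jacobiLeft a b c r s t i + μ.jacobiLeft a' b c r s t i := by
    ext i
    simp only [jacobiLeft, map_add, LinearMap.add_apply, smul_add]
  have hr : μ.jacobiRight (a + a') b c r s t =
      fun i => μ.jacobiRight a b c r s t i + μ.jacobiRight a' b c r s t i := by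
    ext i
    simp only [jacobiRight, map_add, LinearMap.add_apply]
    rw [smul_add (t.negOnePow : ℤ), add_sub_add_comm, smul_add]
  rw [hl, hr, finsum_add_distrib (μ.jacobiLeft_finite _ _ _ _ _ _)
    (μ.jacobiLeft_finite _ _ _ _ _ _), finsum_add_distrib (μ.jacobiRight_finite _ _ _ _ _ _)
    (μ.jacobiRight_finite _ _ _ _ _ _), h, h']

theorem Jacobi.add_middle {a b b' c : M} (h : μ.Jacobi a b c) (h' : μ.Jacobi a b' c) :
    μ.Jacobi a (b + b') c := fun r s t => by
  have hl : μ.jacobiLeft a (b + b') c r s t =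
      fun i => μ.jacobiLeft a b c r s t i + μ.jacobiLeft a b' c r s t i := by
    ext i
    simp only [jacobiLeft, map_add, LinearMap.add_apply, smul_add]
  have hr : μ.jacobiRight a (b + b') c r s t =
      fun i => μ.jacobiRight a b c r s t i + μ.jacobiRight a b' c r s t i := by
    ext i
    simp only [jacobiRight, map_add, LinearMap.add_apply]
    rw [smul_add (t.negOnePow : ℤ), add_sub_add_comm, smul_add]
  rw [hl, hr, finsum_add_distrib (μ.jacobiLeft_finite _ _ _ _ _ _)
    (μ.jacobiLeft_finite _ _ _ _ _ _), finsum_add_distrib (μ.jacobiRight_finite _ _ _ _ _ _)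
    (μ.jacobiRight_finite _ _ _ _ _ _), h, h']

theorem Jacobi.add_right {a b c c' : M} (h : μ.Jacobi a b c) (h' : μ.Jacobi a b c') :
    μ.Jacobi a b (c + c') := fun r s t => by
  have hl : μ.jacobiLeft a b (c + c') r s t =
      fun i => μ.jacobiLeft a b c r s t i + μ.jacobiLeft a b c' r s t i := by
    ext i
    simp only [jacobiLeft, map_add, smul_add]
  have hr : μ.jacobiRight a b (c + c') r s t =
      fun i => μ.jacobiRight a b c r s t i + μ.jacobiRight a b c' r s t i := by
    ext i
    simp only [jacobiRight, map_add]
    rw [smul_add (t.negOnePow : ℤ), add_sub_add_comm, smul_add]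
  rw [hl, hr, finsum_add_distrib (μ.jacobiLeft_finite _ _ _ _ _ _)
    (μ.jacobiLeft_finite _ _ _ _ _ _), finsum_add_distrib (μ.jacobiRight_finite _ _ _ _ _ _)
    (μ.jacobiRight_finite _ _ _ _ _ _), h, h']

theorem jacobi_zero_left (b c : M) : μ.Jacobi 0 b c := fun r s t => by
  simp [jacobiLeft, jacobiRight]

theorem jacobi_zero_middle (a c : M) : μ.Jacobi a 0 c := fun r s t => by
  simp [jacobiLeft, jacobiRight]

theorem jacobi_zero_right (a b : M) : μ.Jacobi a b 0 := fun r s t => by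
  simp [jacobiLeft, jacobiRight]

/-! ### From products to fields. -/

variable (μ)

/-- The field with modes `a(n)`. -/
def field (a : M) : VertexOperator ℂ M :=
  -- The mode a(n) is the coefficient of z^(−n−1), so the coefficient of zᵐ is a(−m−1).
  VertexOperator.of_coeff (fun m => μ.mode (-m - 1) a) fun b => by
    obtain ⟨R, hR⟩ := μ.exists_eq_zero a b 0
    refine ⟨-R, fun m hm => ?_⟩
    by_contra h
    refine hm ?_
    have := hR (-m - 1).toNat (by omega)
    rwa [Int.toNat_of_nonneg (by omega), zero_add] at this

theorem ncoeff_field (a : M) (n : ℤ) : (μ.field a).ncoeff n = μ.mode n a := by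
  rw [field, VertexOperator.ncoeff_of_coeff]
  congr 2
  ring

/-- The state-field correspondence. -/
def fieldMap : M →ₗ[ℂ] VertexOperator ℂ M where
  toFun := μ.field
  map_add' a b := by
    refine HVertexOperator.coeff_inj (funext fun n => ?_)
    rw [VertexOperator.coeff_eq_ncoeff, ncoeff_field, map_add, map_add, Pi.add_apply,
      VertexOperator.coeff_eq_ncoeff, VertexOperator.coeff_eq_ncoeff, ncoeff_field, ncoeff_field]
  map_smul' c a := by
    refine HVertexOperator.coeff_inj (funext fun n => ?_)
    rw [VertexOperator.coeff_eq_ncoeff, ncoeff_field, map_smul, map_smul, Pi.smul_apply,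
      VertexOperator.coeff_eq_ncoeff, ncoeff_field, RingHom.id_apply]

/-- The vertex algebra given by a family of products. -/
def toVertexAlg (vac : M) (h0 : vac ≠ 0) (hc : ∀ (a : M) (n : ℤ), 0 ≤ n → μ.mode n a vac = 0)
    (hv : ∀ a : M, μ.mode (-1) a vac = a) (hJ : ∀ a b c, μ.Jacobi a b c) : VertexAlg M where
  Y := μ.fieldMap
  vac := vac
  vac_ne_zero := h0
  creative a n hn := (congrArg (fun f : Module.End ℂ M => f vac) (μ.ncoeff_field a n)).trans
    (hc a n hn)
  creates a := (congrArg (fun f : Module.End ℂ M => f vac) (μ.ncoeff_field a (-1))).trans (hv a)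
  jacobi a b c r s t := by
    have h (a : M) (n : ℤ) : (μ.fieldMap a).ncoeff n = μ.mode n a := μ.ncoeff_field a n
    simp only [h]
    exact hJ a b c r s t

end ModeFamily

/-- The products of a vertex algebra. -/
def VertexAlg.toModeFamily {V : Type*} [AddCommGroup V] [Module ℂ V] (S : VertexAlg V) :
    ModeFamily V where
  mode n := LinearMap.mk₂ ℂ (fun a b => S.mode a n b)
    (fun a b c => by rw [S.mode_add, LinearMap.add_apply])
    (fun a b c => by rw [S.mode_smul, LinearMap.smul_apply])
    (fun a b c => map_add _ _ _) (fun a b c => map_smul _ _ _)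
  exists_eq_zero a b x := S.exists_mode_eq_zero a b x

theorem VertexAlg.toModeFamily_mode {V : Type*} [AddCommGroup V] [Module ℂ V] (S : VertexAlg V)
    (n : ℤ) (a b : V) : S.toModeFamily.mode n a b = S.mode a n b := rfl

theorem VertexAlg.toModeFamily_jacobi {V : Type*} [AddCommGroup V] [Module ℂ V] (S : VertexAlg V)
    (a b c : V) : S.toModeFamily.Jacobi a b c := S.jacobi a b c

/-! ### Divided powers of a derivation -/

section DividedPower

variable {U : Type*} [CommRing U] [Algebra ℂ U] (D : Derivation ℂ U U)

/-- The operator `D ^ i / i!`. -/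
def Derivation.dividedPow (i : ℕ) : U →ₗ[ℂ] U := (i.factorial : ℂ)⁻¹ • (D : U →ₗ[ℂ] U) ^ i

theorem Derivation.dividedPow_zero (a : U) : D.dividedPow 0 a = a := by
  simp [Derivation.dividedPow]

theorem Derivation.apply_dividedPow (i : ℕ) (a : U) :
    D (D.dividedPow i a) = (i + 1 : ℂ) • D.dividedPow (i + 1) a := by
  simp only [Derivation.dividedPow, LinearMap.smul_apply, Derivation.map_smul, pow_succ',
    Module.End.mul_apply, smul_smul, Derivation.coeFn_coe]
  congr 1
  rw [Nat.factorial_succ]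
  have := Nat.factorial_ne_zero i
  have : (i + 1 : ℂ) ≠ 0 := by exact_mod_cast i.succ_ne_zero
  push_cast
  field_simp

theorem Derivation.dividedPow_apply (i : ℕ) (a : U) :
    D.dividedPow i (D a) = (i + 1 : ℂ) • D.dividedPow (i + 1) a := by
  rw [← D.apply_dividedPow]
  simp only [Derivation.dividedPow, LinearMap.smul_apply, Derivation.map_smul]
  congr 1
  exact LinearMap.congr_fun (pow_mul_comm' (D : U →ₗ[ℂ] U) i) a

/-- This says that e^{zD} is multiplicative. Apply D to the case n: after the Leibniz rule each term
of total degree n + 1 carries the weight p.1 + p.2 = n + 1, which is cancelled. -/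
theorem Derivation.dividedPow_mul (n : ℕ) (a b : U) :
    D.dividedPow n (a * b) =
      ∑ p ∈ Finset.HasAntidiagonal.antidiagonal n, D.dividedPow p.1 a * D.dividedPow p.2 b := by
  induction n with
  | zero => simp [Derivation.dividedPow_zero]
  | succ n ih =>
    have hn : (n + 1 : ℂ) ≠ 0 := by exact_mod_cast n.succ_ne_zero
    have h1 : ∑ p ∈ Finset.HasAntidiagonal.antidiagonal (n + 1),
        (p.1 : ℂ) • (D.dividedPow p.1 a * D.dividedPow p.2 b) =
        ∑ p ∈ Finset.HasAntidiagonal.antidiagonal n, D (D.dividedPow p.1 a) * D.dividedPow p.2 b := by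
      rw [Finset.Nat.sum_antidiagonal_succ]
      simp [Derivation.apply_dividedPow]
    have h2 : ∑ p ∈ Finset.HasAntidiagonal.antidiagonal (n + 1),
        (p.2 : ℂ) • (D.dividedPow p.1 a * D.dividedPow p.2 b) =
        ∑ p ∈ Finset.HasAntidiagonal.antidiagonal n, D.dividedPow p.1 a * D (D.dividedPow p.2 b) := by
      rw [Finset.Nat.sum_antidiagonal_succ']
      simp [Derivation.apply_dividedPow]
    have h3 : (n + 1 : ℂ) • ∑ p ∈ Finset.HasAntidiagonal.antidiagonal (n + 1),
        D.dividedPow p.1 a * D.dividedPow p.2 b = (n + 1 : ℂ) • D.dividedPow (n + 1) (a * b) := by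
      rw [← Derivation.apply_dividedPow, ih, map_sum, Finset.smul_sum]
      simp only [Derivation.leibniz, smul_eq_mul, Finset.sum_add_distrib]
      simp only [mul_comm (D.dividedPow _ b) (D _)]
      rw [← h1, ← h2, ← Finset.sum_add_distrib]
      refine Finset.sum_congr rfl fun p hp => ?_
      rw [← add_smul]
      congr 1
      have := Finset.HasAntidiagonal.mem_antidiagonal.1 hp
      rw [← Nat.cast_add, add_comm p.2 p.1, this]
      push_cast
      rfl
    exact (smul_right_injective U hn h3).symm

theorem Derivation.dividedPow_dividedPow (p u : ℕ) (a : U) :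
    D.dividedPow u (D.dividedPow p a) = ((p + u).choose p : ℂ) • D.dividedPow (p + u) a := by
  simp only [Derivation.dividedPow, LinearMap.smul_apply, LinearMap.map_smul, smul_smul]
  rw [← Module.End.mul_apply, ← pow_add, add_comm u p]
  congr 1
  rw [Nat.choose_symm_add, Nat.add_choose, Nat.cast_div
    (Nat.factorial_mul_factorial_dvd_factorial_add p u)
    (Nat.cast_ne_zero.2 (by positivity))]
  have := Nat.factorial_ne_zero p
  have := Nat.factorial_ne_zero u
  have := Nat.factorial_ne_zero (p + u)
  push_cast
  field_simp

end DividedPower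

/-! ### Rearranging finite sums -/

theorem sum_antidiagonal_range {M : Type*} [AddCommMonoid M] (h : ℕ → ℕ → M) (R : ℕ)
    (hz : ∀ i j, R ≤ i + j → h i j = 0) :
    ∑ k ∈ Finset.range R, ∑ p ∈ Finset.HasAntidiagonal.antidiagonal k, h p.1 p.2 =
      ∑ i ∈ Finset.range R, ∑ j ∈ Finset.range R, h i j := by
  simp only [Finset.Nat.sum_antidiagonal_eq_sum_range_succ h]
  rw [Finset.sum_range_diag_flip]
  refine Finset.sum_congr rfl fun i hi => ?_
  refine Finset.sum_subset (Finset.range_mono (Nat.sub_le _ _)) fun j _ hj => hz i j ?_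
  have := Finset.mem_range.1 hi
  simp only [Finset.mem_range] at hj
  omega

/-- The terms with m < p have a zero binomial coefficient, and those beyond R vanish by hypothesis.
-/
theorem sum_choose_shift {M : Type*} [AddCommGroup M] [Module ℂ M] (h : ℕ → M) (R p : ℕ)
    (hz : ∀ m, R ≤ m → h m = 0) :
    ∑ m ∈ Finset.range R, (m.choose p : ℂ) • h m =
      ∑ u ∈ Finset.range R, ((p + u).choose p : ℂ) • h (p + u) := by
  have h1 : ∑ m ∈ Finset.range R, (m.choose p : ℂ) • h m =
      ∑ m ∈ Finset.range (p + R), (m.choose p : ℂ) • h m := by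
    refine Finset.sum_subset (Finset.range_mono (Nat.le_add_left _ _)) fun m _ hm => ?_
    rw [hz m (by simpa using hm), smul_zero]
  rw [h1, Finset.sum_range_add, Finset.sum_eq_zero, zero_add]
  intro m hm
  rw [Nat.choose_eq_zero_of_lt (Finset.mem_range.1 hm), Nat.cast_zero, zero_smul]

theorem choose_add_natCast (r : ℤ) (m k : ℕ) :
    ((Ring.choose (r + m) k : ℤ) : ℂ) =
      ∑ p ∈ Finset.HasAntidiagonal.antidiagonal k, ((Ring.choose r p.1 : ℤ) : ℂ) * (m.choose p.2 : ℂ) := by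
  rw [Ring.add_choose_eq k (Commute.all r (m : ℤ))]
  push_cast
  refine Finset.sum_congr rfl fun p _ => ?_
  rw [Ring.choose_natCast]
  simp

/-! ### The tensor product of a commutative vertex algebra and a vertex algebra -/

namespace VertexAlg

variable {U V : Type*} [CommRing U] [Algebra ℂ U] [AddCommGroup V] [Module ℂ V]
  (D : Derivation ℂ U U) (S : VertexAlg V)

/-- The finitely supported sequence `b(n + i) d`. -/
def modeSeq (n : ℤ) : V →ₗ[ℂ] V →ₗ[ℂ] (ℕ →₀ V) :=
  LinearMap.mk₂ ℂ (fun b d => Finsupp.ofSupportFinite (fun i => S.mode b (n + i) d) (by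
      obtain ⟨R, hR⟩ := S.exists_mode_eq_zero b d n
      exact ModeFamily.finite_support_of_le hR))
    (fun a b c => by
      ext i
      change S.mode (a + b) (n + i) c = S.mode a (n + i) c + S.mode b (n + i) c
      rw [S.mode_add, LinearMap.add_apply])
    (fun x b c => by
      ext i
      change S.mode (x • b) (n + i) c = x • S.mode b (n + i) c
      rw [S.mode_smul, LinearMap.smul_apply])
    (fun a b c => by ext i; exact map_add (S.mode a (n + i)) b c)
    (fun x b c => by ext i; exact map_smul (S.mode b (n + i)) x c)

variable (V) in
/-- The linear map `x ↦ ∑ (Dⁱ a / i!) c ⊗ xᵢ`. -/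
def expTensor : U →ₗ[ℂ] U →ₗ[ℂ] (ℕ →₀ V) →ₗ[ℂ] U ⊗[ℂ] V :=
  LinearMap.mk₂ ℂ (fun a c => Finsupp.lsum ℂ fun i =>
      TensorProduct.mk ℂ U V (D.dividedPow i a * c))
    (fun a b c => by ext i x; simp [add_mul])
    (fun x b c => by ext i y; simp [TensorProduct.smul_tmul'])
    (fun a b c => by ext i x; simp [mul_add])
    (fun x b c => by ext i y; simp [TensorProduct.smul_tmul'])

/-- The products `(a ⊗ b)(n)(c ⊗ d) = ∑ (Dⁱ a / i!) c ⊗ b(n + i) d`. -/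
def tensorMode (n : ℤ) : U ⊗[ℂ] V →ₗ[ℂ] U ⊗[ℂ] V →ₗ[ℂ] U ⊗[ℂ] V :=
  (TensorProduct.map₂ (expTensor V D) (S.modeSeq n)).compr₂ (TensorProduct.lift LinearMap.id)

/-- The cutoff R is free, so that several products can be expanded over one common range. -/
theorem tensorMode_tmul (n : ℤ) (a c : U) (b d : V) (R : ℕ)
    (hR : ∀ i : ℕ, R ≤ i → S.mode b (n + i) d = 0) :
    S.tensorMode D n (a ⊗ₜ b) (c ⊗ₜ d) =
      ∑ i ∈ Finset.range R, (D.dividedPow i a * c) ⊗ₜ S.mode b (n + i) d := by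
  have h : S.tensorMode D n (a ⊗ₜ b) (c ⊗ₜ d) =
      (S.modeSeq n b d).sum fun i x => (D.dividedPow i a * c) ⊗ₜ x := by
    simp [tensorMode, expTensor]
    rfl
  rw [h]
  refine Finsupp.sum_of_support_subset _ (fun i hi => ?_) _ fun i _ => by simp
  by_contra h'
  simp only [Finset.mem_range, not_lt] at h'
  exact Finsupp.mem_support_iff.1 hi (hR i h')

/-- The products of the tensor product. -/
def tensorFamily : ModeFamily (U ⊗[ℂ] V) where
  mode := S.tensorMode D
  exists_eq_zero x y n := by
    induction x using TensorProduct.induction_on with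
    | zero => exact ⟨0, fun k _ => by rw [map_zero, LinearMap.zero_apply]⟩
    | add x x' h h' =>
      obtain ⟨R, hR⟩ := h
      obtain ⟨R', hR'⟩ := h'
      exact ⟨max R R', fun k hk => by
        rw [map_add, LinearMap.add_apply, hR k (le_trans (le_max_left _ _) hk),
          hR' k (le_trans (le_max_right _ _) hk), add_zero]⟩
    | tmul a b =>
      induction y using TensorProduct.induction_on with
      | zero => exact ⟨0, fun k _ => map_zero _⟩
      | add x x' h h' =>
        obtain ⟨R, hR⟩ := h
        obtain ⟨R', hR'⟩ := h'
        exact ⟨max R R', fun k hk => by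
          rw [map_add, hR k (le_trans (le_max_left _ _) hk),
            hR' k (le_trans (le_max_right _ _) hk), add_zero]⟩
      | tmul c d =>
        obtain ⟨R, hR⟩ := S.exists_mode_eq_zero b d n
        refine ⟨R, fun k hk => ?_⟩
        rw [S.tensorMode_tmul D (n + k) a c b d 0 fun i _ => by
          rw [add_assoc, ← Nat.cast_add]
          exact hR _ (by omega)]
        rfl

theorem tensorFamily_mode (n : ℤ) : (S.tensorFamily D).mode n = S.tensorMode D n := rfl

/-- The inner product contributes an index p. The outer one applies a divided power to (Dᵖa/p!)a',
which by Leibniz splits into u + l with a factor C(p + u, p). With m = p + u and k = i + p, the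
V-component depends on k, m, l only, and its coefficient ∑ C(r, i) C(m, p) over i + p = k is C(r +
m, k) by Vandermonde: this is the left side of the Jacobi identity of V at (r + m, s + l, t). -/
theorem jacobiLeft_tensor (a a' c : U) (b b' d : V) (r s t : ℤ) (R : ℕ)
    (h1 : ∀ k : ℕ, R ≤ k → S.mode b (t + k) b' = 0)
    (h2 : ∀ k e : ℕ, R ≤ e → S.mode (S.mode b (t + k) b') (r + s - k + e) d = 0) :
    ∑ᶠ i, (S.tensorFamily D).jacobiLeft (a ⊗ₜ b) (a' ⊗ₜ b') (c ⊗ₜ d) r s t i =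
      ∑ m ∈ Finset.range R, ∑ l ∈ Finset.range R,
        (D.dividedPow m a * (D.dividedPow l a' * c)) ⊗ₜ
          ∑ᶠ i, S.toModeFamily.jacobiLeft b b' d (r + m) (s + l) t i := by
  set F : ℕ → ℤ → V := fun k n => S.mode (S.mode b (t + k) b') n d with hF
  have hF1 (k : ℕ) (n : ℤ) (hk : R ≤ k) : F k n = 0 := by
    rw [hF]
    dsimp only
    rw [h1 k hk, S.mode_zero, LinearMap.zero_apply]
  set H : ℕ → ℕ → ℕ → U ⊗[ℂ] V := fun k m l =>
    (D.dividedPow m a * (D.dividedPow l a' * c)) ⊗ₜ F k (r + s - k + ((m + l : ℕ) : ℤ)) with hH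
  have hH1 (k m l : ℕ) (hk : R ≤ k) : H k m l = 0 := by
    rw [hH]
    dsimp only
    rw [hF1 _ _ hk, TensorProduct.tmul_zero]
  have hH2 (k m l : ℕ) (hk : R ≤ m + l) : H k m l = 0 := by
    rw [hH]
    dsimp only
    rw [hF]
    dsimp only
    rw [h2 _ _ hk, TensorProduct.tmul_zero]
  have hterm (i : ℕ) : (S.tensorFamily D).jacobiLeft (a ⊗ₜ b) (a' ⊗ₜ b') (c ⊗ₜ d) r s t i =
      ∑ p ∈ Finset.range R, ∑ m ∈ Finset.range R, ∑ l ∈ Finset.range R,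
        (((Ring.choose r i : ℤ) : ℂ) * (m.choose p : ℂ)) • H (i + p) m l := by
    rw [ModeFamily.jacobiLeft, tensorFamily_mode, tensorFamily_mode,
      S.tensorMode_tmul D (t + i) a a' b b' R fun p hp => by
        rw [add_assoc, ← Nat.cast_add]
        exact h1 _ (by omega),
      map_sum, LinearMap.sum_apply, Finset.smul_sum]
    refine Finset.sum_congr rfl fun p _ => ?_
    rw [S.tensorMode_tmul D (r + s - i) _ c _ d R fun q hq => by
      rw [add_assoc, ← Nat.cast_add]
      have := h2 (i + p) (p + q) (by omega)
      rwa [show r + s - ((i + p : ℕ) : ℤ) + ((p + q : ℕ) : ℤ) = r + s - i + q by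
        push_cast; ring] at this]
    -- Here x = (u, l) splits q, and `H` is evaluated at k = i + p and m = p + u.
    have hq (q : ℕ) : (D.dividedPow q (D.dividedPow p a * a') * c) ⊗ₜ[ℂ]
        S.mode (S.mode b (t + i + p) b') (r + s - i + q) d =
        ∑ x ∈ Finset.HasAntidiagonal.antidiagonal q, ((p + x.1).choose p : ℂ) • H (i + p) (p + x.1) x.2 := by
      rw [D.dividedPow_mul, Finset.sum_mul, TensorProduct.sum_tmul]
      refine Finset.sum_congr rfl fun x hx => ?_
      rw [D.dividedPow_dividedPow, hH, hF, smul_mul_assoc, smul_mul_assoc,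
        ← TensorProduct.smul_tmul', mul_assoc, ← Finset.HasAntidiagonal.mem_antidiagonal.1 hx]
      dsimp only
      rw [show r + s - ((i + p : ℕ) : ℤ) + ((p + x.1 + x.2 : ℕ) : ℤ) =
        r + s - i + ((x.1 + x.2 : ℕ) : ℤ) by push_cast; ring, Nat.cast_add i p, add_assoc t]
    simp only [hq]
    rw [sum_antidiagonal_range (fun u l => ((p + u).choose p : ℂ) • H (i + p) (p + u) l) R
      fun u l hul => by rw [hH2 _ _ _ (by omega), smul_zero]]
    simp only [← Finset.smul_sum, mul_smul]
    rw [← sum_choose_shift (fun m => ∑ l ∈ Finset.range R, H (i + p) m l) R p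
      fun m hm => Finset.sum_eq_zero fun l _ => hH2 _ _ _ (by omega), Int.cast_smul_eq_zsmul]
  rw [finsum_eq_sum_range_of_le _ R fun i hi => by
    rw [hterm]
    exact Finset.sum_eq_zero fun p _ => Finset.sum_eq_zero fun m _ => Finset.sum_eq_zero
      fun l _ => by rw [hH1 _ _ _ (by omega), smul_zero]]
  simp only [hterm]
  have hswap : ∀ i ∈ Finset.range R, ∑ p ∈ Finset.range R, ∑ m ∈ Finset.range R,
      ∑ l ∈ Finset.range R, (((Ring.choose r i : ℤ) : ℂ) * (m.choose p : ℂ)) • H (i + p) m l =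
      ∑ m ∈ Finset.range R, ∑ l ∈ Finset.range R, ∑ p ∈ Finset.range R,
      (((Ring.choose r i : ℤ) : ℂ) * (m.choose p : ℂ)) • H (i + p) m l := fun i _ => by
    rw [Finset.sum_comm]
    exact Finset.sum_congr rfl fun m _ => Finset.sum_comm
  rw [Finset.sum_congr rfl hswap, Finset.sum_comm]
  refine Finset.sum_congr rfl fun m _ => ?_
  rw [Finset.sum_comm]
  refine Finset.sum_congr rfl fun l _ => ?_
  rw [← sum_antidiagonal_range
    (fun i p => (((Ring.choose r i : ℤ) : ℂ) * (m.choose p : ℂ)) • H (i + p) m l) R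
    fun i p hip => by rw [hH1 _ _ _ hip, smul_zero]]
  rw [finsum_eq_sum_range_of_le _ R fun k hk => by
    rw [ModeFamily.jacobiLeft, toModeFamily_mode, toModeFamily_mode, h1 k hk, mode_zero,
      LinearMap.zero_apply, smul_zero], TensorProduct.tmul_sum]
  refine Finset.sum_congr rfl fun k _ => ?_
  -- On the antidiagonal `H` is constant, so only the binomial coefficients remain to be summed.
  have hk : ∀ x ∈ Finset.HasAntidiagonal.antidiagonal k,
      (((Ring.choose r x.1 : ℤ) : ℂ) * (m.choose x.2 : ℂ)) • H (x.1 + x.2) m l =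
      (((Ring.choose r x.1 : ℤ) : ℂ) * (m.choose x.2 : ℂ)) • H k m l := fun x hx => by
    rw [Finset.HasAntidiagonal.mem_antidiagonal.1 hx]
  rw [Finset.sum_congr rfl hk, ← Finset.sum_smul, ← choose_add_natCast, ModeFamily.jacobiLeft,
    ← Int.cast_smul_eq_zsmul ℂ, TensorProduct.tmul_smul, toModeFamily_mode, toModeFamily_mode, hH]
  dsimp only
  rw [show r + m + (s + l) - k = r + s - k + ((m + l : ℕ) : ℤ) by push_cast; ring]

/-- No binomial identity is needed here: the divided powers only shift r by m and s by l in each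
summand. Commutativity of U aligns the two orders of multiplication. -/
theorem jacobiRight_tensor (a a' c : U) (b b' d : V) (r s t : ℤ) (R : ℕ)
    (h3 : ∀ k : ℕ, R ≤ k → S.mode b' (s + k) d = 0)
    (h4 : ∀ i l m : ℕ, R ≤ m → S.mode b (r + t - i + m) (S.mode b' (s + i + l) d) = 0)
    (h5 : ∀ k : ℕ, R ≤ k → S.mode b (r + k) d = 0)
    (h6 : ∀ i m l : ℕ, R ≤ l → S.mode b' (s + t - i + l) (S.mode b (r + i + m) d) = 0) :
    ∑ᶠ i, (S.tensorFamily D).jacobiRight (a ⊗ₜ b) (a' ⊗ₜ b') (c ⊗ₜ d) r s t i =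
      ∑ m ∈ Finset.range R, ∑ l ∈ Finset.range R,
        (D.dividedPow m a * (D.dividedPow l a' * c)) ⊗ₜ
          ∑ᶠ i, S.toModeFamily.jacobiRight b b' d (r + m) (s + l) t i := by
  have hterm (i : ℕ) : (S.tensorFamily D).jacobiRight (a ⊗ₜ b) (a' ⊗ₜ b') (c ⊗ₜ d) r s t i =
      ∑ m ∈ Finset.range R, ∑ l ∈ Finset.range R,
        (D.dividedPow m a * (D.dividedPow l a' * c)) ⊗ₜ
          S.toModeFamily.jacobiRight b b' d (r + m) (s + l) t i := by
    rw [ModeFamily.jacobiRight]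
    simp only [tensorFamily_mode]
    rw [S.tensorMode_tmul D (s + i) a' c b' d R fun l hl => by
        rw [add_assoc, ← Nat.cast_add]
        exact h3 _ (by omega),
      S.tensorMode_tmul D (r + i) a c b d R fun l hl => by
        rw [add_assoc, ← Nat.cast_add]
        exact h5 _ (by omega), map_sum, map_sum]
    have e1 (l : ℕ) : S.tensorMode D (r + t - i) (a ⊗ₜ b)
        ((D.dividedPow l a' * c) ⊗ₜ S.mode b' (s + i + l) d) =
        ∑ m ∈ Finset.range R, (D.dividedPow m a * (D.dividedPow l a' * c)) ⊗ₜ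
          S.mode b (r + t - i + m) (S.mode b' (s + i + l) d) :=
      S.tensorMode_tmul D _ _ _ _ _ R fun m hm => h4 i l m hm
    have e2 (m : ℕ) : S.tensorMode D (s + t - i) (a' ⊗ₜ b')
        ((D.dividedPow m a * c) ⊗ₜ S.mode b (r + i + m) d) =
        ∑ l ∈ Finset.range R, (D.dividedPow l a' * (D.dividedPow m a * c)) ⊗ₜ
          S.mode b' (s + t - i + l) (S.mode b (r + i + m) d) :=
      S.tensorMode_tmul D _ _ _ _ _ R fun l hl => h6 i m l hl
    simp only [e1, e2]
    rw [Finset.sum_comm]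
    simp only [← Int.cast_smul_eq_zsmul ℂ]
    rw [Finset.smul_sum, ← Finset.sum_sub_distrib, Finset.smul_sum]
    refine Finset.sum_congr rfl fun m _ => ?_
    rw [Finset.smul_sum, ← Finset.sum_sub_distrib, Finset.smul_sum]
    refine Finset.sum_congr rfl fun l _ => ?_
    rw [ModeFamily.jacobiRight]
    simp only [toModeFamily_mode, ← Int.cast_smul_eq_zsmul ℂ]
    rw [TensorProduct.tmul_smul, TensorProduct.tmul_sub, TensorProduct.tmul_smul,
      mul_left_comm (D.dividedPow l a')]
    rw [show r + m + t - i = r + t - i + m by ring, show s + l + i = s + i + l by ring,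
      show s + l + t - i = s + t - i + l by ring, show r + m + i = r + i + m by ring]
  have hzero (i m l : ℕ) (hi : R ≤ i) :
      S.toModeFamily.jacobiRight b b' d (r + m) (s + l) t i = 0 := by
    rw [ModeFamily.jacobiRight]
    simp only [toModeFamily_mode]
    rw [add_assoc s, ← Nat.cast_add, h3 _ (by omega), add_assoc r (m : ℤ) i, ← Nat.cast_add m,
      h5 _ (by omega), map_zero, map_zero, smul_zero, sub_zero, smul_zero]
  rw [finsum_eq_sum_range_of_le _ R fun i hi => by
    rw [hterm]
    exact Finset.sum_eq_zero fun m _ => Finset.sum_eq_zero fun l _ => by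
      rw [hzero i m l hi, TensorProduct.tmul_zero]]
  simp only [hterm]
  rw [Finset.sum_comm]
  refine Finset.sum_congr rfl fun m _ => ?_
  rw [Finset.sum_comm]
  refine Finset.sum_congr rfl fun l _ => ?_
  rw [finsum_eq_sum_range_of_le _ R fun i hi => hzero i m l hi, TensorProduct.tmul_sum]

theorem tensorFamily_jacobi (x y z : U ⊗[ℂ] V) : (S.tensorFamily D).Jacobi x y z := by
  induction x using TensorProduct.induction_on with
  | zero => exact ModeFamily.jacobi_zero_left _ _
  | add x x' h h' => exact h.add_left h'
  | tmul a b =>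
    induction y using TensorProduct.induction_on with
    | zero => exact ModeFamily.jacobi_zero_middle _ _
    | add y y' h h' => exact h.add_middle h'
    | tmul a' b' =>
      induction z using TensorProduct.induction_on with
      | zero => exact ModeFamily.jacobi_zero_right _ _
      | add z z' h h' => exact h.add_right h'
      | tmul c d =>
        intro r s t
        obtain ⟨R1, h1⟩ := S.exists_mode_eq_zero b b' t
        obtain ⟨R2, h2⟩ := S.exists_mode_of_mode_eq_zero b b' d (r + s) t
        obtain ⟨R3, h3⟩ := S.exists_mode_eq_zero b' d s
        obtain ⟨R4, h4⟩ := S.exists_mode_mode_eq_zero b b' d (r + t) s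
        obtain ⟨R5, h5⟩ := S.exists_mode_eq_zero b d r
        obtain ⟨R6, h6⟩ := S.exists_mode_mode_eq_zero b' b d (s + t) r
        rw [S.jacobiLeft_tensor D a a' c b b' d r s t (R1 + R2 + R3 + R4 + R5 + R6)
            (fun k hk => h1 k (by omega)) (fun k e he => h2 k e (by omega)),
          S.jacobiRight_tensor D a a' c b b' d r s t (R1 + R2 + R3 + R4 + R5 + R6)
            (fun k hk => h3 k (by omega)) (fun i l m hm => h4 i l m (by omega))
            (fun k hk => h5 k (by omega)) (fun i m l hl => h6 i m l (by omega))]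
        refine Finset.sum_congr rfl fun m _ => Finset.sum_congr rfl fun l _ => ?_
        rw [S.toModeFamily_jacobi b b' d]

end VertexAlg

attribute [local instance 100] LieRing.ofAssociativeRing

/-! ### Commutative quasi-vertex operator algebras -/

/-- A graded commutative algebra with derivations spanning a copy of `sl₂`, the middle one being
the Euler operator. -/
structure SL2Algebra (U : Type*) [CommRing U] [Algebra ℂ U] where
  /-- the operator `L(-1)` -/
  raise : Derivation ℂ U U
  /-- the operator `L(0)` -/
  euler : Derivation ℂ U U
  /-- the operator `L(1)` -/
  lower : Derivation ℂ U U
  /-- the homogeneous spaces -/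
  grading : ℤ → Submodule ℂ U
  iSup_grading : ⨆ k, grading k = ⊤
  mul_mem : ∀ {k l : ℤ} {a b : U}, a ∈ grading k → b ∈ grading l → a * b ∈ grading (k + l)
  raise_mem : ∀ {k : ℤ} {a : U}, a ∈ grading k → raise a ∈ grading (k + 1)
  euler_apply : ∀ {k : ℤ} {a : U}, a ∈ grading k → euler a = (k : ℂ) • a
  finiteDimensional : ∀ k, FiniteDimensional ℂ (grading k)
  bounded_below : ∃ N : ℤ, ∀ k < N, grading k = ⊥
  euler_raise : ∀ a, euler (raise a) - raise (euler a) = raise a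
  euler_lower : ∀ a, euler (lower a) - lower (euler a) = -lower a
  lower_raise : ∀ a, lower (raise a) - raise (lower a) = (2 : ℂ) • euler a

namespace SL2Algebra

variable {U : Type*} [CommRing U] [Algebra ℂ U] (A : SL2Algebra U)

/-- The divided powers of `L(-1)`. -/
def dpow (i : ℕ) : U →ₗ[ℂ] U := A.raise.dividedPow i

theorem dpow_zero (a : U) : A.dpow 0 a = a := A.raise.dividedPow_zero a

theorem raise_dpow (i : ℕ) (a : U) :
    A.raise (A.dpow i a) = (i + 1 : ℂ) • A.dpow (i + 1) a := A.raise.apply_dividedPow i a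

theorem dpow_raise (i : ℕ) (a : U) :
    A.dpow i (A.raise a) = (i + 1 : ℂ) • A.dpow (i + 1) a := A.raise.dividedPow_apply i a

theorem dpow_mem {k : ℤ} {a : U} (ha : a ∈ A.grading k) (i : ℕ) :
    A.dpow i a ∈ A.grading (k + i) := by
  induction i with
  | zero =>
    rw [dpow_zero]
    simpa using ha
  | succ i ih =>
    have h := A.raise_mem ih
    rw [raise_dpow] at h
    have hi : (i + 1 : ℂ) ≠ 0 := by exact_mod_cast i.succ_ne_zero
    have := Submodule.smul_mem _ (i + 1 : ℂ)⁻¹ h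
    rw [smul_smul, inv_mul_cancel₀ hi, one_smul] at this
    rwa [show k + ((i + 1 : ℕ) : ℤ) = k + i + 1 by push_cast; ring]

/-- Moving L(1) past L(−1)^(i+1) produces ∑ 2(k + j) over 0 ≤ j ≤ i, that is (i + 1)(2k + i); the
factor i + 1 is absorbed by the factorial. -/
theorem lower_dpow {k : ℤ} {a : U} (ha : a ∈ A.grading k) (i : ℕ) :
    A.lower (A.dpow (i + 1) a) =
      A.dpow (i + 1) (A.lower a) + (2 * k + i : ℂ) • A.dpow i a := by
  have hs (j : ℕ) (b : U) : (j + 1 : ℂ) • A.dpow (j + 1) b = A.raise (A.dpow j b) :=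
    (A.raise_dpow j b).symm
  have hl (b : U) : A.lower (A.raise b) = A.raise (A.lower b) + (2 : ℂ) • A.euler b := by
    rw [← A.lower_raise]
    abel
  have hi (i : ℕ) : (i + 1 : ℂ) ≠ 0 := by exact_mod_cast i.succ_ne_zero
  induction i with
  | zero =>
    refine smul_right_injective U (hi 0) ?_
    dsimp only
    rw [← Derivation.map_smul, hs, smul_add, hs, hl, dpow_zero, A.euler_apply ha,
      dpow_zero, smul_smul]
    simp
  | succ i ih =>
    refine smul_right_injective U (hi (i + 1)) ?_
    dsimp only
    rw [← Derivation.map_smul, hs, smul_add, hs, hl, A.euler_apply (A.dpow_mem ha (i + 1)), ih,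
      map_add, Derivation.map_smul, ← hs i]
    push_cast
    module

/-- The action of `sl₂`. -/
def rho : SL2C →ₗ⁅ℂ⁆ Module.End ℂ U where
  -- These are the coordinates of x in the basis `sl2Euler`, `sl2Raise`, `sl2Lower`, whose entries
  -- 1/2 and −1 explain the 2 and the sign.
  toFun x := (2 * x.1 0 0) • (A.euler : U →ₗ[ℂ] U) + x.1 0 1 • (A.raise : U →ₗ[ℂ] U) -
    x.1 1 0 • (A.lower : U →ₗ[ℂ] U)
  map_add' x y := by
    have h (i j : Fin 2) : (x + y).1 i j = x.1 i j + y.1 i j := rfl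
    rw [h, h, h]
    module
  map_smul' c x := by
    have h (i j : Fin 2) : (c • x).1 i j = c * x.1 i j := rfl
    rw [h, h, h, RingHom.id_apply]
    module
  map_lie' {x y} := by
    have h1 : (A.euler : Module.End ℂ U) * (A.raise : U →ₗ[ℂ] U) =
        (A.raise : Module.End ℂ U) * (A.euler : U →ₗ[ℂ] U) + (A.raise : U →ₗ[ℂ] U) :=
      LinearMap.ext fun a => by
        have := A.euler_raise a
        rw [sub_eq_iff_eq_add'] at this
        exact this
    have h2 : (A.euler : Module.End ℂ U) * (A.lower : U →ₗ[ℂ] U) =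
        (A.lower : Module.End ℂ U) * (A.euler : U →ₗ[ℂ] U) - (A.lower : U →ₗ[ℂ] U) :=
      LinearMap.ext fun a => by
        have := A.euler_lower a
        rw [sub_eq_iff_eq_add', ← sub_eq_add_neg] at this
        exact this
    have h3 : (A.lower : Module.End ℂ U) * (A.raise : U →ₗ[ℂ] U) =
        (A.raise : Module.End ℂ U) * (A.lower : U →ₗ[ℂ] U) + (2 : ℂ) • (A.euler : U →ₗ[ℂ] U) :=
      LinearMap.ext fun a => by
        have := A.lower_raise a
        rw [sub_eq_iff_eq_add'] at this
        exact this
    have hx : x.1 1 1 = -x.1 0 0 := by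
      have h : Matrix.trace x.1 = 0 := x.2
      rw [Matrix.trace_fin_two] at h
      linear_combination h
    have hy : y.1 1 1 = -y.1 0 0 := by
      have h : Matrix.trace y.1 = 0 := y.2
      rw [Matrix.trace_fin_two] at h
      linear_combination h
    rw [LieAlgebra.SpecialLinear.sl_bracket, LieRing.of_associative_ring_bracket]
    simp only [Matrix.sub_apply, Matrix.mul_apply, Fin.sum_univ_two, hx, hy]
    simp only [sub_mul, mul_sub, add_mul, mul_add, smul_mul_smul_comm, h1, h2, h3, smul_add,
      smul_sub]
    module

theorem rho_euler : A.rho sl2Euler = (A.euler : U →ₗ[ℂ] U) := by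
  change (2 * sl2Euler.1 0 0) • (A.euler : U →ₗ[ℂ] U) + sl2Euler.1 0 1 • (A.raise : U →ₗ[ℂ] U) -
    sl2Euler.1 1 0 • (A.lower : U →ₗ[ℂ] U) = _
  simp [sl2Euler]

theorem rho_raise : A.rho sl2Raise = (A.raise : U →ₗ[ℂ] U) := by
  change (2 * sl2Raise.1 0 0) • (A.euler : U →ₗ[ℂ] U) + sl2Raise.1 0 1 • (A.raise : U →ₗ[ℂ] U) -
    sl2Raise.1 1 0 • (A.lower : U →ₗ[ℂ] U) = _
  simp [sl2Raise]

theorem rho_lower : A.rho sl2Lower = (A.lower : U →ₗ[ℂ] U) := by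
  change (2 * sl2Lower.1 0 0) • (A.euler : U →ₗ[ℂ] U) + sl2Lower.1 0 1 • (A.raise : U →ₗ[ℂ] U) -
    sl2Lower.1 1 0 • (A.lower : U →ₗ[ℂ] U) = _
  simp [sl2Lower]

end SL2Algebra

/-- The tensor product of two representations of `sl₂`. -/
def tensorRho {U V : Type*} [AddCommGroup U] [Module ℂ U] [AddCommGroup V] [Module ℂ V]
    (f : SL2C →ₗ⁅ℂ⁆ Module.End ℂ U) (g : SL2C →ₗ⁅ℂ⁆ Module.End ℂ V) :
    SL2C →ₗ⁅ℂ⁆ Module.End ℂ (U ⊗[ℂ] V) where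
  toFun x := TensorProduct.map (f x) LinearMap.id + TensorProduct.map LinearMap.id (g x)
  map_add' x y := by
    rw [map_add, map_add, TensorProduct.map_add_left, TensorProduct.map_add_right]
    abel
  map_smul' c x := by
    rw [map_smul, map_smul, TensorProduct.map_smul_left, TensorProduct.map_smul_right,
      RingHom.id_apply, smul_add]
  map_lie' {x y} := by
    refine TensorProduct.ext' fun a b => ?_
    simp only [LieHom.map_lie, LieRing.of_associative_ring_bracket, LinearMap.sub_apply,
      LinearMap.add_apply, Module.End.mul_apply, TensorProduct.map_tmul, LinearMap.id_apply,
      map_add, TensorProduct.sub_tmul, TensorProduct.tmul_sub]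
    abel

theorem tensorRho_tmul {U V : Type*} [AddCommGroup U] [Module ℂ U] [AddCommGroup V] [Module ℂ V]
    (f : SL2C →ₗ⁅ℂ⁆ Module.End ℂ U) (g : SL2C →ₗ⁅ℂ⁆ Module.End ℂ V) (x : SL2C) (a : U) (b : V) :
    tensorRho f g x (a ⊗ₜ b) = f x a ⊗ₜ b + a ⊗ₜ g x b := rfl

/-! ### The tensor product of a commutative and an arbitrary quasi-vertex operator algebra -/

section TensorGrading

variable {U V : Type*} [AddCommGroup U] [Module ℂ U] [AddCommGroup V] [Module ℂ V]

/-- The tensor product grading. -/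
def tensorGrading (F : ℤ → Submodule ℂ U) (G : ℤ → Submodule ℂ V) (n : ℤ) :
    Submodule ℂ (U ⊗[ℂ] V) :=
  ⨆ k : ℤ, Submodule.map₂ (TensorProduct.mk ℂ U V) (F k) (G (n - k))

theorem tmul_mem_tensorGrading {F : ℤ → Submodule ℂ U} {G : ℤ → Submodule ℂ V} {k l n : ℤ}
    (h : k + l = n) {a : U} {b : V} (ha : a ∈ F k) (hb : b ∈ G l) :
    a ⊗ₜ b ∈ tensorGrading F G n :=
  Submodule.mem_iSup_of_mem k (Submodule.apply_mem_map₂ _ ha (by rwa [← h, add_sub_cancel_left]))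

theorem tensorGrading_le {F : ℤ → Submodule ℂ U} {G : ℤ → Submodule ℂ V} {n : ℤ}
    {W : Submodule ℂ (U ⊗[ℂ] V)}
    (h : ∀ k l : ℤ, k + l = n → ∀ a ∈ F k, ∀ b ∈ G l, a ⊗ₜ b ∈ W) : tensorGrading F G n ≤ W :=
  iSup_le fun k => Submodule.map₂_le.2 fun a ha b hb => h k (n - k) (by ring) a ha b hb

theorem iSup_tensorGrading {F : ℤ → Submodule ℂ U} {G : ℤ → Submodule ℂ V}
    (hF : ⨆ k, F k = ⊤) (hG : ⨆ k, G k = ⊤) : ⨆ n, tensorGrading F G n = ⊤ := by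
  rw [eq_top_iff, ← TensorProduct.map₂_mk_top_top_eq_top, ← hF, ← hG, Submodule.map₂_iSup_left]
  refine iSup_le fun k => ?_
  rw [Submodule.map₂_iSup_right]
  refine iSup_le fun l => Submodule.map₂_le.2 fun a ha b hb => ?_
  exact Submodule.mem_iSup_of_mem (k + l) (tmul_mem_tensorGrading rfl ha hb)

theorem tensorGrading_eq_bot {F : ℤ → Submodule ℂ U} {G : ℤ → Submodule ℂ V} {N M n : ℤ}
    (hF : ∀ k < N, F k = ⊥) (hG : ∀ k < M, G k = ⊥) (hn : n < N + M) :
    tensorGrading F G n = ⊥ := by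
  rw [eq_bot_iff]
  refine tensorGrading_le fun k l hkl a ha b hb => ?_
  rw [Submodule.mem_bot]
  obtain h | h := lt_or_ge k N
  · rw [hF k h, Submodule.mem_bot] at ha
    rw [ha, TensorProduct.zero_tmul]
  · rw [hG l (by omega), Submodule.mem_bot] at hb
    rw [hb, TensorProduct.tmul_zero]

/-- Both gradings are bounded below, so only N ≤ k ≤ n − M contribute to degree n. -/
theorem finiteDimensional_tensorGrading {F : ℤ → Submodule ℂ U} {G : ℤ → Submodule ℂ V} {N M : ℤ}
    (hF : ∀ k < N, F k = ⊥) (hG : ∀ k < M, G k = ⊥) (fF : ∀ k, FiniteDimensional ℂ (F k))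
    (fG : ∀ k, FiniteDimensional ℂ (G k)) (n : ℤ) :
    FiniteDimensional ℂ (tensorGrading F G n) := by
  let W : Submodule ℂ (U ⊗[ℂ] V) := (Finset.Icc N (n - M)).sup fun k =>
    Submodule.map₂ (TensorProduct.mk ℂ U V) (F k) (G (n - k))
  have hW : W.FG := Submodule.fg_finset_sup _ _ fun k _ =>
    Submodule.FG.map₂ _ ((Submodule.fg_iff_finiteDimensional _).2 (fF k))
      ((Submodule.fg_iff_finiteDimensional _).2 (fG (n - k)))
  have hle : tensorGrading F G n ≤ W := tensorGrading_le fun k l hkl a ha b hb => by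
    obtain h | h := lt_or_ge k N
    · rw [hF k h, Submodule.mem_bot] at ha
      rw [ha, TensorProduct.zero_tmul]
      exact Submodule.zero_mem _
    obtain h' | h' := lt_or_ge l M
    · rw [hG l h', Submodule.mem_bot] at hb
      rw [hb, TensorProduct.tmul_zero]
      exact Submodule.zero_mem _
    refine (Finset.le_sup (f := fun k => Submodule.map₂ (TensorProduct.mk ℂ U V) (F k)
      (G (n - k))) (Finset.mem_Icc.2 ⟨h, by omega⟩ : k ∈ Finset.Icc N (n - M))) ?_
    exact Submodule.apply_mem_map₂ _ ha (by rwa [← hkl, add_sub_cancel_left])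
  have : FiniteDimensional ℂ W := (Submodule.fg_iff_finiteDimensional W).1 hW
  exact Submodule.finiteDimensional_of_le hle

/-- A family of subspaces on which an operator acts by distinct integers is a direct sum. -/
theorem isInternal_of_eigenvalue {M : Type*} [AddCommGroup M] [Module ℂ M]
    (F : ℤ → Submodule ℂ M) (f : Module.End ℂ M) (htop : ⨆ k, F k = ⊤)
    (hf : ∀ (k : ℤ) (a : M), a ∈ F k → f a = (k : ℂ) • a) : DirectSum.IsInternal F := by
  refine (DirectSum.isInternal_submodule_iff_iSupIndep_and_iSup_eq_top F).2 ⟨?_, htop⟩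
  refine ((Module.End.eigenspaces_iSupIndep f).comp (Int.cast_injective (α := ℂ))).mono ?_
  exact fun k a ha => Module.End.mem_eigenspace_iff.2 (hf k a ha)

end TensorGrading

/-! ### The quasi-vertex operator algebra axioms on the tensor product. -/

namespace SL2Algebra

variable {U V : Type*} [CommRing U] [Algebra ℂ U] [AddCommGroup V] [Module ℂ V]
  (A : SL2Algebra U) (S : QVOA V)

/-- The products of the tensor product. -/
abbrev tmode (n : ℤ) : U ⊗[ℂ] V →ₗ[ℂ] U ⊗[ℂ] V →ₗ[ℂ] U ⊗[ℂ] V :=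
  (S.toVertexAlg.tensorFamily A.raise).mode n

theorem tmode_tmul (n : ℤ) (a c : U) (b d : V) (R : ℕ)
    (hR : ∀ i : ℕ, R ≤ i → S.mode b (n + i) d = 0) :
    A.tmode S n (a ⊗ₜ b) (c ⊗ₜ d) =
      ∑ i ∈ Finset.range R, (A.dpow i a * c) ⊗ₜ S.mode b (n + i) d :=
  S.toVertexAlg.tensorMode_tmul A.raise n a c b d R hR

theorem tmode_creative (x : U ⊗[ℂ] V) (n : ℤ) (hn : 0 ≤ n) :
    A.tmode S n x (1 ⊗ₜ S.vac) = 0 := by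
  induction x using TensorProduct.induction_on with
  | zero => rw [map_zero, LinearMap.zero_apply]
  | add x y hx hy => rw [map_add, LinearMap.add_apply, hx, hy, add_zero]
  | tmul a b =>
    rw [A.tmode_tmul S n a 1 b S.vac 0 fun i _ => S.creative b (n + i) (by omega)]
    rfl

theorem tmode_creates (x : U ⊗[ℂ] V) : A.tmode S (-1) x (1 ⊗ₜ S.vac) = x := by
  induction x using TensorProduct.induction_on with
  | zero => rw [map_zero, LinearMap.zero_apply]
  | add x y hx hy => rw [map_add, LinearMap.add_apply, hx, hy]
  | tmul a b =>
    rw [A.tmode_tmul S (-1) a 1 b S.vac 1 fun i hi => S.creative b (-1 + i) (by omega),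
      Finset.sum_range_one, Nat.cast_zero, add_zero, mul_one, dpow_zero]
    exact congrArg _ (S.creates b)

theorem one_tmul_vac_ne_zero [Nontrivial U] : (1 : U) ⊗ₜ[ℂ] S.vac ≠ 0 := by
  intro h
  refine S.vac_ne_zero ((Module.forall_dual_apply_eq_zero_iff ℂ S.vac).1 fun φ => ?_)
  have h1 := congrArg (TensorProduct.rid ℂ U ∘ TensorProduct.map LinearMap.id φ) h
  simpa using h1

/-- The vertex algebra structure on the tensor product. -/
def tensorVertexAlg [Nontrivial U] : VertexAlg (U ⊗[ℂ] V) :=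
  (S.toVertexAlg.tensorFamily A.raise).toVertexAlg (1 ⊗ₜ S.vac) (one_tmul_vac_ne_zero S)
    (A.tmode_creative S) (A.tmode_creates S) (S.toVertexAlg.tensorFamily_jacobi A.raise)

theorem tensorVertexAlg_mode [Nontrivial U] (x : U ⊗[ℂ] V) (n : ℤ) :
    (A.tensorVertexAlg S).mode x n = A.tmode S n x :=
  (S.toVertexAlg.tensorFamily A.raise).ncoeff_field x n

theorem tmode_mem (k l n : ℤ) (x y : U ⊗[ℂ] V) (hx : x ∈ tensorGrading A.grading S.grading k)
    (hy : y ∈ tensorGrading A.grading S.grading l) :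
    A.tmode S n x y ∈ tensorGrading A.grading S.grading (k + l - n - 1) := by
  set W := tensorGrading A.grading S.grading (k + l - n - 1) with hW
  have h : tensorGrading A.grading S.grading k ≤ W.comap ((A.tmode S n).flip y) := by
    refine tensorGrading_le fun p q hpq a ha b hb => ?_
    have h' : tensorGrading A.grading S.grading l ≤ W.comap (A.tmode S n (a ⊗ₜ b)) := by
      refine tensorGrading_le fun p' q' hpq' c hc d hd => ?_
      obtain ⟨R, hR⟩ := S.exists_mode_eq_zero b d n
      rw [Submodule.mem_comap, A.tmode_tmul S n a c b d R hR]
      refine Submodule.sum_mem _ fun i _ => ?_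
      exact tmul_mem_tensorGrading (by omega) (A.mul_mem (A.dpow_mem ha i) hc)
        (S.mode_mem q q' (n + i) b d hb hd)
    exact h' hy
  exact h hx

/-- The action of `sl₂` on the tensor product. -/
abbrev trho : SL2C →ₗ⁅ℂ⁆ Module.End ℂ (U ⊗[ℂ] V) := tensorRho A.rho S.rho

theorem trho_euler (k : ℤ) (x : U ⊗[ℂ] V) (hx : x ∈ tensorGrading A.grading S.grading k) :
    A.trho S sl2Euler x = (k : ℂ) • x := by
  have h : tensorGrading A.grading S.grading k ≤
      Module.End.eigenspace (A.trho S sl2Euler) (k : ℂ) := by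
    refine tensorGrading_le fun p q hpq a ha b hb => Module.End.mem_eigenspace_iff.2 ?_
    rw [tensorRho_tmul, S.rho_euler q b hb, A.rho_euler, Derivation.coeFn_coe, A.euler_apply ha,
      TensorProduct.tmul_smul, ← TensorProduct.smul_tmul', ← add_smul, ← hpq, Int.cast_add]
  exact Module.End.mem_eigenspace_iff.1 (h hx)

theorem iSup_grading_eq_top : ⨆ k, S.grading k = ⊤ := S.internal.submodule_iSup_eq_top

theorem trho_raise (x : U ⊗[ℂ] V) :
    A.trho S sl2Raise x = A.tmode S (-2) x (1 ⊗ₜ S.vac) := by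
  induction x using TensorProduct.induction_on with
  | zero => rw [map_zero, map_zero, LinearMap.zero_apply]
  | add x y hx hy => rw [map_add, map_add, LinearMap.add_apply, hx, hy]
  | tmul a b =>
    -- Creativity leaves i = 0, which gives a ⊗ L(−1)b, and i = 1, which gives L(−1)a ⊗ b.
    rw [A.tmode_tmul S (-2) a 1 b S.vac 2 fun i hi => S.creative b (-2 + i) (by omega),
      Finset.sum_range_succ, Finset.sum_range_one, tensorRho_tmul, A.rho_raise,
      Derivation.coeFn_coe, S.rho_raise, add_comm, mul_one, mul_one, dpow_zero,
      ← A.dpow_zero (A.raise a), dpow_raise]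
    have h1 : S.mode b (-2 + (1 : ℕ)) S.vac = b := S.creates b
    rw [h1]
    simp

/-- The computation common to both translation formulas. After the shift i + 1 ↦ i the first sum
carries i and the second −(n + i), leaving −n. -/
theorem sum_tmul_shift (n : ℤ) (a c : U) (b d : V) (R : ℕ)
    (hR : ∀ i : ℕ, R ≤ i → S.mode b (n - 1 + i) d = 0) :
    ∑ i ∈ Finset.range R, ((i + 1 : ℂ) • (A.dpow (i + 1) a * c)) ⊗ₜ[ℂ] S.mode b (n + i) d +
      ∑ i ∈ Finset.range R, (A.dpow i a * c) ⊗ₜ[ℂ]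
        ((-(n + i : ℤ) : ℂ) • S.mode b (n + i - 1) d) =
      (-n : ℂ) • A.tmode S (n - 1) (a ⊗ₜ b) (c ⊗ₜ d) := by
  have h1 : ∑ i ∈ Finset.range R,
      ((i + 1 : ℂ) • (A.dpow (i + 1) a * c)) ⊗ₜ[ℂ] S.mode b (n + i) d =
      ∑ i ∈ Finset.range R, (i : ℂ) • ((A.dpow i a * c) ⊗ₜ[ℂ] S.mode b (n - 1 + i) d) := by
    have h2 := Finset.sum_range_succ'
      (fun i : ℕ => (i : ℂ) • ((A.dpow i a * c) ⊗ₜ[ℂ] S.mode b (n - 1 + i) d)) R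
    rw [Finset.sum_range_succ, hR R le_rfl, TensorProduct.tmul_zero, smul_zero, add_zero,
      Nat.cast_zero, zero_smul, add_zero] at h2
    rw [h2]
    refine Finset.sum_congr rfl fun i _ => ?_
    rw [TensorProduct.smul_tmul', show n - 1 + ((i + 1 : ℕ) : ℤ) = n + i by push_cast; ring]
    push_cast
    rfl
  rw [h1, A.tmode_tmul S (n - 1) a c b d R hR, ← Finset.sum_add_distrib, Finset.smul_sum]
  refine Finset.sum_congr rfl fun i _ => ?_
  rw [show n + i - 1 = n - 1 + (i : ℤ) by ring, TensorProduct.tmul_smul, ← add_smul]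
  congr 1
  push_cast
  ring

theorem exists_common_bound (b d : V) (n : ℤ) :
    ∃ R : ℕ, ∀ i : ℕ, R ≤ i → S.mode b (n + i) d = 0 ∧
      S.mode b (n - 1 + i) d = 0 ∧ S.mode b (n + 1 + i) d = 0 := by
  obtain ⟨R1, h1⟩ := S.exists_mode_eq_zero b d (n - 1)
  refine ⟨R1, fun i hi => ⟨?_, h1 i hi, ?_⟩⟩
  · have := h1 (i + 1) (by omega)
    rwa [show n - 1 + ((i + 1 : ℕ) : ℤ) = n + i by push_cast; ring] at this
  · have := h1 (i + 2) (by omega)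
    rwa [show n - 1 + ((i + 2 : ℕ) : ℤ) = n + 1 + i by push_cast; ring] at this

theorem tmode_trho_raise (x y : U ⊗[ℂ] V) (n : ℤ) :
    A.tmode S n (A.trho S sl2Raise x) y = (-n : ℂ) • A.tmode S (n - 1) x y := by
  induction x using TensorProduct.induction_on with
  | zero => simp
  | add x x' h h' => simp only [map_add, LinearMap.add_apply, smul_add, h, h']
  | tmul a b =>
    induction y using TensorProduct.induction_on with
    | zero => simp
    | add y y' h h' => simp only [map_add, smul_add, h, h']
    | tmul c d =>
      obtain ⟨R, hR⟩ := exists_common_bound S b d n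
      obtain ⟨R', hR'⟩ := S.exists_mode_eq_zero (S.rho sl2Raise b) d n
      have e1 := A.tmode_tmul S n (A.raise a) c b d (R + R') fun i hi => (hR i (by omega)).1
      have e2 := A.tmode_tmul S n a c (S.rho sl2Raise b) d (R + R') fun i hi => hR' i (by omega)
      rw [tensorRho_tmul, A.rho_raise, Derivation.coeFn_coe, map_add, LinearMap.add_apply, e1, e2,
        ← A.sum_tmul_shift S n a c b d (R + R') fun i hi => (hR i (by omega)).2.1]
      congr 1
      · refine Finset.sum_congr rfl fun i _ => ?_
        rw [dpow_raise, smul_mul_assoc]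
      · refine Finset.sum_congr rfl fun i _ => ?_
        rw [S.translation, LinearMap.smul_apply]

theorem trho_raise_tmode (x y : U ⊗[ℂ] V) (n : ℤ) :
    A.trho S sl2Raise (A.tmode S n x y) - A.tmode S n x (A.trho S sl2Raise y) =
      (-n : ℂ) • A.tmode S (n - 1) x y := by
  induction x using TensorProduct.induction_on with
  | zero => simp
  | add x x' h h' =>
    simp only [map_add, LinearMap.add_apply, smul_add, ← h, ← h']
    abel
  | tmul a b =>
    induction y using TensorProduct.induction_on with
    | zero => simp
    | add y y' h h' =>
      simp only [map_add, smul_add, ← h, ← h']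
      abel
    | tmul c d =>
      obtain ⟨R, hR⟩ := exists_common_bound S b d n
      obtain ⟨R', hR'⟩ := S.exists_mode_eq_zero b (S.rho sl2Raise d) n
      have e0 := A.tmode_tmul S n a c b d (R + R') fun i hi => (hR i (by omega)).1
      have e1 := A.tmode_tmul S n a (A.raise c) b d (R + R') fun i hi => (hR i (by omega)).1
      have e2 := A.tmode_tmul S n a c b (S.rho sl2Raise d) (R + R') fun i hi => hR' i (by omega)
      have e3 (i : ℕ) : S.rho sl2Raise (S.mode b (n + i) d) =
          S.mode b (n + i) (S.rho sl2Raise d) +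
            (-(n + i : ℤ) : ℂ) • S.mode b (n + i - 1) d := by
        have h := LinearMap.congr_fun (S.translation_bracket b (n + i)) d
        rw [LieRing.of_associative_ring_bracket] at h
        exact sub_eq_iff_eq_add'.1 h
      rw [tensorRho_tmul, A.rho_raise, Derivation.coeFn_coe, map_add, e0, e1, e2, map_sum,
        ← A.sum_tmul_shift S n a c b d (R + R') fun i hi => (hR i (by omega)).2.1,
        ← Finset.sum_add_distrib, ← Finset.sum_sub_distrib, ← Finset.sum_add_distrib]
      refine Finset.sum_congr rfl fun i _ => ?_
      rw [tensorRho_tmul, A.rho_raise, Derivation.coeFn_coe, Derivation.leibniz, e3,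
        smul_eq_mul, smul_eq_mul, raise_dpow, mul_comm c,
        TensorProduct.add_tmul, TensorProduct.tmul_add, smul_mul_assoc]
      abel

/-- The correction from U, after a shift of the index, is 2p + i, and the one from V is 2q − (n + i)
− 2. Their sum 2(p + q) − n − 2 does not depend on i. -/
theorem trho_lower_tmode_tmul {p q : ℤ} {a : U} (ha : a ∈ A.grading p) {b : V}
    (hb : b ∈ S.grading q) (y : U ⊗[ℂ] V) (n : ℤ) :
    A.trho S sl2Lower (A.tmode S n (a ⊗ₜ b) y) - A.tmode S n (a ⊗ₜ b) (A.trho S sl2Lower y) =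
      A.tmode S n (A.trho S sl2Lower (a ⊗ₜ b)) y +
        (2 * (p + q : ℤ) - n - 2 : ℂ) • A.tmode S (n + 1) (a ⊗ₜ b) y := by
  induction y using TensorProduct.induction_on with
  | zero => simp
  | add y y' h h' =>
    simp only [map_add, smul_add]
    rw [add_sub_add_comm, h, h']
    abel
  | tmul c d =>
    obtain ⟨R, hR⟩ := exists_common_bound S b d n
    obtain ⟨R', hR'⟩ := S.exists_mode_eq_zero b (S.rho sl2Lower d) n
    obtain ⟨R'', hR''⟩ := S.exists_mode_eq_zero (S.rho sl2Lower b) d n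
    set N := R + R' + R'' with hN
    have e0 := A.tmode_tmul S n a c b d (N + 1) fun i hi => (hR i (by omega)).1
    have e1 := A.tmode_tmul S n a (A.lower c) b d (N + 1) fun i hi => (hR i (by omega)).1
    have e2 := A.tmode_tmul S n a c b (S.rho sl2Lower d) (N + 1) fun i hi => hR' i (by omega)
    have e3 := A.tmode_tmul S n (A.lower a) c b d (N + 1) fun i hi => (hR i (by omega)).1
    have e4 := A.tmode_tmul S n a c (S.rho sl2Lower b) d (N + 1) fun i hi => hR'' i (by omega)
    have e5 := A.tmode_tmul S (n + 1) a c b d (N + 1) fun i hi => (hR i (by omega)).2.2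
    have e6 (i : ℕ) : S.rho sl2Lower (S.mode b (n + i) d) =
        S.mode b (n + i) (S.rho sl2Lower d) + (S.mode (S.rho sl2Lower b) (n + i) d +
          (2 * q - (n + i : ℤ) - 2 : ℂ) • S.mode b (n + i + 1) d) := by
      have h := LinearMap.congr_fun (S.lower_bracket q b hb (n + i)) d
      rw [LieRing.of_associative_ring_bracket] at h
      exact sub_eq_iff_eq_add'.1 h
    -- The term i = 0 has no correction, so the shifted sum has N terms; the range N + 1 can be kept
    -- because the mode at index N already vanishes.
    have e7 : ∑ i ∈ Finset.range (N + 1), (A.lower (A.dpow i a) * c) ⊗ₜ[ℂ] S.mode b (n + i) d =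
        ∑ i ∈ Finset.range (N + 1), (A.dpow i (A.lower a) * c) ⊗ₜ[ℂ] S.mode b (n + i) d +
        ∑ i ∈ Finset.range (N + 1), (2 * p + i : ℂ) •
          ((A.dpow i a * c) ⊗ₜ[ℂ] S.mode b (n + 1 + i) d) := by
      have h0 : (A.lower (A.dpow 0 a) * c) ⊗ₜ[ℂ] S.mode b (n + (0 : ℕ)) d =
          (A.dpow 0 (A.lower a) * c) ⊗ₜ[ℂ] S.mode b (n + (0 : ℕ)) d := by
        rw [dpow_zero, dpow_zero]
      have hlast := (hR N (by omega)).2.2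
      rw [Finset.sum_range_succ', Finset.sum_range_succ'
        (fun i : ℕ => (A.dpow i (A.lower a) * c) ⊗ₜ[ℂ] S.mode b (n + i) d),
        Finset.sum_range_succ (fun i : ℕ => (2 * p + i : ℂ) •
          ((A.dpow i a * c) ⊗ₜ[ℂ] S.mode b (n + 1 + i) d)), hlast, TensorProduct.tmul_zero,
        smul_zero, add_zero, h0, add_right_comm, ← Finset.sum_add_distrib]
      congr 1
      refine Finset.sum_congr rfl fun i _ => ?_
      rw [A.lower_dpow ha, add_mul, TensorProduct.add_tmul, smul_mul_assoc,
        TensorProduct.smul_tmul', show n + ((i + 1 : ℕ) : ℤ) = n + 1 + i by push_cast; ring]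
    rw [tensorRho_tmul, tensorRho_tmul, A.rho_lower, Derivation.coeFn_coe, map_add, map_add,
      LinearMap.add_apply, e0, e1, e2, e3, e4, e5, map_sum, Finset.smul_sum]
    have e8 (i : ℕ) : A.trho S sl2Lower ((A.dpow i a * c) ⊗ₜ[ℂ] S.mode b (n + i) d) =
        (A.lower (A.dpow i a) * c) ⊗ₜ[ℂ] S.mode b (n + i) d +
        ((A.dpow i a * A.lower c) ⊗ₜ[ℂ] S.mode b (n + i) d +
        (A.dpow i a * c) ⊗ₜ[ℂ] S.mode b (n + i) (S.rho sl2Lower d) +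
        (A.dpow i a * c) ⊗ₜ[ℂ] S.mode (S.rho sl2Lower b) (n + i) d +
        (2 * q - (n + i : ℤ) - 2 : ℂ) • ((A.dpow i a * c) ⊗ₜ[ℂ] S.mode b (n + 1 + i) d)) := by
      rw [tensorRho_tmul, A.rho_lower, Derivation.coeFn_coe, Derivation.leibniz, e6,
        smul_eq_mul, smul_eq_mul, mul_comm c, TensorProduct.add_tmul, TensorProduct.tmul_add,
        TensorProduct.tmul_add, TensorProduct.tmul_smul,
        show n + (i : ℤ) + 1 = n + 1 + i by ring]
      abel
    simp only [e8]
    rw [Finset.sum_add_distrib, e7]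
    simp only [Finset.sum_add_distrib]
    have e9 : ∑ i ∈ Finset.range (N + 1), (2 * (p + q : ℤ) - n - 2 : ℂ) •
        ((A.dpow i a * c) ⊗ₜ[ℂ] S.mode b (n + 1 + i) d) =
        ∑ i ∈ Finset.range (N + 1), (2 * p + i : ℂ) •
          ((A.dpow i a * c) ⊗ₜ[ℂ] S.mode b (n + 1 + i) d) +
        ∑ i ∈ Finset.range (N + 1), (2 * q - (n + i : ℤ) - 2 : ℂ) •
          ((A.dpow i a * c) ⊗ₜ[ℂ] S.mode b (n + 1 + i) d) := by
      rw [← Finset.sum_add_distrib]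
      refine Finset.sum_congr rfl fun i _ => ?_
      rw [← add_smul]
      congr 1
      push_cast
      ring
    rw [e9]
    abel

theorem trho_lower_tmode (k : ℤ) (x y : U ⊗[ℂ] V)
    (hx : x ∈ tensorGrading A.grading S.grading k) (n : ℤ) :
    A.trho S sl2Lower (A.tmode S n x y) - A.tmode S n x (A.trho S sl2Lower y) =
      A.tmode S n (A.trho S sl2Lower x) y +
        (2 * k - n - 2 : ℂ) • A.tmode S (n + 1) x y := by
  have h : tensorGrading A.grading S.grading k ≤ LinearMap.eqLocus
      ((A.trho S sl2Lower) ∘ₗ (A.tmode S n).flip y -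
        (A.tmode S n).flip (A.trho S sl2Lower y))
      ((A.tmode S n).flip y ∘ₗ A.trho S sl2Lower +
        (2 * k - n - 2 : ℂ) • (A.tmode S (n + 1)).flip y) :=
    tensorGrading_le fun p q hpq a ha b hb => by
      have := A.trho_lower_tmode_tmul S ha hb y n
      rwa [hpq] at this
  exact h hx

/-- The tensor product of the quasi-vertex operator algebra attached to a commutative algebra and
another quasi-vertex operator algebra. -/
def tensorQVOA [Nontrivial U] : QVOA (U ⊗[ℂ] V) where
  toVertexAlg := A.tensorVertexAlg S
  grading := tensorGrading A.grading S.grading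
  internal := isInternal_of_eigenvalue _ (A.trho S sl2Euler)
    (iSup_tensorGrading A.iSup_grading (iSup_grading_eq_top S)) (A.trho_euler S)
  mode_mem k l n x y hx hy := by
    rw [tensorVertexAlg_mode]
    exact A.tmode_mem S k l n x y hx hy
  finiteDimensional := by
    obtain ⟨N, hN⟩ := A.bounded_below
    obtain ⟨M, hM⟩ := S.bounded_below
    exact finiteDimensional_tensorGrading hN hM A.finiteDimensional S.finiteDimensional
  bounded_below := by
    obtain ⟨N, hN⟩ := A.bounded_below
    obtain ⟨M, hM⟩ := S.bounded_below
    exact ⟨N + M, fun k hk => tensorGrading_eq_bot hN hM hk⟩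
  rho := A.trho S
  rho_euler := A.trho_euler S
  rho_raise x := by
    rw [tensorVertexAlg_mode]
    exact A.trho_raise S x
  translation x n := by
    rw [tensorVertexAlg_mode, tensorVertexAlg_mode]
    exact LinearMap.ext fun y => A.tmode_trho_raise S x y n
  translation_bracket x n := by
    rw [tensorVertexAlg_mode, tensorVertexAlg_mode]
    exact LinearMap.ext fun y => A.trho_raise_tmode S x y n
  lower_bracket k x hx n := by
    rw [tensorVertexAlg_mode, tensorVertexAlg_mode, tensorVertexAlg_mode]
    exact LinearMap.ext fun y => A.trho_lower_tmode S k x y hx n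

theorem tensorQVOA_mode [Nontrivial U] (x : U ⊗[ℂ] V) (n : ℤ) :
    (A.tensorQVOA S).mode x n = A.tmode S n x :=
  A.tensorVertexAlg_mode S x n

end SL2Algebra

/-! ### The trivial quasi-vertex operator algebra -/

theorem finsum_ite_cast_eq {M : Type*} [AddCommMonoid M] (k : ℤ) (g : ℕ → M) :
    ∑ᶠ i : ℕ, (if (i : ℤ) = k then g i else 0) = if 0 ≤ k then g k.toNat else 0 := by
  split_ifs with hk
  · rw [finsum_eq_single _ k.toNat fun i hi => if_neg (by omega), if_pos (by omega)]
  · exact finsum_eq_zero_of_forall_eq_zero fun i => if_neg (by omega)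

theorem ringChoose_neg_one_sub (k p : ℕ) :
    Ring.choose (-1 - k : ℤ) p = (-1) ^ p * ((k + p).choose p : ℤ) := by
  have h := Ring.choose_neg (1 + k : ℤ) p
  rw [show -(1 + k : ℤ) = -1 - k by ring, show (1 + k : ℤ) + p - 1 = ((k + p : ℕ) : ℤ) by
    push_cast; ring, Ring.choose_natCast] at h
  rw [h, Int.negOnePow_def, Units.smul_def]
  simp

/-- The identity between binomial coefficients which is the Jacobi identity for the vacuum. -/
theorem ringChoose_jacobi {r s t : ℤ} (h : r + s + t = -2) :
    (if 0 ≤ -1 - t then Ring.choose r (-1 - t).toNat else 0) =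
      (if 0 ≤ -1 - s then (-1) ^ (-1 - s).toNat * Ring.choose t (-1 - s).toNat else 0) -
      (if 0 ≤ -1 - r then (-1) ^ (-1 - r).toNat * Ring.choose t (-1 - r).toNat else 0) *
        (Int.negOnePow t : ℤ) := by
  have hsq (n : ℕ) : ((-1 : ℤ) ^ n) * (-1) ^ n = 1 := by rw [← mul_pow]; norm_num
  -- The numbers −1−t, −1−s, −1−r add up to −1, so at least one is negative. If exactly one is
  -- negative the identity is a symmetry or a reflection of binomial coefficients; otherwise each
  -- term vanishes.
  obtain ht | ht := lt_or_ge (-1 - t) 0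
  · lift t to ℕ using by omega with T
    rw [if_neg (by omega)]
    obtain hs | hs := lt_or_ge (-1 - s) 0
    · obtain ⟨q, hq⟩ := Int.eq_ofNat_of_zero_le (show 0 ≤ -1 - r by omega)
      rw [if_neg (by omega), hq, if_pos (by omega), Int.toNat_natCast, Ring.choose_natCast,
        Nat.choose_eq_zero_of_lt (by omega)]
      simp
    obtain ⟨p, hp⟩ := Int.eq_ofNat_of_zero_le hs
    obtain hr | hr := lt_or_ge (-1 - r) 0
    · rw [if_neg (show ¬ 0 ≤ -1 - r by omega), hp, if_pos (by omega), Int.toNat_natCast,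
        Ring.choose_natCast, Nat.choose_eq_zero_of_lt (by omega)]
      simp
    obtain ⟨q, hq⟩ := Int.eq_ofNat_of_zero_le hr
    obtain rfl : T = p + q := by omega
    rw [hp, hq, if_pos (by omega), if_pos (by omega), Int.toNat_natCast, Int.toNat_natCast,
      Ring.choose_natCast, Ring.choose_natCast, Nat.choose_symm_add, Int.negOnePow_def]
    rw [zpow_natCast, Units.val_pow_eq_pow_val, pow_add, Units.val_neg, Units.val_one]
    linear_combination ((-1) ^ p * ((p + q).choose q : ℤ)) * hsq q
  · obtain ⟨k, hk⟩ := Int.eq_ofNat_of_zero_le ht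
    obtain rfl : t = -1 - k := by omega
    have hn : ((Int.negOnePow (-1 - k) : ℤˣ) : ℤ) = - (-1) ^ k := by
      rw [Int.negOnePow_def, show (-1 - k : ℤ) = -(k + 1 : ℕ) by push_cast; ring, zpow_neg,
        zpow_natCast, ← inv_pow]
      simp [pow_succ]
    rw [hk, if_pos (by omega), Int.toNat_natCast, hn]
    obtain hs | hs := lt_or_ge (-1 - s) 0
    · rw [if_neg (show ¬ 0 ≤ -1 - s by omega)]
      obtain hr | hr := lt_or_ge (-1 - r) 0
      · rw [if_neg (by omega)]
        lift r to ℕ using by omega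
        rw [Ring.choose_natCast, Nat.choose_eq_zero_of_lt (by omega)]
        simp
      · obtain ⟨q, hq⟩ := Int.eq_ofNat_of_zero_le hr
        obtain rfl : r = -1 - q := by omega
        rw [hq, if_pos (by omega), Int.toNat_natCast, ringChoose_neg_one_sub,
          ringChoose_neg_one_sub, add_comm q k, ← Nat.choose_symm_add]
        linear_combination (-(-1) ^ k * ((k + q).choose k : ℤ)) * hsq q
    · obtain ⟨p, hp⟩ := Int.eq_ofNat_of_zero_le hs
      obtain rfl : r = ((k + p : ℕ) : ℤ) := by omega
      rw [hp, if_pos (by omega), if_neg (by omega), Int.toNat_natCast, ringChoose_neg_one_sub,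
        Ring.choose_natCast, Nat.choose_symm_add]
      linear_combination (-((k + p).choose p : ℤ)) * hsq p

/-- The products on the complex numbers: `a(-1)b = ab`, and the other modes vanish. -/
def trivialFamily : ModeFamily ℂ where
  mode n := if n = -1 then LinearMap.mul ℂ ℂ else 0
  exists_eq_zero a b x := ⟨(-x).toNat, fun k hk => by
    rw [if_neg (by omega)]
    rfl⟩

theorem trivialFamily_mode (n : ℤ) (a b : ℂ) :
    trivialFamily.mode n a b = if n = -1 then a * b else 0 := by
  rw [trivialFamily]
  dsimp only
  split_ifs <;> rfl

/-- Only the mode −1 is nonzero. Hence the three products survive only at i = −1−t, −1−s and −1−r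
respectively, and only when r + s + t = −2. -/
theorem trivialFamily_jacobi (a b c : ℂ) : trivialFamily.Jacobi a b c := fun r s t => by
  simp only [ModeFamily.jacobiLeft, ModeFamily.jacobiRight, trivialFamily_mode]
  by_cases h : r + s + t = -2
  · have hl (i : ℕ) : (Ring.choose r i • (if r + s - i = -1 then
        (if t + i = -1 then a * b else 0) * c else 0) : ℂ) =
        if (i : ℤ) = -1 - t then Ring.choose r i • (a * b * c) else 0 := by
      split_ifs <;> first | omega | simp
    have hr (i : ℕ) : (((-1 : ℤ) ^ i * Ring.choose t i) • ((if r + t - i = -1 then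
        a * (if s + i = -1 then b * c else 0) else 0) - (Int.negOnePow t : ℤ) •
          (if s + t - i = -1 then b * (if r + i = -1 then a * c else 0) else 0)) : ℂ) =
        (if (i : ℤ) = -1 - s then ((-1 : ℤ) ^ i * Ring.choose t i) • (a * b * c) else 0) +
        (if (i : ℤ) = -1 - r then
          -((-1 : ℤ) ^ i * Ring.choose t i * Int.negOnePow t) • (a * b * c) else 0) := by
      split_ifs <;> first
        | omega
        | (simp only [zsmul_eq_mul, sub_zero, zero_sub, mul_zero, add_zero, zero_add]; done)
        | (simp only [zsmul_eq_mul, sub_zero, zero_sub, mul_zero, add_zero, zero_add]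
           push_cast
           ring)
    rw [finsum_congr hl, finsum_congr hr, finsum_add_distrib, finsum_ite_cast_eq,
      finsum_ite_cast_eq, finsum_ite_cast_eq]
    · have := congrArg (fun n : ℤ => n • (a * b * c)) (ringChoose_jacobi h)
      simp only [sub_smul, ite_smul, zero_smul, ite_mul, zero_mul] at this
      rw [this, sub_eq_add_neg]
      congr 1
      split_ifs <;> simp
    · exact (Set.finite_singleton (-1 - s).toNat).subset fun i hi => by
        by_contra h'
        exact hi (if_neg fun h'' => h' (by simp; omega))
    · exact (Set.finite_singleton (-1 - r).toNat).subset fun i hi => by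
        by_contra h'
        exact hi (if_neg fun h'' => h' (by simp; omega))
  · refine (finsum_eq_zero_of_forall_eq_zero fun i => ?_).trans
      (finsum_eq_zero_of_forall_eq_zero fun i => ?_).symm
    · split_ifs <;> first | omega | simp
    · split_ifs <;> first | omega | simp

/-- The complex numbers as a vertex algebra. -/
def trivialVertexAlg : VertexAlg ℂ :=
  trivialFamily.toVertexAlg 1 one_ne_zero
    (fun a n hn => by rw [trivialFamily_mode, if_neg (by omega)])
    (fun a => by rw [trivialFamily_mode, if_pos rfl, mul_one]) trivialFamily_jacobi

theorem trivialVertexAlg_mode (a b : ℂ) (n : ℤ) :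
    trivialVertexAlg.mode a n b = if n = -1 then a * b else 0 :=
  (congrArg (fun f : Module.End ℂ ℂ => f b) (trivialFamily.ncoeff_field a n)).trans
    (trivialFamily_mode n a b)

/-- The complex numbers as a quasi-vertex operator algebra. -/
def trivialQVOA : QVOA ℂ where
  toVertexAlg := trivialVertexAlg
  grading n := if n = 0 then ⊤ else ⊥
  internal := isInternal_of_eigenvalue _ 0
    (top_le_iff.1 ((if_pos rfl).ge.trans (le_iSup (fun n : ℤ => if n = 0 then ⊤ else ⊥) 0)))
    (fun k a ha => by
      split_ifs at ha with h
      · simp [h]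
      · rw [(Submodule.mem_bot ℂ).1 ha, smul_zero, map_zero])
  mode_mem k l n a b ha hb := by
    rw [trivialVertexAlg_mode]
    by_cases hk : k = 0
    · by_cases hl : l = 0
      · by_cases hn : n = -1
        · rw [if_pos (by omega : k + l - n - 1 = 0)]
          trivial
        · rw [if_neg hn]
          exact Submodule.zero_mem _
      · rw [if_neg hl, Submodule.mem_bot] at hb
        simp [hb]
    · rw [if_neg hk, Submodule.mem_bot] at ha
      simp [ha]
  finiteDimensional k := inferInstance
  bounded_below := ⟨0, fun k hk => if_neg (by omega)⟩
  rho := 0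
  rho_euler k a ha := by
    split_ifs at ha with h
    · simp [h]
    · rw [(Submodule.mem_bot ℂ).1 ha, smul_zero, map_zero]
  rho_raise a := by
    rw [trivialVertexAlg_mode]
    simp
  translation a n := LinearMap.ext fun b => by
    rw [LinearMap.smul_apply, LieHom.zero_apply, LinearMap.zero_apply, VertexAlg.mode_zero,
      LinearMap.zero_apply, trivialVertexAlg_mode]
    by_cases hn : n = 0
    · simp [hn]
    · rw [if_neg (by omega), smul_zero]
  translation_bracket a n := LinearMap.ext fun b => by
    rw [LieHom.zero_apply, LieRing.of_associative_ring_bracket, zero_mul, mul_zero, sub_zero,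
      LinearMap.smul_apply, LinearMap.zero_apply,
      trivialVertexAlg_mode]
    by_cases hn : n = 0
    · simp [hn]
    · rw [if_neg (by omega), smul_zero]
  lower_bracket k a ha n := LinearMap.ext fun b => by
    rw [LieHom.zero_apply, LieRing.of_associative_ring_bracket, zero_mul, mul_zero, sub_zero,
      LinearMap.add_apply, LinearMap.smul_apply,
      LinearMap.zero_apply, LinearMap.zero_apply, VertexAlg.mode_zero, LinearMap.zero_apply,
      trivialVertexAlg_mode, zero_add]
    by_cases hn : n + 1 = -1
    · split_ifs at ha with hk
      · rw [show n = -2 by omega, hk]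
        simp
      · rw [(Submodule.mem_bot ℂ).1 ha]
        simp
    · rw [if_neg hn, smul_zero]

theorem trivialQVOA_mode (a b : ℂ) (n : ℤ) :
    trivialQVOA.mode a n b = if n = -1 then a * b else 0 := trivialVertexAlg_mode a b n

/-! ### Transport along a linear equivalence -/

namespace QVOA

variable {V W : Type*} [AddCommGroup V] [Module ℂ V] [AddCommGroup W] [Module ℂ W]
  (S : QVOA V) (e : V ≃ₗ[ℂ] W)

/-- The transported products. -/
def transportFamily : ModeFamily W where
  mode n := ((S.toModeFamily.mode n).compl₁₂ e.symm.toLinearMap e.symm.toLinearMap).compr₂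
    e.toLinearMap
  exists_eq_zero a b x := by
    obtain ⟨R, hR⟩ := S.exists_mode_eq_zero (e.symm a) (e.symm b) x
    exact ⟨R, fun k hk => (congrArg e (hR k hk)).trans (map_zero e)⟩

theorem transportFamily_mode (n : ℤ) (a b : W) :
    (S.transportFamily e).mode n a b = e (S.mode (e.symm a) n (e.symm b)) := rfl

theorem transportFamily_jacobi (a b c : W) : (S.transportFamily e).Jacobi a b c := fun r s t => by
  have h := congrArg e (S.toModeFamily_jacobi (e.symm a) (e.symm b) (e.symm c) r s t)
  have h1 := AddMonoidHom.map_finsum (e : V →+ W)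
    (S.toModeFamily.jacobiLeft_finite (e.symm a) (e.symm b) (e.symm c) r s t)
  have h2 := AddMonoidHom.map_finsum (e : V →+ W)
    (S.toModeFamily.jacobiRight_finite (e.symm a) (e.symm b) (e.symm c) r s t)
  refine Eq.trans (finsum_congr fun i => ?_) (h1.symm.trans (h.trans (h2.trans
    (finsum_congr fun i => ?_))))
  · simp only [ModeFamily.jacobiLeft, transportFamily_mode, VertexAlg.toModeFamily_mode,
      LinearEquiv.symm_apply_apply, AddMonoidHom.coe_coe, map_zsmul]
  · simp only [ModeFamily.jacobiRight, transportFamily_mode, VertexAlg.toModeFamily_mode,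
      LinearEquiv.symm_apply_apply, AddMonoidHom.coe_coe, map_zsmul, map_sub]

/-- The transported vertex algebra. -/
def transportVertexAlg : VertexAlg W :=
  (S.transportFamily e).toVertexAlg (e S.vac) ((map_ne_zero_iff e e.injective).2 S.vac_ne_zero)
    (fun a n hn => by
      rw [transportFamily_mode, LinearEquiv.symm_apply_apply]
      exact (congrArg e (S.creative _ n hn)).trans (map_zero e))
    (fun a => by
      rw [transportFamily_mode, LinearEquiv.symm_apply_apply]
      exact (congrArg e (S.creates _)).trans (e.apply_symm_apply a))
    (S.transportFamily_jacobi e)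

theorem transportVertexAlg_mode (a : W) (n : ℤ) :
    (S.transportVertexAlg e).mode a n = e.conj (S.mode (e.symm a) n) :=
  (S.transportFamily e).ncoeff_field a n

theorem mem_map_iff {x : W} {p : Submodule ℂ V} :
    x ∈ p.map (e : V →ₗ[ℂ] W) ↔ e.symm x ∈ p := by
  rw [Submodule.mem_map_equiv]

theorem conj_lie (f g : Module.End ℂ V) : ⁅e.conj f, e.conj g⁆ = e.conj ⁅f, g⁆ :=
  (e.lieConj.map_lie f g).symm

/-- The transported quasi-vertex operator algebra. -/
def transport : QVOA W where
  toVertexAlg := S.transportVertexAlg e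
  grading n := (S.grading n).map (e : V →ₗ[ℂ] W)
  internal := isInternal_of_eigenvalue _ (e.conj (S.rho sl2Euler))
    (by
      rw [← Submodule.map_iSup, SL2Algebra.iSup_grading_eq_top, Submodule.map_top]
      exact LinearEquiv.range e)
    (fun k a ha => by
      rw [LinearEquiv.conj_apply_apply, S.rho_euler k _ ((mem_map_iff e).1 ha), map_smul,
        e.apply_symm_apply])
  mode_mem k l n a b ha hb := by
    rw [transportVertexAlg_mode, mem_map_iff, LinearEquiv.conj_apply_apply, e.symm_apply_apply]
    exact S.mode_mem k l n _ _ ((mem_map_iff e).1 ha) ((mem_map_iff e).1 hb)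
  finiteDimensional k := by
    have := S.finiteDimensional k
    infer_instance
  bounded_below := by
    obtain ⟨N, hN⟩ := S.bounded_below
    exact ⟨N, fun k hk => by rw [hN k hk, Submodule.map_bot]⟩
  rho := e.lieConj.toLieHom.comp S.rho
  rho_euler k a ha := by
    change e (S.rho sl2Euler (e.symm a)) = _
    rw [S.rho_euler k _ ((mem_map_iff e).1 ha), map_smul, e.apply_symm_apply]
  rho_raise a := by
    change e (S.rho sl2Raise (e.symm a)) = (S.transportVertexAlg e).mode a (-2) (e S.vac)
    rw [transportVertexAlg_mode, LinearEquiv.conj_apply_apply, e.symm_apply_apply, S.rho_raise]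
  translation a n := by
    change (S.transportVertexAlg e).mode (e (S.rho sl2Raise (e.symm a))) n = _
    rw [transportVertexAlg_mode, e.symm_apply_apply, S.translation, map_smul,
      transportVertexAlg_mode]
  translation_bracket a n := by
    change ⁅e.conj (S.rho sl2Raise), _⁆ = _
    rw [transportVertexAlg_mode, conj_lie, S.translation_bracket, map_smul,
      transportVertexAlg_mode]
  lower_bracket k a ha n := by
    change ⁅e.conj (S.rho sl2Lower), _⁆ =
      (S.transportVertexAlg e).mode (e (S.rho sl2Lower (e.symm a))) n + _
    rw [transportVertexAlg_mode, conj_lie, S.lower_bracket k _ ((mem_map_iff e).1 ha), map_add,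
      map_smul, transportVertexAlg_mode, transportVertexAlg_mode, e.symm_apply_apply]

theorem transport_mode (a b : W) (n : ℤ) :
    (S.transport e).mode a n b = e (S.mode (e.symm a) n (e.symm b)) := by
  change (S.transportVertexAlg e).mode a n b = _
  rw [transportVertexAlg_mode, LinearEquiv.conj_apply_apply]

theorem transport_rho (x : SL2C) (a : W) :
    (S.transport e).rho x a = e (S.rho x (e.symm a)) := rfl

theorem isQVOAIso_transport : IsQVOAIso S (S.transport e) e where
  map_vac := rfl
  map_mode a b n := by rw [transport_mode, e.symm_apply_apply, e.symm_apply_apply]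
  map_rho x a := by rw [transport_rho, e.symm_apply_apply]

end QVOA

/-! ### The quasi-vertex operator algebra of a commutative algebra -/

namespace SL2Algebra

variable {U : Type*} [CommRing U] [Algebra ℂ U] [Nontrivial U] (A : SL2Algebra U)

/-- The quasi-vertex operator algebra with `Y(a, z) b = (e ^ (z L(-1)) a) b`. -/
def qvoa : QVOA U := (A.tensorQVOA trivialQVOA).transport (TensorProduct.rid ℂ U)

theorem qvoa_vac : A.qvoa.vac = 1 := by
  change TensorProduct.rid ℂ U ((1 : U) ⊗ₜ (1 : ℂ)) = 1
  simp

theorem qvoa_mode_eq (a b : U) (n : ℤ) (R : ℕ)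
    (hR : ∀ i : ℕ, R ≤ i → n + i ≠ -1) : A.qvoa.mode a n b =
      ∑ i ∈ Finset.range R, if n + i = -1 then A.dpow i a * b else 0 := by
  rw [qvoa, QVOA.transport_mode, tensorQVOA_mode, TensorProduct.rid_symm_apply,
    TensorProduct.rid_symm_apply, A.tmode_tmul trivialQVOA n a b 1 1 R fun i hi => by
      rw [trivialQVOA_mode, if_neg (hR i hi)], map_sum]
  refine Finset.sum_congr rfl fun i _ => ?_
  rw [trivialQVOA_mode]
  split_ifs <;> simp

theorem qvoa_mode_nonneg (a b : U) (n : ℤ) (hn : 0 ≤ n) : A.qvoa.mode a n b = 0 := by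
  rw [A.qvoa_mode_eq a b n 0 fun i _ => by omega, Finset.sum_range_zero]

theorem qvoa_mode_neg (a b : U) (n : ℕ) : A.qvoa.mode a (-n - 1) b = A.dpow n a * b := by
  rw [A.qvoa_mode_eq a b (-n - 1) (n + 1) fun i _ => by omega,
    Finset.sum_eq_single n (fun i _ hi => if_neg (by omega))
      (fun h => absurd (Finset.self_mem_range_succ n) h), if_pos (by omega)]

theorem qvoa_grading (k : ℤ) : A.qvoa.grading k = A.grading k := by
  change (tensorGrading A.grading trivialQVOA.grading k).map
    (TensorProduct.rid ℂ U : U ⊗[ℂ] ℂ →ₗ[ℂ] U) = _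
  refine le_antisymm ?_ fun a ha => ?_
  · rw [Submodule.map_le_iff_le_comap]
    refine tensorGrading_le fun p q hpq a ha b hb => ?_
    change b ∈ (if q = 0 then ⊤ else ⊥ : Submodule ℂ ℂ) at hb
    rw [Submodule.mem_comap]
    change TensorProduct.rid ℂ U (a ⊗ₜ b) ∈ _
    rw [TensorProduct.rid_tmul]
    split_ifs at hb with hq
    · rw [show k = p by omega]
      exact Submodule.smul_mem _ _ ha
    · rw [(Submodule.mem_bot ℂ).1 hb, zero_smul]
      exact Submodule.zero_mem _
  · refine ⟨a ⊗ₜ 1, tmul_mem_tensorGrading (l := 0) (add_zero k) ha ?_, ?_⟩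
    · change (1 : ℂ) ∈ (if (0 : ℤ) = 0 then ⊤ else ⊥ : Submodule ℂ ℂ)
      rw [if_pos rfl]
      trivial
    · change TensorProduct.rid ℂ U (a ⊗ₜ (1 : ℂ)) = a
      simp

theorem qvoa_rho (x : SL2C) : A.qvoa.rho x = A.rho x := LinearMap.ext fun a => by
  rw [qvoa, QVOA.transport_rho, TensorProduct.rid_symm_apply]
  change TensorProduct.rid ℂ U (tensorRho A.rho trivialQVOA.rho x (a ⊗ₜ 1)) = _
  rw [tensorRho_tmul]
  have : trivialQVOA.rho x = 0 := rfl
  simp [this]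

end SL2Algebra

/-- Transport along an isomorphism of algebras. -/
def SL2Algebra.map {U U' : Type*} [CommRing U] [Algebra ℂ U] [CommRing U'] [Algebra ℂ U']
    (A : SL2Algebra U) (e : U ≃ₐ[ℂ] U') : SL2Algebra U' :=
  let D (d : Derivation ℂ U U) : Derivation ℂ U' U' :=
    Derivation.mk' (e.toLinearEquiv.conj (d : U →ₗ[ℂ] U)) fun a b => by
      change e (d (e.symm (a * b))) = a * e (d (e.symm b)) + b * e (d (e.symm a))
      simp
  { raise := D A.raise
    euler := D A.euler
    lower := D A.lower
    grading := fun k => (A.grading k).map e.toLinearMap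
    iSup_grading := by
      rw [← Submodule.map_iSup, A.iSup_grading, Submodule.map_top, LinearMap.range_eq_top]
      exact e.surjective
    mul_mem := by
      rintro k l _ _ ⟨a, ha, rfl⟩ ⟨b, hb, rfl⟩
      exact ⟨a * b, A.mul_mem ha hb, map_mul e a b⟩
    raise_mem := by
      rintro k _ ⟨a, ha, rfl⟩
      exact ⟨A.raise a, A.raise_mem ha,
        congrArg (fun x => e (A.raise x)) (e.symm_apply_apply a).symm⟩
    euler_apply := by
      rintro k _ ⟨a, ha, rfl⟩
      change e (A.euler (e.symm (e a))) = (k : ℂ) • e a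
      rw [e.symm_apply_apply, A.euler_apply ha, map_smul]
    finiteDimensional := fun k => by
      have := A.finiteDimensional k
      infer_instance
    bounded_below := by
      obtain ⟨N, hN⟩ := A.bounded_below
      exact ⟨N, fun k hk => by rw [hN k hk, Submodule.map_bot]⟩
    euler_raise := fun a => by
      change e (A.euler (e.symm (e (A.raise (e.symm a))))) -
        e (A.raise (e.symm (e (A.euler (e.symm a))))) = e (A.raise (e.symm a))
      rw [e.symm_apply_apply, e.symm_apply_apply, ← map_sub, A.euler_raise]
    euler_lower := fun a => by
      change e (A.euler (e.symm (e (A.lower (e.symm a))))) -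
        e (A.lower (e.symm (e (A.euler (e.symm a))))) = -e (A.lower (e.symm a))
      rw [e.symm_apply_apply, e.symm_apply_apply, ← map_sub, A.euler_lower, map_neg]
    lower_raise := fun a => by
      change e (A.lower (e.symm (e (A.raise (e.symm a))))) -
        e (A.raise (e.symm (e (A.lower (e.symm a))))) = (2 : ℂ) • e (A.euler (e.symm a))
      rw [e.symm_apply_apply, e.symm_apply_apply, ← map_sub, A.lower_raise, map_smul] }

/-! ### The `sl₂`-action on quasi-modular forms -/

namespace QuasiModular

open MvPolynomial

/-- The Euler operator on polynomials. -/
def polynomialEuler : Derivation ℂ (MvPolynomial (Fin 3) ℂ) (MvPolynomial (Fin 3) ℂ) :=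
  mkDerivation ℂ fun i => (eisensteinDegree i : ℂ) • X i

/-- The operator `12 ∂/∂E₂` on polynomials. -/
def polynomialLower : Derivation ℂ (MvPolynomial (Fin 3) ℂ) (MvPolynomial (Fin 3) ℂ) :=
  (12 : ℂ) • pderiv 0

theorem polynomialLower_apply (p : MvPolynomial (Fin 3) ℂ) :
    polynomialLower p = (12 : ℂ) • pderiv 0 p := rfl

theorem polynomialEuler_monomial (d : Fin 3 →₀ ℕ) (c : ℂ) :
    polynomialEuler (monomial d c) =
      (Finsupp.weight eisensteinDegree d : ℂ) • monomial d c := by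
  have h : polynomialEuler = ∑ i : Fin 3, ((eisensteinDegree i : ℂ) • X i :
      MvPolynomial (Fin 3) ℂ) • pderiv i := by
    refine derivation_ext fun i => ?_
    rw [polynomialEuler, mkDerivation_X]
    fin_cases i <;> simp [Fin.sum_univ_three, pderiv_X]
  rw [h, isModularPolynomial_degree_nonneg, Fin.sum_univ_three]
  simp only [Derivation.add_apply, Derivation.smul_apply, smul_eq_mul, smul_mul_assoc,
    X_mul_pderiv_monomial, eisensteinDegree]
  simp only [← Nat.cast_smul_eq_nsmul ℂ, smul_smul, ← add_smul]
  congr 1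
  simp

theorem coeff_polynomialEuler (p : MvPolynomial (Fin 3) ℂ) (d : Fin 3 →₀ ℕ) :
    coeff d (polynomialEuler p) = (Finsupp.weight eisensteinDegree d : ℂ) * coeff d p := by
  induction p using MvPolynomial.induction_on' with
  | monomial s r =>
    rw [polynomialEuler_monomial, coeff_smul, coeff_monomial, smul_eq_mul]
    split_ifs with h
    · rw [h]
    · simp
  | add p q hp hq => rw [map_add, coeff_add, coeff_add, hp, hq, mul_add]

/-- The Euler operator multiplies each monomial by its degree. Homogeneity can thus be read off from
commutation relations, which is how θ is seen to raise the degree. -/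
theorem polynomialEuler_eq_smul_iff {p : MvPolynomial (Fin 3) ℂ} {k : ℤ} :
    polynomialEuler p = (k : ℂ) • p ↔ p.IsWeightedHomogeneous eisensteinDegree k := by
  constructor
  · intro h d hd
    have := congrArg (coeff d) h
    rw [coeff_polynomialEuler, coeff_smul, smul_eq_mul] at this
    exact_mod_cast mul_right_cancel₀ hd this
  · intro h
    ext d
    rw [coeff_polynomialEuler, coeff_smul, smul_eq_mul]
    by_cases hd : coeff d p = 0
    · rw [hd, mul_zero, mul_zero]
    · rw [h hd]

theorem iSup_weightedHomogeneousSubmodule :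
    ⨆ k : ℤ, weightedHomogeneousSubmodule ℂ eisensteinDegree k = ⊤ := by
  refine eq_top_iff.2 fun p _ => ?_
  induction p using MvPolynomial.induction_on' with
  | monomial d c =>
    exact Submodule.mem_iSup_of_mem (Finsupp.weight eisensteinDegree d)
      (isWeightedHomogeneous_monomial _ _ _ rfl)
  | add p q hp hq => exact Submodule.add_mem _ (hp trivial) (hq trivial)

theorem finiteDimensional_weightedHomogeneousSubmodule (k : ℤ) :
    FiniteDimensional ℂ (weightedHomogeneousSubmodule ℂ eisensteinDegree k) := by
  have hfin : {d : Fin 3 →₀ ℕ | Finsupp.weight eisensteinDegree d = k}.Finite := by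
    refine (Set.finite_Iic (Finsupp.equivFunOnFinite.symm fun _ => k.toNat)).subset
      fun d hd => ?_
    have h := isModularPolynomial_degree_nonneg d
    rw [show Finsupp.weight eisensteinDegree d = k from hd] at h
    intro i
    change d i ≤ k.toNat
    fin_cases i <;> simp <;> omega
  rw [weightedHomogeneousSubmodule_eq_finsupp_supported, AddMonoidAlgebra.supported_eq_span_single]
  exact FiniteDimensional.span_of_finite ℂ (hfin.image _)

theorem weightedHomogeneousSubmodule_eq_bot {k : ℤ} (hk : k < 0) :
    weightedHomogeneousSubmodule ℂ eisensteinDegree k = ⊥ := by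
  refine (Submodule.eq_bot_iff _).2 fun p hp => ?_
  ext d
  by_contra h
  have h1 := isModularPolynomial_degree_nonneg d
  rw [hp h] at h1
  omega

/-- The polynomial algebra with the derivation `g i` of the generators. -/
def polynomialSL2 (g : Fin 3 → MvPolynomial (Fin 3) ℂ)
    (hg : ∀ i, (g i).IsWeightedHomogeneous eisensteinDegree (eisensteinDegree i + 1))
    (hg' : ∀ i, (12 : ℂ) • pderiv 0 (g i) = (2 * eisensteinDegree i : ℂ) • X i) :
    SL2Algebra (MvPolynomial (Fin 3) ℂ) :=
  -- A commutator of derivations is a derivation, so each sl₂ relation need only be checked on the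
  -- generators.
  have hr : ⁅polynomialEuler, mkDerivation ℂ g⁆ = mkDerivation ℂ g := derivation_ext fun i => by
    rw [Derivation.commutator_apply, mkDerivation_X, polynomialEuler_eq_smul_iff.2 (hg i),
      polynomialEuler, mkDerivation_X, Derivation.map_smul, mkDerivation_X]
    push_cast
    module
  { raise := mkDerivation ℂ g
    euler := polynomialEuler
    lower := polynomialLower
    grading := weightedHomogeneousSubmodule ℂ eisensteinDegree
    iSup_grading := iSup_weightedHomogeneousSubmodule
    mul_mem := fun ha hb => ha.mul hb
    raise_mem := fun {k a} ha => by
      have h := congrArg (fun D => D a) hr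
      simp only [Derivation.commutator_apply] at h
      rw [sub_eq_iff_eq_add, polynomialEuler_eq_smul_iff.2 ha, Derivation.map_smul] at h
      refine polynomialEuler_eq_smul_iff.1 (h.trans ?_)
      push_cast
      module
    euler_apply := fun ha => polynomialEuler_eq_smul_iff.2 ha
    finiteDimensional := finiteDimensional_weightedHomogeneousSubmodule
    bounded_below := ⟨0, fun k hk => weightedHomogeneousSubmodule_eq_bot hk⟩
    euler_raise := fun a => congrArg (fun D => D a) hr
    euler_lower := fun a => by
      have h : ⁅polynomialEuler, polynomialLower⁆ = -polynomialLower := derivation_ext fun i => by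
        rw [Derivation.commutator_apply, Derivation.neg_apply, polynomialLower_apply,
          polynomialLower_apply, polynomialEuler, mkDerivation_X, Derivation.map_smul (pderiv 0),
          pderiv_X]
        fin_cases i <;> simp [eisensteinDegree]
      exact congrArg (fun D => D a) h
    lower_raise := fun a => by
      have h : ⁅polynomialLower, mkDerivation ℂ g⁆ = (2 : ℂ) • polynomialEuler :=
        derivation_ext fun i => by
          rw [Derivation.commutator_apply, mkDerivation_X, polynomialLower_apply, hg',
            polynomialLower_apply, polynomialEuler, Derivation.smul_apply, mkDerivation_X,
            smul_smul, pderiv_X]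
          fin_cases i <;> simp
      exact congrArg (fun D => D a) h }

/-! ### Passage from polynomials to quasi-modular forms. -/

/-- Polynomials in `E₂, E₄, E₆` are the same thing as quasi-modular forms. -/
def eisensteinEquiv : MvPolynomial (Fin 3) ℂ ≃ₐ[ℂ] quasiModularAlgebra :=
  (AlgEquiv.ofInjective eisensteinEval eisensteinEval_injective).trans
    (Subalgebra.equivOfEq _ _ eisensteinEval_range)

theorem map_eisensteinEquiv (k : ℤ) :
    (weightedHomogeneousSubmodule ℂ eisensteinDegree k).map eisensteinEquiv.toLinearMap =
      quasiModularDegree k := by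
  refine le_antisymm ?_ fun f hf => ?_
  · rintro _ ⟨p, hp, rfl⟩
    exact eisensteinEval_mem hp
  · obtain ⟨p, hp, h⟩ := exists_polynomial_of_mem hf
    exact ⟨p, hp, Subtype.ext h⟩

/-- The algebra of quasi-modular forms. -/
def quasiModularSL2 : SL2Algebra quasiModularAlgebra :=
  (polynomialSL2 exists_theta_generators.choose
    (fun i => (exists_theta_generators.choose_spec i).1)
    fun i => (exists_theta_generators.choose_spec i).2.1).map eisensteinEquiv

theorem quasiModularSL2_grading (k : ℤ) :
    quasiModularSL2.grading k = quasiModularDegree k := map_eisensteinEquiv k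

theorem quasiModularSL2_lower (p : MvPolynomial (Fin 3) ℂ) (f : quasiModularAlgebra)
    (h : eisensteinEval p = f) :
    (quasiModularSL2.lower f : ℍ → ℂ) = (12 : ℂ) • eisensteinEval (pderiv 0 p) := by
  obtain rfl : eisensteinEquiv p = f := Subtype.ext h
  change (eisensteinEquiv (polynomialLower
    (eisensteinEquiv.symm (eisensteinEquiv p))) : ℍ → ℂ) = _
  rw [AlgEquiv.symm_apply_apply, polynomialLower_apply, map_smul]
  rfl

theorem normalizedDeriv_eisensteinEval {g : Fin 3 → MvPolynomial (Fin 3) ℂ}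
    (hg : ∀ i, eisensteinEval (g i) =
      Derivative.normalizedDerivOfComplex (eisensteinEval (X i))) (p : MvPolynomial (Fin 3) ℂ) :
    eisensteinEval (mkDerivation ℂ g p) =
      Derivative.normalizedDerivOfComplex (eisensteinEval p) := by
  induction p using MvPolynomial.induction_on with
  | C c =>
    rw [derivation_C, map_zero]
    rw [← algebraMap_eq, AlgHom.commutes]
    exact (Derivative.normalizedDerivOfComplex_const c).symm
  | add p q hp hq =>
    rw [map_add, map_add, hp, hq, map_add, Derivative.normalizedDerivOfComplex_add _ _
      (mdifferentiable_eisensteinEval p) (mdifferentiable_eisensteinEval q)]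
  | mul_X p i hp =>
    rw [Derivation.leibniz, mkDerivation_X, smul_eq_mul, smul_eq_mul, map_add, map_mul, map_mul,
      hp, hg, map_mul, Derivative.normalizedDerivOfComplex_mul _ _
      (mdifferentiable_eisensteinEval p) (mdifferentiable_eisensteinEval _)]
    ring

theorem quasiModularSL2_raise (f : quasiModularAlgebra) :
    (quasiModularSL2.raise f : ℍ → ℂ) = Derivative.normalizedDerivOfComplex f := by
  obtain ⟨p, rfl⟩ := eisensteinEquiv.surjective f
  change eisensteinEval (mkDerivation ℂ _ (eisensteinEquiv.symm (eisensteinEquiv p))) = _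
  rw [AlgEquiv.symm_apply_apply]
  exact normalizedDeriv_eisensteinEval
    (fun i => (exists_theta_generators.choose_spec i).2.2) p

theorem quasiModularSL2_dpow (n : ℕ) (f : quasiModularAlgebra) :
    (quasiModularSL2.dpow n f : ℍ → ℂ) =
      (n.factorial : ℂ)⁻¹ • Derivative.normalizedDerivOfComplex^[n] f := by
  have h : ((quasiModularSL2.raise :
      quasiModularAlgebra →ₗ[ℂ] quasiModularAlgebra)^[n] f : ℍ → ℂ) =
      Derivative.normalizedDerivOfComplex^[n] f := by
    induction n with
    | zero => rfl
    | succ n ih =>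
      rw [Function.iterate_succ_apply', Function.iterate_succ_apply', ← ih]
      exact quasiModularSL2_raise _
  rw [← h, ← Module.End.pow_apply]
  rfl

end QuasiModular
/-! ### Quasi-modular forms with values in a quasi-vertex operator algebra -/

/-- Collects by powers of X the product of an expansion with the polynomial exp(±X L(1)); both
directions of the comparison use it. -/
theorem sum_pow_add_smul {M : Type*} [AddCommGroup M] [Module ℂ M] (x : ℂ) (a b : ℕ)
    (B : ℕ → ℕ → M) :
    ∑ p ∈ Finset.range a, ∑ n ∈ Finset.range b, x ^ (p + n) • B p n =
      ∑ r ∈ Finset.range (a + b + 1), x ^ r •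
        ∑ q ∈ Finset.range a ×ˢ Finset.range b, if q.1 + q.2 = r then B q.1 q.2 else 0 := by
  rw [← Finset.sum_product']
  simp only [Finset.smul_sum]
  rw [Finset.sum_comm]
  refine Finset.sum_congr rfl fun p hp => ?_
  simp only [Finset.mem_product, Finset.mem_range] at hp
  rw [Finset.sum_eq_single (p.1 + p.2)]
  · rw [if_pos rfl]
  · intro n _ hn
    rw [if_neg (Ne.symm hn), smul_zero]
  · intro h
    exact absurd (Finset.mem_range.2 (by omega)) h

namespace QVOA

open QuasiModular

variable {V : Type*} [AddCommGroup V] [Module ℂ V] (S : QVOA V)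

theorem lower_pow_mem {l : ℤ} {v : V} (hv : v ∈ S.grading l) (n : ℕ) :
    (S.rho sl2Lower ^ n) v ∈ S.grading (l - n) := by
  induction n with
  | zero => simpa using hv
  | succ n ih =>
    rw [pow_succ', Module.End.mul_apply]
    have := S.lower_mem ih
    rwa [show l - ((n + 1 : ℕ) : ℤ) = l - n - 1 by push_cast; ring]

theorem grading_le_truncation {l N : ℤ} (h : l ≤ N) : S.grading l ≤ S.truncation N :=
  le_iSup (fun n : {n : ℤ // n ≤ N} => S.grading n) ⟨l, h⟩

/-- `L(1)` is nilpotent on every `F_N V`. -/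
theorem exists_lower_pow_eq_zero (N : ℤ) :
    ∃ R : ℕ, ∀ n ≥ R, ∀ v ∈ S.truncation N, (S.rho sl2Lower ^ n) v = 0 := by
  obtain ⟨B, hB⟩ := S.bounded_below
  refine ⟨(N - B + 1).toNat, fun n hn v hv => ?_⟩
  have h : S.truncation N ≤ LinearMap.ker (S.rho sl2Lower ^ n) := by
    refine iSup_le fun l v hv => ?_
    have h := S.lower_pow_mem hv n
    have := l.2
    rw [hB _ (by omega), Submodule.mem_bot] at h
    exact h
  exact h hv

/-- L(1) lowers the degree by one, so conjugation by z^L(0) divides it by z. -/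
theorem powL0_mul_expL1 (z x : ℂ) (hz : z ≠ 0) :
    S.powL0 z * S.expL1 x = S.expL1 (x / z) * S.powL0 z := by
  ext v
  induction v using S.grading_induction with
  | h0 => simp only [map_zero]
  | hadd x y hx hy => simp only [map_add, hx, hy]
  | hmem l v hv =>
    obtain ⟨N, hN⟩ := S.lower_locally_nilpotent v
    rw [Module.End.mul_apply, Module.End.mul_apply, S.powL0_apply z hv, map_smul,
      S.expL1_apply hN, S.expL1_apply hN, map_sum, Finset.smul_sum]
    refine Finset.sum_congr rfl fun n _ => ?_
    rw [map_smul, S.powL0_apply z (S.lower_pow_mem hv n), smul_smul, smul_smul, zpow_sub₀ hz,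
      zpow_natCast, div_pow]
    congr 1
    field_simp

/-- Commuting past j^(2L(0)) divides cj by j² and gives X. In this order K⁻¹ is a power of j on each
degree, followed by a polynomial in X. -/
theorem cocycleInv_eq (γ : SL(2, ℤ)) (τ : ℍ) :
    S.cocycleInv γ τ = S.expL1 (cocycleX γ τ) * S.powL0 (denom γ τ ^ (2 : ℤ)) := by
  have hd := denom_ne_zero (γ : GL (Fin 2) ℝ) τ
  rw [cocycleInv, S.powL0_mul_expL1 _ _ (zpow_ne_zero 2 hd)]
  congr 2
  rw [cocycleX]
  field_simp

/-- The form `τ ↦ f(τ)v`. -/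
def valuedMap : quasiModularAlgebra ⊗[ℂ] V →ₗ[ℂ] (ℍ → V) :=
  TensorProduct.lift (LinearMap.mk₂ ℂ (fun (f : quasiModularAlgebra) (v : V) (τ : ℍ) =>
      (f : ℍ → ℂ) τ • v)
    (fun _ _ _ => funext fun _ => add_smul _ _ _) (fun _ _ _ => funext fun _ => mul_smul _ _ _)
    (fun _ _ _ => funext fun _ => smul_add _ _ _) (fun _ _ _ => funext fun _ => smul_comm _ _ _))

theorem valuedMap_tmul (f : quasiModularAlgebra) (v : V) (τ : ℍ) :
    valuedMap (f ⊗ₜ v) τ = (f : ℍ → ℂ) τ • v := rfl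

/-- In a basis of V, an element of Q ⊗ V is a finite family of functions, and these are the
coordinates of its image. -/
theorem valuedMap_injective : Function.Injective (valuedMap (V := V)) := by
  classical
  rw [injective_iff_map_eq_zero]
  intro x hx
  let b := Module.Basis.ofVectorSpace ℂ V
  have h (x : quasiModularAlgebra ⊗[ℂ] V) (i) (τ : ℍ) :
      ((TensorProduct.equivFinsuppOfBasisRight b x i : quasiModularAlgebra) : ℍ → ℂ) τ =
        b.repr (valuedMap x τ) i := by
    induction x using TensorProduct.induction_on with
    | zero =>
      rw [LinearEquiv.map_zero, LinearMap.map_zero, Pi.zero_apply, LinearEquiv.map_zero]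
      rfl
    | add x y hx hy =>
      rw [LinearEquiv.map_add, LinearMap.map_add, Finsupp.add_apply, Pi.add_apply,
        map_add, Finsupp.add_apply, ← hx, ← hy]
      rfl
    | tmul f v =>
      rw [TensorProduct.equivFinsuppOfBasisRight_apply_tmul_apply, valuedMap_tmul, map_smul,
        Finsupp.smul_apply, smul_eq_mul, mul_comm]
      rfl
  refine (TensorProduct.equivFinsuppOfBasisRight b).injective ?_
  rw [LinearEquiv.map_zero]
  refine Finsupp.ext fun i => Subtype.ext (funext fun τ => ?_)
  rw [h, hx, Pi.zero_apply, LinearEquiv.map_zero]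
  rfl

/-- The slash of f ⊗ v is (f|γ)(τ) exp(X L(1))v, a product of two polynomials in X: the factor
j^(2l) from L(0) makes up the difference between the weights 2m and 2k. -/
theorem valuedMap_tmul_mem {k l m : ℤ} (hkl : k + l = m) {f : quasiModularAlgebra}
    (hf : f ∈ quasiModularDegree k) {v : V} (hv : v ∈ S.grading l) :
    valuedMap (f ⊗ₜ v) ∈ S.valuedForms (2 * m) := by
  obtain ⟨s, A, hA, h⟩ := hf
  obtain ⟨N, hN⟩ := S.lower_locally_nilpotent v
  refine ⟨l, s + 1 + N, fun r τ => ∑ q ∈ Finset.range (s + 1) ×ˢ Finset.range N,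
    if q.1 + q.2 = r then (A q.1 τ * (q.2.factorial : ℂ)⁻¹) • (S.rho sl2Lower ^ q.2) v else 0,
    fun r => ⟨fun τ => ?_, fun φ => ?_⟩, fun γ τ => ?_⟩
  · refine Submodule.sum_mem _ fun q _ => ?_
    split_ifs
    · exact Submodule.smul_mem _ _ (S.grading_le_truncation (by omega) (S.lower_pow_mem hv q.2))
    · exact Submodule.zero_mem _
  · have : (fun τ => φ (∑ q ∈ Finset.range (s + 1) ×ˢ Finset.range N, if q.1 + q.2 = r then
        (A q.1 τ * (q.2.factorial : ℂ)⁻¹) • (S.rho sl2Lower ^ q.2) v else 0)) =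
        ∑ q ∈ Finset.range (s + 1) ×ˢ Finset.range N, if q.1 + q.2 = r then
          ((q.2.factorial : ℂ)⁻¹ * φ ((S.rho sl2Lower ^ q.2) v)) • A q.1 else 0 := by
      ext τ
      rw [map_sum, Finset.sum_apply]
      refine Finset.sum_congr rfl fun q _ => ?_
      split_ifs
      · rw [map_smul, Pi.smul_apply, smul_eq_mul, smul_eq_mul]
        ring
      · rw [map_zero, Pi.zero_apply]
    rw [this]
    exact .sum _ _ fun q _ => ((hA _).smul _).ite _
  · rw [← sum_pow_add_smul (cocycleX γ τ) (s + 1) N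
      fun p n => (A p τ * (n.factorial : ℂ)⁻¹) • (S.rho sl2Lower ^ n) v, slash, valuedMap_tmul,
      map_smul, cocycleInv_eq, Module.End.mul_apply, S.powL0_apply _ hv, map_smul,
      S.expL1_apply hN, smul_smul, smul_smul]
    have hd := denom_ne_zero (γ : GL (Fin 2) ℝ) τ
    have h' := h γ τ
    change ((f : ℍ → ℂ) ∣[2 * k] γ) τ = _ at h'
    rw [QuasiModular.slash_apply] at h'
    have hw : denom γ τ ^ (-(2 * m)) * ((f : ℍ → ℂ) (γ • τ) * (denom γ τ ^ (2 : ℤ)) ^ l) =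
        (f : ℍ → ℂ) (γ • τ) * denom γ τ ^ (-(2 * k)) := by
      rw [← zpow_mul, mul_left_comm, ← zpow_add₀ hd, ← hkl]
      congr 2
      ring
    rw [mul_assoc, hw, h', Finset.sum_smul]
    refine Finset.sum_congr rfl fun p _ => ?_
    rw [Finset.smul_sum]
    refine Finset.sum_congr rfl fun n _ => ?_
    rw [smul_smul, smul_smul, pow_add, smul_eq_mul]
    congr 1
    ring

/-! ### Coordinates of a valued form and surjectivity. -/

/-- A basis of a homogeneous space. -/
def homogeneousBasis (l : ℤ) :
    Module.Basis (Fin (Module.finrank ℂ (S.grading l))) ℂ (S.grading l) :=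
  have := S.finiteDimensional l
  Module.finBasis ℂ (S.grading l)

/-- A basis of homogeneous states. -/
def gradedBasis :
    Module.Basis (Σ l : ℤ, Fin (Module.finrank ℂ (S.grading l))) ℂ V :=
  S.internal.collectedBasis S.homogeneousBasis

theorem gradedBasis_mem (κ : Σ l : ℤ, Fin (Module.finrank ℂ (S.grading l))) :
    S.gradedBasis κ ∈ S.grading κ.1 :=
  S.internal.collectedBasis_mem S.homogeneousBasis κ

theorem gradedBasis_coord_eq_zero (κ : Σ l : ℤ, Fin (Module.finrank ℂ (S.grading l))) {l : ℤ}
    (hl : l ≠ κ.1) {v : V} (hv : v ∈ S.grading l) : S.gradedBasis.coord κ v = 0 :=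
  S.internal.collectedBasis_repr_of_mem_ne S.homogeneousBasis hl hv

theorem gradedBasis_coord_powL0 (κ : Σ l : ℤ, Fin (Module.finrank ℂ (S.grading l))) (z : ℂ)
    (v : V) : S.gradedBasis.coord κ (S.powL0 z v) = z ^ κ.1 * S.gradedBasis.coord κ v := by
  induction v using S.grading_induction with
  | h0 => simp only [map_zero, mul_zero]
  | hadd x y hx hy => simp only [map_add, hx, hy, mul_add]
  | hmem l v hv =>
    rw [S.powL0_apply z hv, map_smul, smul_eq_mul]
    by_cases h : l = κ.1
    · rw [h]
    · rw [S.gradedBasis_coord_eq_zero κ h hv, mul_zero, mul_zero]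

theorem gradedBasis_coord_eq_zero_of_lt (κ : Σ l : ℤ, Fin (Module.finrank ℂ (S.grading l)))
    {N : ℤ} (hN : N < κ.1) {v : V} (hv : v ∈ S.truncation N) : S.gradedBasis.coord κ v = 0 := by
  have h : S.truncation N ≤ LinearMap.ker (S.gradedBasis.coord κ) :=
    iSup_le fun l v hv => S.gradedBasis_coord_eq_zero κ (by have := l.2; omega) hv
  exact h hv

/-- The coordinates of a form are quasi-modular. -/
theorem coord_mem_quasiModularForms {m : ℤ} {f : ℍ → V} (hf : f ∈ S.valuedForms m)
    (κ : Σ l : ℤ, Fin (Module.finrank ℂ (S.grading l))) :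
    (fun τ => S.gradedBasis.coord κ (f τ)) ∈ quasiModularForms (m - 2 * κ.1) := by
  obtain ⟨N, s, A, hA, h⟩ := hf
  obtain ⟨R, hR⟩ := S.exists_lower_pow_eq_zero N
  -- The contribution of A p to X^(p+n) once exp(−X L(1)) has been applied.
  let B (p n : ℕ) : ℍ → ℂ := ((-1) ^ n / n.factorial : ℂ) •
    fun τ => (S.gradedBasis.coord κ ∘ₗ S.rho sl2Lower ^ n) (A p τ)
  refine ⟨s + 1 + R, fun r => ∑ q ∈ Finset.range (s + 1) ×ˢ Finset.range R,
    if q.1 + q.2 = r then B q.1 q.2 else 0,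
    fun r => .sum _ _ fun q _ => (((hA q.1).2 _).smul _).ite _, fun γ τ => ?_⟩
  have hd := denom_ne_zero (γ : GL (Fin 2) ℝ) τ
  -- Applying exp(−X L(1)) leaves only j^(2L(0)) on the left, which acts on the coordinate κ by the
  -- scalar j^(2 κ.1).
  have h1 := congrArg (fun v => S.gradedBasis.coord κ (S.expL1 (-cocycleX γ τ) v)) (h γ τ)
  rw [slash, cocycleInv_eq, map_smul, ← Module.End.mul_apply, ← mul_assoc, expL1_mul,
    neg_add_cancel, expL1_zero, one_mul, map_smul, gradedBasis_coord_powL0, smul_eq_mul,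
    ← mul_assoc, ← zpow_mul, ← zpow_add₀ hd] at h1
  rw [QuasiModular.slash_apply, mul_comm, show -(m - 2 * κ.1) = -m + 2 * κ.1 by ring, h1]
  have h2 := sum_pow_add_smul (cocycleX γ τ) (s + 1) R fun p n => B p n τ
  have h3 (r : ℕ) : (∑ q ∈ Finset.range (s + 1) ×ˢ Finset.range R,
      if q.1 + q.2 = r then B q.1 q.2 else 0) τ =
      ∑ q ∈ Finset.range (s + 1) ×ˢ Finset.range R,
        if q.1 + q.2 = r then B q.1 q.2 τ else 0 := by
    rw [Finset.sum_apply]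
    refine Finset.sum_congr rfl fun q _ => ?_
    split_ifs <;> rfl
  simp only [h3]
  rw [← h2, map_sum, map_sum]
  refine Finset.sum_congr rfl fun p _ => ?_
  rw [map_smul, map_smul, S.expL1_apply fun n hn => hR n hn _ ((hA p).1 τ), map_sum,
    Finset.smul_sum]
  refine Finset.sum_congr rfl fun n _ => ?_
  rw [map_smul, smul_smul, pow_add]
  change _ = (cocycleX γ τ ^ p * cocycleX γ τ ^ n) • (((-1) ^ n / n.factorial : ℂ) •
    S.gradedBasis.coord κ ((S.rho sl2Lower ^ n) (A p τ)))
  rw [smul_smul]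
  congr 1
  rw [neg_pow]
  ring

theorem apply_mem_truncation {m : ℤ} {f : ℍ → V} (hf : f ∈ S.valuedForms m) :
    ∃ N, ∀ τ, f τ ∈ S.truncation N := by
  obtain ⟨N, s, A, hA, h⟩ := hf
  refine ⟨N, fun τ => ?_⟩
  have h1 := h 1 τ
  rw [slash, cocycleInv_eq, cocycleX_one, expL1_zero, one_mul] at h1
  have h2 : denom (1 : SL(2, ℤ)) τ = 1 := by simp
  rw [h2, one_zpow, one_zpow, powL0_one, one_smul, one_smul, Module.End.one_apply] at h1
  rw [h1]
  exact Submodule.sum_mem _ fun n _ => Submodule.smul_mem _ _ ((hA n).1 τ)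

/-- A form is a finite sum of its components. -/
theorem exists_eq_sum_coord {m : ℤ} {f : ℍ → V} (hf : f ∈ S.valuedForms m) :
    ∃ K : Finset (Σ l : ℤ, Fin (Module.finrank ℂ (S.grading l))),
      ∀ τ, f τ = ∑ κ ∈ K, S.gradedBasis.coord κ (f τ) • S.gradedBasis κ := by
  obtain ⟨N, hN⟩ := S.apply_mem_truncation hf
  obtain ⟨B, hB⟩ := S.bounded_below
  -- Below B there are no basis vectors, and above N the coordinates of values in the truncation
  -- vanish.
  refine ⟨(Finset.Icc B N).sigma fun _ => Finset.univ, fun τ => ?_⟩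
  have h := S.gradedBasis.linearCombination_repr (f τ)
  rw [Finsupp.linearCombination_apply] at h
  refine h.symm.trans (Finsupp.sum_of_support_subset _ (fun κ hκ => ?_) _ fun κ _ => zero_smul _ _)
  rw [Finset.mem_sigma, Finset.mem_Icc]
  refine ⟨⟨?_, ?_⟩, Finset.mem_univ _⟩
  · by_contra hlt
    have := κ.2
    rw [hB κ.1 (by omega), finrank_bot] at this
    exact this.elim0
  · by_contra hlt
    exact Finsupp.mem_support_iff.1 hκ
      (S.gradedBasis_coord_eq_zero_of_lt κ (by omega) (hN τ))

theorem eq_zero_of_mem_valuedForms_odd {m : ℤ} (hm : Odd m) {f : ℍ → V}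
    (hf : f ∈ S.valuedForms m) : f = 0 := by
  obtain ⟨K, hK⟩ := S.exists_eq_sum_coord hf
  ext τ
  rw [hK τ]
  refine Finset.sum_eq_zero fun κ _ => ?_
  have h := eq_zero_of_mem_odd (hm.sub_even (even_two_mul κ.1)) (S.coord_mem_quasiModularForms hf κ)
  have h' : S.gradedBasis.coord κ (f τ) = 0 := congrFun h τ
  rw [h', zero_smul]

theorem map_valuedMap (k : ℤ) :
    (tensorGrading quasiModularDegree S.grading k).map valuedMap = S.valuedForms (2 * k) := by
  refine le_antisymm ?_ fun f hf => ?_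
  · rw [Submodule.map_le_iff_le_comap]
    exact tensorGrading_le fun p q hpq a ha b hb => S.valuedMap_tmul_mem hpq ha hb
  · obtain ⟨K, hK⟩ := S.exists_eq_sum_coord hf
    have h (κ) := S.coord_mem_quasiModularForms hf κ
    simp only [← mul_sub] at h
    -- The coordinate at κ has degree k − κ.1 in Q and the basis vector has degree κ.1 in V, so each
    -- tensor has degree k.
    refine ⟨∑ κ ∈ K, (⟨_, quasiModularForms_le _ (h κ)⟩ : quasiModularAlgebra) ⊗ₜ
      S.gradedBasis κ, Submodule.sum_mem _ fun κ _ => ?_, ?_⟩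
    · exact tmul_mem_tensorGrading (sub_add_cancel k κ.1) (h κ) (S.gradedBasis_mem κ)
    · ext τ
      rw [map_sum, Finset.sum_apply, hK τ]
      rfl

theorem range_valuedMap : LinearMap.range (valuedMap (V := V)) = S.valuedFormSpace := by
  have hQ : ⨆ k, quasiModularDegree k = ⊤ := by
    simp only [← quasiModularSL2_grading]
    exact quasiModularSL2.iSup_grading
  rw [LinearMap.range_eq_map, ← iSup_tensorGrading hQ (SL2Algebra.iSup_grading_eq_top S),
    Submodule.map_iSup]
  exact iSup_congr fun k => S.map_valuedMap k

/-- Quasi-modular forms with values in `V` are the elements of the tensor product. -/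
def valuedEquiv : quasiModularAlgebra ⊗[ℂ] V ≃ₗ[ℂ] S.valuedFormSpace :=
  (LinearEquiv.ofInjective valuedMap valuedMap_injective).trans
    (LinearEquiv.ofEq _ _ S.range_valuedMap)

theorem map_valuedEquiv (k : ℤ) :
    (tensorGrading quasiModularSL2.grading S.grading k).map
      (S.valuedEquiv : quasiModularAlgebra ⊗[ℂ] V →ₗ[ℂ] S.valuedFormSpace) =
      S.valuedWeight (2 * k) := by
  have h : quasiModularSL2.grading = quasiModularDegree := funext quasiModularSL2_grading
  rw [h, valuedWeight, ← S.map_valuedMap k]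
  ext f
  constructor
  · rintro ⟨x, hx, rfl⟩
    exact ⟨x, hx, rfl⟩
  · rintro ⟨x, hx, h⟩
    exact ⟨x, hx, Subtype.ext h⟩

/-- The doubled quasi-vertex operator algebra of quasi-modular forms with values in `V`. -/
def valuedDoubledQVOA : DoubledQVOA S.valuedFormSpace where
  toQVOA := (quasiModularSL2.tensorQVOA S).transport S.valuedEquiv
  weight := S.valuedWeight
  weight_even n := (S.map_valuedEquiv n).symm
  weight_odd _ hm := (Submodule.eq_bot_iff _).2 fun _ hf =>
    Subtype.ext (S.eq_zero_of_mem_valuedForms_odd hm hf)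

end QVOA

/-! ### Agreement with the tensor product formula. -/

namespace SL2Algebra

variable {U V : Type*} [CommRing U] [Algebra ℂ U] [Nontrivial U] [AddCommGroup V] [Module ℂ V]
  (A : SL2Algebra U) (S : QVOA V)

/-- The nonnegative modes of the commutative factor vanish and its mode −i−1 is multiplication by
the i-th divided power. So the sum over ℤ in the tensor product reduces to the sum over i ∈ ℕ used
in the construction. -/
theorem isTensorQVOA_tensorQVOA : IsTensorQVOA A.qvoa S (A.tensorQVOA S) where
  vac := by
    rw [qvoa_vac]
    rfl
  mode a c b d n := by
    obtain ⟨R, hR⟩ := S.exists_mode_eq_zero b d n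
    rw [tensorQVOA_mode, A.tmode_tmul S n a c b d R hR]
    have hinj : Function.Injective fun i : ℕ => -(i : ℤ) - 1 := fun i j h => by
      dsimp only at h
      omega
    rw [finsum_eq_sum_of_support_subset (s := (Finset.range R).map ⟨_, hinj⟩),
      Finset.sum_map]
    · refine Finset.sum_congr rfl fun i _ => ?_
      rw [Function.Embedding.coeFn_mk, qvoa_mode_neg,
        show n - 1 - (-(i : ℤ) - 1) = n + i by ring]
    · intro i hi
      rw [Finset.coe_map, Function.Embedding.coeFn_mk, Finset.coe_range]
      obtain h | h := le_or_gt 0 i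
      · refine absurd ?_ hi
        dsimp only
        rw [A.qvoa_mode_nonneg a c i h, TensorProduct.zero_tmul]
      · refine ⟨(-i - 1).toNat, ?_, by dsimp only; omega⟩
        by_contra h'
        refine hi ?_
        have := hR (-i - 1).toNat (by simpa using h')
        rw [show n + ((-i - 1).toNat : ℤ) = n - 1 - i by omega] at this
        dsimp only
        rw [this, TensorProduct.tmul_zero]
  grading n := by
    simp only [qvoa_grading]
    rfl
  rho x := by
    rw [qvoa_rho]
    rfl

end SL2Algebra

end

theorem mainTheorem7 :
    -- `Q` is the polynomial algebra on the Eisenstein series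
    Function.Injective eisensteinEval ∧
    eisensteinEval.range = quasiModularAlgebra ∧
    -- the quasi-vertex operator algebra on the regraded algebra
    ∃ R : QVOA quasiModularAlgebra,
      R.vac = 1 ∧
      (∀ k : ℤ, R.grading k = quasiModularDegree k) ∧
      (∀ (f g : quasiModularAlgebra) (n : ℤ), 0 ≤ n → R.mode f n g = 0) ∧
      (∀ (f g : quasiModularAlgebra) (n : ℕ),
        (R.mode f (-n - 1) g : ℍ → ℂ) =
          ((n.factorial : ℂ)⁻¹ • Derivative.normalizedDerivOfComplex^[n] f) * g) ∧
      (∀ (k : ℤ) (f : quasiModularAlgebra), f ∈ quasiModularDegree k →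
        R.rho sl2Euler f = (k : ℂ) • f) ∧
      (∀ f : quasiModularAlgebra,
        (R.rho sl2Raise f : ℍ → ℂ) = Derivative.normalizedDerivOfComplex f) ∧
      (∀ (p : MvPolynomial (Fin 3) ℂ) (f : quasiModularAlgebra), eisensteinEval p = f →
        (R.rho sl2Lower f : ℍ → ℂ) = (12 : ℂ) • eisensteinEval (MvPolynomial.pderiv 0 p)) ∧
      -- the doubled quasi-vertex operator algebra `Q(V)`
      ∀ {V : Type*} [AddCommGroup V] [Module ℂ V] (S : QVOA V),
        ∃ (T : QVOA (quasiModularAlgebra ⊗[ℂ] V)) (W : DoubledQVOA S.valuedFormSpace)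
          (ι : quasiModularAlgebra ⊗[ℂ] V ≃ₗ[ℂ] S.valuedFormSpace),
          IsTensorQVOA R S T ∧
          (∀ (f : quasiModularAlgebra) (v : V) (τ : ℍ),
            (ι (f ⊗ₜ[ℂ] v) : ℍ → V) τ = (f : ℍ → ℂ) τ • v) ∧
          IsQVOAIso T W.toQVOA ι ∧
          (∀ m : ℤ, W.weight m = S.valuedWeight m) := by
  refine ⟨QuasiModular.eisensteinEval_injective, QuasiModular.eisensteinEval_range,
    QuasiModular.quasiModularSL2.qvoa,
    QuasiModular.quasiModularSL2.qvoa_vac,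
    fun k => (QuasiModular.quasiModularSL2.qvoa_grading k).trans
      (QuasiModular.quasiModularSL2_grading k),
    fun f g n hn => QuasiModular.quasiModularSL2.qvoa_mode_nonneg f g n hn, fun f g n => ?_,
    fun k f hf => ?_, fun f => ?_, fun p f hp => ?_, fun {V} _ _ S =>
      ⟨QuasiModular.quasiModularSL2.tensorQVOA S,
      S.valuedDoubledQVOA, S.valuedEquiv, QuasiModular.quasiModularSL2.isTensorQVOA_tensorQVOA S,
      fun f v τ => rfl,
      (QuasiModular.quasiModularSL2.tensorQVOA S).isQVOAIso_transport S.valuedEquiv,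
      fun m => rfl⟩⟩
  · rw [SL2Algebra.qvoa_mode_neg, ← QuasiModular.quasiModularSL2_dpow]
    rfl
  · rw [SL2Algebra.qvoa_rho, SL2Algebra.rho_euler]
    exact QuasiModular.quasiModularSL2.euler_apply (by rwa [QuasiModular.quasiModularSL2_grading])
  · rw [SL2Algebra.qvoa_rho, SL2Algebra.rho_raise]
    exact QuasiModular.quasiModularSL2_raise f
  · rw [SL2Algebra.qvoa_rho, SL2Algebra.rho_lower]
    exact QuasiModular.quasiModularSL2_lower p f hp
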